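/- Let $S$ be a scheme, let $n\ge 1$, and let $U$ be an essentially smooth henselian local scheme over $S$ of relative dimension $n$, that is, $U\cong X^h_{x}$ is the henselization at a point $x$ of a smooth $S$-scheme $X$ of relative dimension $n$. Let $x$ also denote the closed point of $U$, let $\sigma\in S$ be its image, and assume that the residue field extension $k(x)/k(\sigma)$ is finite and generated by one element (for example, finite separable). Let $Z\subset U$ be a closed subscheme of positive relative codimension, i.e. $\operatorname{codim}_{U_\sigma} Z_\sigma>0$, where $U_\sigma=U\times_S\sigma$ and $Z_\sigma=Z\times_S\sigma$ (the empty set has codimension $\infty$). Let $S'=(\mathbb A^{n-1}_S)^h_0$ be the henselization of $\mathbb A^{n-1}_S$ at the origin $0$ of the fibre $\mathbb A^{n-1}_{\sigma}$. Then there is a morphism of $S$-schemes $\pi\colon U\to\mathbb A^1_{S'}$ such that 1. $\pi$ is (essentially) étale: $U$ is, over $\mathbb A^1_{S'}$, the henselization at a point of an étale $\mathbb A^1_{S'}$-scheme; 2. $\pi$ induces an isomorphism $Z\simeq\pi(Z)$, where $\pi(Z)\subset\mathbb A^1_{S'}$ is the (closed) scheme-theoretic image of $Z$; 3. $\pi(Z)$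 is finite over $S'$. -/

import Mathlib

open AlgebraicGeometry CategoryTheory CategoryTheory.Limits

universe u

noncomputable section

/-! ### The henselization of a local ring

For a local ring `R` with residue field `κ`, the henselization is the colimit of the étale
neighbourhoods of the closed point with trivial residue field extension, that is of the pairs
`(B, φ)` with `B` an étale `R`-algebra and `φ : B → κ` an `R`-algebra map. The standard étale
neighbourhoods `R[X]_g / (f)` are cofinal among all of them, and they form a small category. -/

/-- A standard étale neighbourhood of the closed point of the local ring `R`, with trivial
extension of the residue field: a standard étale `R`-algebra and an `R`-algebra map from it to the
residue field of `R` (equivalently, a prime over the maximal ideal with residue field that of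
`R`). -/
structure EtaleNhd (R : Type u) [CommRing R] [IsLocalRing R] where
  /-- the pair `(f, g)` that defines the standard étale algebra `R[X]_g / (f)` -/
  pair : StandardEtalePair R
  /-- the point over the closed point of `R` -/
  point : pair.Ring →ₐ[R] IsLocalRing.ResidueField R

namespace EtaleNhd

variable {R : Type u} [CommRing R] [IsLocalRing R]

/-- A morphism of étale neighbourhoods (in the direction of rings): an `R`-algebra map that is
compatible with the chosen points. -/
@[ext]
structure Hom (A B : EtaleNhd R) where
  /-- the underlying algebra map -/
  map : A.pair.Ring →ₐ[R] B.pair.Ring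
  comp_map : B.point.comp map = A.point

/-- The identity morphism. -/
def Hom.id (A : EtaleNhd R) : Hom A A where
  map := AlgHom.id R A.pair.Ring
  comp_map := AlgHom.comp_id A.point

/-- The composition of morphisms. -/
def Hom.comp {A B C : EtaleNhd R} (f : Hom A B) (g : Hom B C) : Hom A C where
  map := g.map.comp f.map
  comp_map := ((AlgHom.comp_assoc C.point g.map f.map).symm.trans
    (congrArg (fun k => k.comp f.map) g.comp_map)).trans f.comp_map

instance : Category (EtaleNhd R) where
  Hom A B := Hom A B
  id A := Hom.id A
  comp f g := Hom.comp f g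
  id_comp f := Hom.ext (AlgHom.comp_id f.map)
  comp_id f := Hom.ext (AlgHom.id_comp f.map)
  assoc f g h := Hom.ext (AlgHom.comp_assoc h.map g.map f.map).symm

variable (R) in
/-- The diagram of rings given by the étale neighbourhoods. -/
def ringFunctor : EtaleNhd R ⥤ CommRingCat.{u} where
  obj A := CommRingCat.of A.pair.Ring
  map f := CommRingCat.ofHom f.map.toRingHom

variable (R) in
/-- The étale neighbourhood `R` itself, presented as `R[X]_1 / (X)`. -/
def base : EtaleNhd R where
  pair :=
    { f := Polynomial.X
      monic_f := Polynomial.monic_X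
      g := 1
      cond := ⟨1, 0, 0, by simp⟩ }
  point := StandardEtalePair.lift _ 0 ⟨by simp, by simp⟩

end EtaleNhd

/-- The henselization of the local ring `R`. -/
def localHenselization (R : Type u) [CommRing R] [IsLocalRing R] : CommRingCat.{u} :=
  colimit (EtaleNhd.ringFunctor R)

/-- The canonical map from a local ring to its henselization. -/
def toLocalHenselization (R : Type u) [CommRing R] [IsLocalRing R] :
    CommRingCat.of R ⟶ localHenselization R :=
  CommRingCat.ofHom (algebraMap R (EtaleNhd.base R).pair.Ring) ≫
    colimit.ι (EtaleNhd.ringFunctor R) (EtaleNhd.base R)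

/-! ### Henselizations of schemes at points -/

/-- The henselization `X^h_x` of the scheme `X` at the point `x`. -/
def henselizationAt (X : Scheme.{u}) (x : X) : Scheme.{u} :=
  Spec (localHenselization (X.presheaf.stalk x))

/-- The canonical morphism `X^h_x ⟶ X`. -/
def fromHenselizationAt (X : Scheme.{u}) (x : X) : henselizationAt X x ⟶ X :=
  Spec.map (toLocalHenselization (X.presheaf.stalk x)) ≫ X.fromSpecStalk x

/-- The morphism `j : U ⟶ X` exhibits `U` as the henselization of `X` at the point `x`. -/
def IsHenselizationAt {U X : Scheme.{u}} (j : U ⟶ X) (x : X) : Prop :=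
  ∃ e : U ≅ henselizationAt X x, e.hom ≫ fromHenselizationAt X x = j

/-- `U` is an essentially smooth henselian local scheme over `S`, of relative dimension `n`:
it is the henselization at a point of a smooth `S`-scheme of relative dimension `n`. -/
def IsEssSmoothHenselianLocal (n : ℕ) {U S : Scheme.{u}} (q : U ⟶ S) : Prop :=
  ∃ (X : Scheme.{u}) (p : X ⟶ S) (x : X) (j : U ⟶ X),
    SmoothOfRelativeDimension n p ∧ IsHenselizationAt j x ∧ j ≫ p = q

/-- The morphism `π : U ⟶ Y` from a henselian local scheme is (essentially) étale:
`U` is, over `Y`, the henselization at a point of an étale `Y`-scheme. -/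
def IsEssEtaleHenselianLocal {U Y : Scheme.{u}} (π : U ⟶ Y) : Prop :=
  ∃ (V : Scheme.{u}) (h : V ⟶ Y) (v : V) (j : U ⟶ V),
    Etale h ∧ IsHenselizationAt j v ∧ j ≫ h = π

/-! ### Codimension, residue fields, affine spaces -/

/-- The codimension in the scheme `X` of a (closed) subset `T`: the infimum over the points
`t ∈ T` of the codimension of the closure of `t`, i.e. of the Krull dimension of the local ring
of `X` at `t`. It is `⊤` if `T` is empty. -/
def codimIn (X : Scheme.{u}) (T : Set X) : ℕ∞ :=
  ⨅ t ∈ T, Order.coheight t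

/-- A field extension `k → K` that is finite and generated by one element. -/
def IsFiniteSimpleExtension {k K : Type u} [Field k] [Field K] (φ : k →+* K) : Prop :=
  letI : Algebra k K := φ.toAlgebra
  Module.Finite k K ∧ ∃ α : K, IntermediateField.adjoin k {α} = ⊤

/-- The affine space `𝔸^m_S`. -/
abbrev affineSpace (m : ℕ) (S : Scheme.{u}) : Scheme.{u} :=
  𝔸(ULift.{u} (Fin m); S)

/-- The projection `𝔸^m_S ⟶ S`. -/
abbrev affineSpaceProj (m : ℕ) (S : Scheme.{u}) : affineSpace m S ⟶ S :=
  𝔸(ULift.{u} (Fin m); S) ↘ S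

/-- The zero section of `𝔸^m_S ⟶ S`. -/
def zeroSection (m : ℕ) (S : Scheme.{u}) : S ⟶ affineSpace m S :=
  AffineSpace.homOfVector (𝟙 S) 0

/-- The henselization `(𝔸^m_S)^h_0` of `𝔸^m_S` at the origin `0` of the fibre over `s`. -/
abbrev henselAffineSpace (m : ℕ) (S : Scheme.{u}) (s : S) : Scheme.{u} :=
  henselizationAt (affineSpace m S) (zeroSection m S s)

/-- The canonical morphism `(𝔸^m_S)^h_0 ⟶ S`. -/
abbrev henselAffineSpaceProj (m : ℕ) (S : Scheme.{u}) (s : S) : henselAffineSpace m S s ⟶ S :=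
  fromHenselizationAt (affineSpace m S) (zeroSection m S s) ≫ affineSpaceProj m S

end

/-!
The construction is local, so `U` is the spectrum of a henselian local ring `A`, the henselization
of a standard smooth algebra `R` over the coordinate ring `D` of an affine chart of `S`. Let `σ` be
the prime of `D` under the closed point, and `Λ` the henselization of `D[T₁, …, Tₘ]` at the origin
over `σ`, where the relative dimension is `m + 1`.

*The universal property.* The colimit that defines the henselization is replaced by the universal
property `IsHenselUniversal`, and by the fact that finitely many elements come from an étale
neighbourhood (`IsHenselUniversal.exists_local_rep_finite`). The property says that a map from `M`
to a henselian local ring `H` that sends the closed point to the right prime of `M` extends uniquely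
to a local homomorphism `A → H`. It holds for the map from a local ring to its henselization
(`IsHenselUniversal.toLocalHenselization`) and for the local ring of an étale algebra at a point
without residue field extension (`IsHenselUniversal.of_isEtaleAt`), it is stable under composition,
and it determines a henselian local ring (`IsHenselUniversal.exists_ringEquiv`). In particular a map
from an affine line over `Λ` to `A` is essentially étale in the required sense as soon as it is
universal.

*Étale coordinates.* As the residue field `κ(x)` is generated over `κ(σ)` by one element, there are
elements `b, t₁, …, tₘ` of `R` such that the class of `b` generates `κ(x)`, the `tᵢ` vanish at `x`,
and all their differentials together are a basis of the module of differentials at `x`. They define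
a map from a polynomial ring over `D` to `R` that is étale at `x` without extension of the residue
field, so that `A` is the henselization of an affine space (`exists_isEtaleAt_mvPolynomial`,
`IsHenselUniversal.exists_mvPolynomial_comp`).

*Choice of the projection.* Since `Z` has positive codimension in the fibre, some equation `g` of
`Z` does not vanish on the fibre (`exists_mem_notMem_map_comap_of_codimIn_pos`). Let `F` be a
polynomial over `D` that lifts a nonzero scalar multiple of the minimal polynomial of the class of
`b`. The curves `tᵢ = F(b) ^ eᵢ` in the fibre are regular with parameter `F(b)`, and by Krull's
intersection theorem `g` cannot vanish on all of them (`exists_notMem_span_image_sub_pow`). On a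
curve where it does not vanish, `g` is the product of a unit and a power of `F(b)`
(`IsHenselUniversal.exists_sub_mul_pow_mem`). The automorphism `MvPolynomial.translateEquiv` makes
the differences `tᵢ - F(b) ^ eᵢ` the new coordinates. They define a local homomorphism `Λ → A`, for
which `A` is a henselization of the affine line over `Λ` with coordinate `b`
(`IsHenselUniversal.eval₂RingHom`), and the chosen curve is the closed fibre.

*Finiteness.* The closed fibre of `A / (g)` over `Λ` is therefore finite and generated by `b`. By
Zariski's main theorem a local algebra essentially of finite type over a henselian local ring is
finite if its closed fibre is (`Module.Finite.of_henselianLocalRing`); this applies to a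
representative of `A / (g)` that is essentially of finite type. By Nakayama's lemma the map from
`Λ[X]` to `A / (g)` is then surjective
(`IsHenselUniversal.finite_quotient_and_exists_dvd_sub_aeval`). Hence the closed subscheme `Z` of
the zero locus of `g` is mapped isomorphically to a closed subscheme of the affine line that is
finite over `Λ` (`exists_hom_affineSpace_of_isHenselUniversal`).
-/

open IsLocalRing EtaleNhd

/-! ### Lifting points of étale algebras over henselian local rings -/

section EtaleLift

open TensorProduct

/-- The equalizer of two algebra maps out of an unramified algebra is open: if two maps agree after
composition with `ρ`, they agree after multiplication with an element that `ρ` sends to `1`. -/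
theorem Algebra.FormallyUnramified.exists_mul_eq_mul_of_comp_eq {R E B T : Type*} [CommRing R]
    [CommRing E] [CommRing B] [CommRing T] [Algebra R E] [Algebra R B]
    [Algebra.FormallyUnramified R E] [Algebra.EssFiniteType R E] (f g : E →ₐ[R] B) (ρ : B →+* T)
    (h : ∀ a, ρ (f a) = ρ (g a)) : ∃ ε : B, ρ ε = 1 ∧ ∀ a, f a * ε = g a * ε := by
  obtain ⟨t, ht, ht1⟩ :=
    (Algebra.FormallyUnramified.iff_exists_tensorProduct (R := R) (S := E)).mp inferInstance
  -- `t` is the idempotent that defines the diagonal; where `f` and `g` agree, it becomes `1`.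
  let F : E ⊗[R] E →ₐ[R] B := Algebra.TensorProduct.productMap f g
  refine ⟨F t, ?_, fun a => ?_⟩
  · have key : ρ.comp F.toRingHom =
        (ρ.comp f.toRingHom).comp (Algebra.TensorProduct.lmul' R (S := E)).toRingHom := by
      ext x
      · simp [F]
      · simp [F, h]
    have := congrArg (fun k : E ⊗[R] E →+* T => k t) key
    simpa [ht1] using this
  · have := congrArg F (ht a)
    simp only [F, map_mul, map_sub, map_zero, Algebra.TensorProduct.productMap_apply_tmul, map_one,
      one_mul, mul_one, sub_mul] at this
    exact (sub_eq_zero.mp this).symm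

/-- Two maps from an unramified algebra to a local ring that agree at the closed point are equal. -/
theorem Algebra.FormallyUnramified.algHom_eq_of_residue_eq {R E B : Type*} [CommRing R]
    [CommRing E] [CommRing B] [IsLocalRing B] [Algebra R E] [Algebra R B]
    [Algebra.FormallyUnramified R E] [Algebra.EssFiniteType R E] (f g : E →ₐ[R] B)
    (h : ∀ a, IsLocalRing.residue B (f a) = IsLocalRing.residue B (g a)) : f = g := by
  obtain ⟨ε, hε, H⟩ := exists_mul_eq_mul_of_comp_eq f g (IsLocalRing.residue B) h
  have hu : IsUnit ε := by
    rw [← IsLocalRing.residue_ne_zero_iff_isUnit, hε]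
    exact one_ne_zero
  ext a
  exact hu.mul_left_injective (H a)

/-- A point of an étale algebra over a field-valued point is contained in a standard étale open. -/
theorem Algebra.Etale.exists_isStandardEtale_lift {R E κ : Type*} [CommRing R] [CommRing E]
    [Field κ] [Algebra R E] [Algebra R κ] [Algebra.Etale R E] (ψ : E →ₐ[R] κ) :
    ∃ (f : E) (_ : Algebra.IsStandardEtale R (Localization.Away f))
      (ψ' : Localization.Away f →ₐ[R] κ), ∀ a, ψ' (algebraMap E _ a) = ψ a := by
  have hp : (RingHom.ker ψ.toRingHom).IsPrime := RingHom.ker_isPrime _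
  have : Algebra.IsEtaleAt R (RingHom.ker ψ.toRingHom) :=
    Algebra.FormallyEtale.comp R E _
  obtain ⟨f, hf, hst⟩ := Algebra.IsEtaleAt.exists_isStandardEtale (R := R)
    (RingHom.ker ψ.toRingHom)
  have hfu : IsUnit (ψ f) := by
    rw [isUnit_iff_ne_zero]
    exact fun h => hf h
  exact ⟨f, hst, IsLocalization.Away.liftAlgHom f (f := ψ) hfu,
    fun a => IsLocalization.Away.lift_eq f (S := Localization.Away f) (g := ψ.toRingHom) hfu a⟩

/-- Over a henselian local ring, a rational point of the closed fibre of an étale algebra lifts. -/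
theorem HenselianLocalRing.exists_algHom_of_etale {H E : Type*} [CommRing H]
    [HenselianLocalRing H] [CommRing E] [Algebra H E] [Algebra.Etale H E]
    (ψ : E →ₐ[H] IsLocalRing.ResidueField H) :
    ∃ s : E →ₐ[H] H, ∀ a, IsLocalRing.residue H (s a) = ψ a := by
  obtain ⟨f, ⟨⟨P⟩⟩, ψ', hψ'⟩ := Algebra.Etale.exists_isStandardEtale_lift ψ
  -- The point is a simple root of the equation of the standard étale algebra, and lifts as such.
  have hP : P.P.HasMap (ψ' P.x) := P.hasMap.map ψ'
  have hH := ((HenselianLocalRing.TFAE H).out 0 1 rfl rfl).mp inferInstance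
  obtain ⟨a, ha, ha0⟩ := hH P.f P.monic_f (ψ' P.x) hP.1 hP.isUnit_derivative_f.ne_zero
  have hres : (Algebra.ofId H (IsLocalRing.ResidueField H)) a = ψ' P.x := ha0
  have hPa : P.P.HasMap a := by
    refine ⟨by simpa [Polynomial.IsRoot, Polynomial.aeval_def] using ha, ?_⟩
    rw [← IsLocalRing.residue_ne_zero_iff_isUnit]
    have h2 := hP.2.ne_zero
    rw [← hres, Polynomial.aeval_algHom_apply] at h2
    exact h2
  let s' : Localization.Away f →ₐ[H] H := (P.P.lift a hPa).comp P.equivRing.toAlgHom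
  have hs' : (Algebra.ofId H (IsLocalRing.ResidueField H)).comp s' = ψ' := by
    have e : ((P.P.lift a hPa).comp P.equivRing.toAlgHom) P.x = a := by simp
    refine P.hom_ext ?_
    rw [AlgHom.comp_apply, e, hres]
  refine ⟨s'.comp (IsScalarTower.toAlgHom H E _), fun z => ?_⟩
  rw [← hψ', ← hs']
  rfl

/-- Maps from an étale algebra to a henselian local ring are the same as maps to its residue
field. -/
theorem HenselianLocalRing.existsUnique_algHom_of_etale {R H E : Type*} [CommRing R] [CommRing H]
    [HenselianLocalRing H] [CommRing E] [Algebra R H] [Algebra R E] [Algebra.Etale R E]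
    (ψ : E →ₐ[R] IsLocalRing.ResidueField H) :
    ∃! s : E →ₐ[R] H, ∀ a, IsLocalRing.residue H (s a) = ψ a := by
  obtain ⟨s, hs⟩ := HenselianLocalRing.exists_algHom_of_etale (H := H) (E := H ⊗[R] E)
    (Algebra.TensorProduct.lift (Algebra.ofId _ _) ψ fun _ _ => .all _ _)
  refine ⟨(s.restrictScalars R).comp Algebra.TensorProduct.includeRight, fun a => ?_,
    fun s' hs' => ?_⟩
  · simpa using hs (1 ⊗ₜ a)
  · refine Algebra.FormallyUnramified.algHom_eq_of_residue_eq _ _ fun a => ?_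
    rw [hs']
    simpa using (hs (1 ⊗ₜ a)).symm

end EtaleLift

/-! ### The henselization of a local ring is henselian and universal -/

namespace EtaleNhd

open IsLocalRing TensorProduct

variable {R : Type u} [CommRing R] [IsLocalRing R]

/-- Every étale algebra with a rational point over the closed point maps to a standard étale
neighbourhood. -/
theorem exists_of_etale {E : Type u} [CommRing E] [Algebra R E] [Algebra.Etale R E]
    (ψ : E →ₐ[R] ResidueField R) :
    ∃ (N : EtaleNhd R) (h : E →ₐ[R] N.pair.Ring), N.point.comp h = ψ := by
  obtain ⟨f, ⟨⟨P⟩⟩, ψ', hψ'⟩ := Algebra.Etale.exists_isStandardEtale_lift ψ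
  refine ⟨⟨P.P, ψ'.comp P.equivRing.symm.toAlgHom⟩,
    P.equivRing.toAlgHom.comp (IsScalarTower.toAlgHom R E _), AlgHom.ext fun a => ?_⟩
  simp [hψ']

/-- Étale neighbourhoods have upper bounds by tensor products, and two parallel maps agree after a
localization because they agree at the chosen points. -/
instance : IsFiltered (EtaleNhd R) where
  cocone_objs A B := by
    have : Algebra.Etale R (A.pair.Ring ⊗[R] B.pair.Ring) := .comp R A.pair.Ring _
    obtain ⟨N, h, hN⟩ := exists_of_etale (E := A.pair.Ring ⊗[R] B.pair.Ring)
      (Algebra.TensorProduct.productMap A.point B.point)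
    refine ⟨N, ⟨h.comp Algebra.TensorProduct.includeLeft, ?_⟩,
      ⟨h.comp Algebra.TensorProduct.includeRight, ?_⟩, trivial⟩
    · rw [← AlgHom.comp_assoc, hN, Algebra.TensorProduct.productMap_left]
    · rw [← AlgHom.comp_assoc, hN, Algebra.TensorProduct.productMap_right]
  cocone_maps A B f g := by
    obtain ⟨ε, hε, H⟩ := Algebra.FormallyUnramified.exists_mul_eq_mul_of_comp_eq f.map g.map
      B.point.toRingHom fun a => by
        have := congrArg (fun k => k a) (f.comp_map.trans g.comp_map.symm)
        exact this
    have : Algebra.Etale R (Localization.Away ε) := by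
      have : Algebra.Etale B.pair.Ring (Localization.Away ε) := .of_isLocalizationAway ε
      exact .comp R B.pair.Ring _
    have hu : IsUnit (B.point ε) := by
      rw [show B.point ε = 1 from hε]
      exact isUnit_one
    obtain ⟨N, h, hN⟩ := exists_of_etale (E := Localization.Away ε)
      (IsLocalization.Away.liftAlgHom ε (f := B.point) hu)
    refine ⟨N, ⟨h.comp (IsScalarTower.toAlgHom R B.pair.Ring _), ?_⟩, ?_⟩
    · rw [← AlgHom.comp_assoc, hN]
      exact AlgHom.ext fun a =>
        IsLocalization.Away.lift_eq ε (S := Localization.Away ε) (g := B.point.toRingHom) hu a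
    · refine Hom.ext (AlgHom.ext fun a => congrArg h ?_)
      exact (IsLocalization.Away.algebraMap_isUnit (S := Localization.Away ε) ε).mul_left_injective
        ((map_mul _ _ _).symm.trans ((congrArg _ (H a)).trans (map_mul _ _ _)))
  nonempty := ⟨base R⟩

end EtaleNhd

section Henselization

open IsLocalRing TensorProduct EtaleNhd

variable (R : Type u) [CommRing R] [IsLocalRing R]

/-- The map from an étale neighbourhood to the henselization. -/
noncomputable def EtaleNhd.toHenselization (N : EtaleNhd R) :
    N.pair.Ring →+* localHenselization R :=
  (colimit.ι (ringFunctor R) N).hom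

variable {R}

theorem EtaleNhd.toHenselization_comp_map {N N' : EtaleNhd R} (f : N ⟶ N') (a : N.pair.Ring) :
    N'.toHenselization R (f.map a) = N.toHenselization R a :=
  congrArg (fun k => k.hom a) (colimit.w (ringFunctor R) f)

theorem EtaleNhd.toHenselization_algebraMap (N : EtaleNhd R) (r : R) :
    N.toHenselization R (algebraMap R _ r) = (toLocalHenselization R).hom r := by
  let f : N ⟶ IsFiltered.max N (base R) := IsFiltered.leftToMax _ _
  let g : base R ⟶ IsFiltered.max N (base R) := IsFiltered.rightToMax _ _
  have h1 := toHenselization_comp_map f (algebraMap R _ r)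
  have h2 := toHenselization_comp_map g (algebraMap R _ r)
  rw [AlgHom.commutes] at h1 h2
  rw [← h1, h2]
  rfl

theorem localHenselization.exists_rep (a : localHenselization R) :
    ∃ (N : EtaleNhd R) (b : N.pair.Ring), N.toHenselization R b = a :=
  Concrete.colimit_exists_rep (ringFunctor R) a

/-- Finitely many elements of the henselization come from a common étale neighbourhood. -/
theorem localHenselization.exists_rep_finite {ι : Type*} [Finite ι]
    (a : ι → localHenselization R) :
    ∃ (N : EtaleNhd R) (b : ι → N.pair.Ring), ∀ i, N.toHenselization R (b i) = a i := by
  choose N b hb using fun i => exists_rep (a i)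
  have := Fintype.ofFinite ι
  classical
  obtain ⟨M, hM⟩ := IsFiltered.sup_objs_exists (Finset.univ.image N)
  let f i : N i ⟶ M := (hM (Finset.mem_image_of_mem _ (Finset.mem_univ i))).some
  exact ⟨M, fun i => (f i).map (b i), fun i => (toHenselization_comp_map (f i) _).trans (hb i)⟩

variable (R) in
/-- The cocone given by the chosen points of the étale neighbourhoods. -/
noncomputable def EtaleNhd.residueCocone : Cocone (ringFunctor R) where
  pt := CommRingCat.of (ResidueField R)
  ι :=
    { app := fun N => CommRingCat.ofHom N.point.toRingHom
      naturality := fun N N' f => by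
        ext a
        exact congrArg (fun k => k a) f.comp_map }

variable (R) in
/-- The residue map of the henselization. -/
noncomputable def localHenselization.toResidueField : localHenselization R →+* ResidueField R :=
  (colimit.desc (ringFunctor R) (residueCocone R)).hom

theorem localHenselization.toResidueField_toHenselization (N : EtaleNhd R) (b : N.pair.Ring) :
    toResidueField R (N.toHenselization R b) = N.point b :=
  congrArg (fun k => k.hom b) (colimit.ι_desc (residueCocone R) N)

theorem localHenselization.toResidueField_toLocalHenselization (r : R) :
    toResidueField R ((toLocalHenselization R).hom r) = residue R r := by
  rw [← (base R).toHenselization_algebraMap, toResidueField_toHenselization, AlgHom.commutes]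
  rfl

/-- The kernel of the residue map consists of all nonunits: an element of an étale neighbourhood
that does not vanish at the chosen point can be inverted in a smaller neighbourhood. -/
theorem localHenselization.isUnit_of_toResidueField_ne_zero {a : localHenselization R}
    (ha : toResidueField R a ≠ 0) : IsUnit a := by
  obtain ⟨N, b, rfl⟩ := exists_rep a
  rw [toResidueField_toHenselization] at ha
  have : Algebra.Etale R (Localization.Away b) := by
    have : Algebra.Etale N.pair.Ring (Localization.Away b) := .of_isLocalizationAway b
    exact .comp R N.pair.Ring _
  have hu : IsUnit (N.point b) := isUnit_iff_ne_zero.mpr ha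
  obtain ⟨N', h, hN'⟩ := exists_of_etale (E := Localization.Away b)
    (IsLocalization.Away.liftAlgHom b (f := N.point) hu)
  let f : N ⟶ N' := ⟨h.comp (IsScalarTower.toAlgHom R N.pair.Ring _), by
    rw [← AlgHom.comp_assoc, hN']
    exact AlgHom.ext fun a =>
      IsLocalization.Away.lift_eq b (S := Localization.Away b) (g := N.point.toRingHom) hu a⟩
  rw [← toHenselization_comp_map f]
  exact ((IsLocalization.Away.algebraMap_isUnit (S := Localization.Away b) b).map h).map _

instance : IsLocalHom (localHenselization.toResidueField R) :=
  ⟨fun _ ha => localHenselization.isUnit_of_toResidueField_ne_zero ha.ne_zero⟩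

instance : IsLocalRing (localHenselization R) :=
  (localHenselization.toResidueField R).domain_isLocalRing

theorem localHenselization.mem_maximalIdeal {a : localHenselization R} :
    a ∈ maximalIdeal (localHenselization R) ↔ toResidueField R a = 0 := by
  rw [IsLocalRing.mem_maximalIdeal, mem_nonunits_iff, not_iff_comm]
  exact ⟨isUnit_of_toResidueField_ne_zero, fun h => (h.map (toResidueField R)).ne_zero⟩

instance : IsLocalHom (toLocalHenselization R).hom := by
  constructor
  intro r hr
  have := hr.map (localHenselization.toResidueField R)
  rw [localHenselization.toResidueField_toLocalHenselization] at this
  exact (IsLocalRing.residue_ne_zero_iff_isUnit r).mp this.ne_zero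

end Henselization

/-- The henselization of a local ring is a henselian local ring. -/
instance localHenselization.henselianLocalRing (R : Type u) [CommRing R] [IsLocalRing R] :
    HenselianLocalRing (localHenselization R) where
  is_henselian F hF a₀ h₀ h₁ := by
    -- The coefficients of `F` live on an étale neighbourhood `N`. The ring obtained from `N` by
    -- adjoining a simple root of `F` is again étale, and its generator is the required root.
    obtain ⟨N, b, hb⟩ := exists_rep_finite (fun i : Fin F.natDegree => F.coeff i)
    let G : Polynomial N.pair.Ring :=
      Polynomial.X ^ F.natDegree +
        ∑ i : Fin F.natDegree, Polynomial.C (b i) * Polynomial.X ^ (i : ℕ)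
    have hG : G.Monic := Polynomial.monic_X_pow_add (Polynomial.degree_sum_fin_lt b)
    have hGF : G.map (N.toHenselization R) = F := by
      conv_rhs => rw [hF.as_sum]
      simp only [G, Polynomial.map_add, Polynomial.map_pow, Polynomial.map_X, Polynomial.map_sum,
        Polynomial.map_mul, Polynomial.map_C, hb]
      rw [Finset.sum_range]
    let P : StandardEtalePair N.pair.Ring := ⟨G, hG, G.derivative, 1, 0, 1, by simp⟩
    let φ : N.pair.Ring →+* ResidueField R := N.point.toRingHom
    have hφ : φ = (toResidueField R).comp (N.toHenselization R) :=
      RingHom.ext fun x => (toResidueField_toHenselization N x).symm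
    let : Algebra N.pair.Ring (ResidueField R) := φ.toAlgebra
    have : IsScalarTower R N.pair.Ring (ResidueField R) :=
      .of_algebraMap_eq' N.point.comp_algebraMap.symm
    let : Algebra R P.Ring := ((algebraMap N.pair.Ring P.Ring).comp (algebraMap R _)).toAlgebra
    have : IsScalarTower R N.pair.Ring P.Ring := .of_algebraMap_eq' rfl
    have hev : ∀ Q : Polynomial N.pair.Ring, Polynomial.aeval (toResidueField R a₀) Q =
        toResidueField R ((Q.map (N.toHenselization R)).eval a₀) := fun Q => by
      rw [Polynomial.aeval_def, Polynomial.eval_map, Polynomial.hom_eval₂]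
      exact congrArg (fun k => Polynomial.eval₂ k _ Q) hφ
    have hP : P.HasMap (toResidueField R a₀) := by
      refine ⟨?_, ?_⟩
      · rw [hev, hGF]
        exact mem_maximalIdeal.mp h₀
      · rw [hev, ← Polynomial.derivative_map, hGF]
        exact h₁.map _
    have : Algebra.Etale R P.Ring := .comp R N.pair.Ring _
    obtain ⟨N', h, hN'⟩ := exists_of_etale ((P.lift _ hP).restrictScalars R)
    let f : N ⟶ N' := ⟨h.comp (IsScalarTower.toAlgHom R N.pair.Ring P.Ring), by
      rw [← AlgHom.comp_assoc, hN']
      exact AlgHom.ext fun x => (P.lift _ hP).commutes x⟩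
    refine ⟨N'.toHenselization R (h P.X), ?_, ?_⟩
    · have e : N.toHenselization R = ((N'.toHenselization R).comp h.toRingHom).comp
          (algebraMap N.pair.Ring P.Ring) :=
        RingHom.ext fun x => (toHenselization_comp_map f x).symm
      have hX : Polynomial.eval₂ (algebraMap N.pair.Ring P.Ring) P.X G = 0 :=
        (StandardEtalePair.hasMap_X (P := P)).1
      rw [Polynomial.IsRoot, ← hGF, Polynomial.eval_map, e]
      have := Polynomial.hom_eval₂ G (algebraMap N.pair.Ring P.Ring)
        ((N'.toHenselization R).comp h.toRingHom) P.X
      rw [hX, map_zero] at this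
      exact this.symm
    · rw [mem_maximalIdeal, map_sub, toResidueField_toHenselization, sub_eq_zero]
      exact (congrArg (fun k => k P.X) hN').trans (P.lift_X _ hP)

/-! ### The universal property of henselization -/

/-- The universal property of henselization: the local ring `A` over `M` is such that each map
from `M` to a henselian local ring `H`, whose closed point has the same image in the spectrum of
`M` as that of `A`, extends uniquely to a local homomorphism from `A` to `H`. -/
def IsHenselUniversal {M A : Type u} [CommRing M] [CommRing A] [IsLocalRing A] (f : M →+* A) :
    Prop :=
  ∀ (H : Type u) [CommRing H] [HenselianLocalRing H] (φ : M →+* H),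
    (maximalIdeal H).comap φ = (maximalIdeal A).comap f →
      ∃! ψ : A →+* H, IsLocalHom ψ ∧ ψ.comp f = φ

theorem isLocalHom_of_comap_maximalIdeal_eq {A B : Type*} [CommRing A] [CommRing B] [IsLocalRing A]
    [IsLocalRing B] (f : A →+* B) (h : (maximalIdeal B).comap f = maximalIdeal A) : IsLocalHom f :=
  ((IsLocalRing.local_hom_TFAE f).out 4 0 rfl rfl).mp h

theorem comap_maximalIdeal_of_isLocalHom {A B : Type*} [CommRing A] [CommRing B] [IsLocalRing A]
    [IsLocalRing B] (f : A →+* B) (h : IsLocalHom f) : (maximalIdeal B).comap f = maximalIdeal A :=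
  ((IsLocalRing.local_hom_TFAE f).out 0 4 rfl rfl).mp h

namespace IsHenselUniversal

variable {M A A' : Type u} [CommRing M] [CommRing A] [CommRing A'] [IsLocalRing A] [IsLocalRing A']

/-- The henselization of a local ring that is universal over `M` is universal over `M`. -/
theorem comp {f : M →+* A} {g : A →+* A'} (hf : IsHenselUniversal f) (hg : IsHenselUniversal g)
    (hgl : IsLocalHom g) : IsHenselUniversal (g.comp f) := by
  intro H _ _ φ hφ
  have hg' := comap_maximalIdeal_of_isLocalHom g hgl
  obtain ⟨ψ, ⟨hψ, hψf⟩, hψu⟩ := hf H φ (by rw [hφ, ← Ideal.comap_comap, hg'])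
  obtain ⟨χ, ⟨hχ, hχg⟩, hχu⟩ := hg H ψ (by rw [hg', comap_maximalIdeal_of_isLocalHom ψ hψ])
  refine ⟨χ, ⟨hχ, by rw [← RingHom.comp_assoc, hχg, hψf]⟩, fun χ' ⟨h1, h2⟩ => hχu _ ⟨h1, ?_⟩⟩
  exact hψu _ ⟨RingHom.isLocalHom_comp χ' g, by rw [RingHom.comp_assoc, h2]⟩

/-- Two henselian local rings with the same universal property are isomorphic. -/
theorem exists_ringEquiv {A A' : Type u} [CommRing A] [CommRing A'] [HenselianLocalRing A]
    [HenselianLocalRing A'] {f : M →+* A} {f' : M →+* A'} (hf : IsHenselUniversal f)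
    (hf' : IsHenselUniversal f')
    (h : (maximalIdeal A).comap f = (maximalIdeal A').comap f') :
    ∃ e : A ≃+* A', e.toRingHom.comp f = f' := by
  obtain ⟨ψ, ⟨hψ, hψf⟩, -⟩ := hf A' f' h.symm
  obtain ⟨ψ', ⟨hψ', hψf'⟩, -⟩ := hf' A f h
  refine ⟨RingEquiv.ofRingHom ψ ψ' ?_ ?_, hψf⟩
  · exact (hf' A' f' rfl).unique ⟨RingHom.isLocalHom_comp ψ ψ', by
      rw [RingHom.comp_assoc, hψf', hψf]⟩ ⟨isLocalHom_id A', RingHom.id_comp _⟩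
  · exact (hf A f rfl).unique ⟨RingHom.isLocalHom_comp ψ' ψ, by
      rw [RingHom.comp_assoc, hψf, hψf']⟩ ⟨isLocalHom_id A, RingHom.id_comp _⟩

end IsHenselUniversal

/-- A field that consists of fractions of the images of elements of `P` maps to every other field
with a map from `P` that has the same kernel. -/
theorem exists_ringHom_of_ker_eq_of_fractions {P κ κ' : Type*} [CommRing P] [Field κ] [Field κ']
    (f : P →+* κ) (φ : P →+* κ') (hker : RingHom.ker f = RingHom.ker φ)
    (hf : ∀ a : κ, ∃ x y : P, f y ≠ 0 ∧ a * f y = f x) : ∃ θ : κ →+* κ', θ.comp f = φ := by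
  have hp : (RingHom.ker f).IsPrime := RingHom.ker_isPrime f
  have hfu : (RingHom.ker f).primeCompl ≤ (IsUnit.submonoid κ).comap f :=
    fun y hy => isUnit_iff_ne_zero.mpr hy
  have hφu : (RingHom.ker f).primeCompl ≤ (IsUnit.submonoid κ').comap φ :=
    fun y hy => isUnit_iff_ne_zero.mpr fun h0 => hy (hker.ge (show y ∈ RingHom.ker φ from h0))
  let g := Ideal.ResidueField.lift (RingHom.ker f) f le_rfl hfu
  let h := Ideal.ResidueField.lift (RingHom.ker f) φ hker.le hφu
  have hg : ∀ x, g (algebraMap P _ x) = f x := Ideal.ResidueField.lift_algebraMap _ _ le_rfl hfu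
  have hh : ∀ x, h (algebraMap P _ x) = φ x := Ideal.ResidueField.lift_algebraMap _ _ hker.le hφu
  have hbij : Function.Bijective g := by
    refine ⟨g.injective, fun a => ?_⟩
    obtain ⟨x, y, hy, hxy⟩ := hf a
    refine ⟨algebraMap P _ x * (algebraMap P _ y)⁻¹, ?_⟩
    rw [map_mul, map_inv₀, hg, hg, ← hxy, mul_assoc, mul_inv_cancel₀ hy, mul_one]
  let e := RingEquiv.ofBijective g hbij
  refine ⟨h.comp e.symm.toRingHom, RingHom.ext fun x => ?_⟩
  rw [← hh]
  refine congrArg h (e.symm_apply_eq.mpr (hg x).symm)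

namespace IsHenselUniversal

/-- A local ring is mapped to its henselization by a universal map. -/
theorem toLocalHenselization (R : Type u) [CommRing R] [IsLocalRing R] :
    IsHenselUniversal (_root_.toLocalHenselization R).hom := by
  intro H _ _ φ hφ
  rw [comap_maximalIdeal_of_isLocalHom (_root_.toLocalHenselization R).hom inferInstance] at hφ
  have hφl : IsLocalHom φ := isLocalHom_of_comap_maximalIdeal_eq φ hφ
  let : Algebra R H := φ.toAlgebra
  have : IsLocalHom (algebraMap R H) := hφl
  let θ : ResidueField R →ₐ[R] ResidueField H := ⟨ResidueField.map φ, fun r => rfl⟩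
  -- The maps from the étale neighbourhoods to `H` exist and are unique by their values at the
  -- chosen points, so they are compatible.
  choose s hs hsu using fun N : EtaleNhd R =>
    HenselianLocalRing.existsUnique_algHom_of_etale (θ.comp N.point)
  let c : Cocone (ringFunctor R) :=
    { pt := CommRingCat.of H
      ι :=
        { app := fun N => CommRingCat.ofHom (s N).toRingHom
          naturality := fun N N' f => by
            have : (s N').comp f.map = s N := hsu N _ fun a => by
              rw [AlgHom.comp_apply, hs]
              exact congrArg (fun k => θ (k a)) f.comp_map
            ext a
            exact congrArg (fun k => k a) this } }
  let ψ : localHenselization R →+* H := (colimit.desc (ringFunctor R) c).hom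
  have hψ : ∀ (N : EtaleNhd R) (b : N.pair.Ring), ψ (N.toHenselization R b) = s N b :=
    fun N b => congrArg (fun k => k.hom b) (colimit.ι_desc c N)
  have hψr : ∀ a, residue H (ψ a) = θ (localHenselization.toResidueField R a) := fun a => by
    obtain ⟨N, b, rfl⟩ := localHenselization.exists_rep a
    rw [hψ, hs, localHenselization.toResidueField_toHenselization]
    rfl
  refine ⟨ψ, ⟨⟨fun a ha => ?_⟩, RingHom.ext fun r => ?_⟩,
    fun χ ⟨hχ, hχφ⟩ => RingHom.ext fun a => ?_⟩
  · refine localHenselization.isUnit_of_toResidueField_ne_zero fun h => ?_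
    have := hψr a
    rw [h, map_zero] at this
    exact (ha.map (residue H)).ne_zero this
  · rw [RingHom.comp_apply, ← (base R).toHenselization_algebraMap, hψ, AlgHom.commutes]
    rfl
  · obtain ⟨N, b, rfl⟩ := localHenselization.exists_rep a
    have hχR : ∀ r, χ ((_root_.toLocalHenselization R).hom r) = φ r := fun r =>
      congrArg (fun k => k r) hχφ
    let χN : N.pair.Ring →ₐ[R] H := ⟨χ.comp (N.toHenselization R), fun r => by
      change χ (N.toHenselization R (algebraMap R _ r)) = φ r
      rw [N.toHenselization_algebraMap, hχR]⟩
    rw [hψ, ← hsu N χN fun b => ?_]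
    · rfl
    · -- The value of `b` at the closed point is that of an element of `R`.
      obtain ⟨r, hr⟩ := IsLocalRing.residue_surjective (N.point b)
      have h1 : N.toHenselization R b - (_root_.toLocalHenselization R).hom r ∈
          maximalIdeal (localHenselization R) := by
        rw [localHenselization.mem_maximalIdeal, map_sub, sub_eq_zero,
          localHenselization.toResidueField_toHenselization,
          localHenselization.toResidueField_toLocalHenselization, hr]
      rw [← comap_maximalIdeal_of_isLocalHom χ hχ, Ideal.mem_comap, map_sub, hχR,
        ← IsLocalRing.residue_eq_zero_iff, map_sub, sub_eq_zero] at h1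
      refine h1.trans ?_
      rw [AlgHom.comp_apply, ← hr]
      rfl

variable {P C A : Type u} [CommRing P] [CommRing C] [CommRing A] [IsLocalRing A] [Algebra P C]
  [Algebra C A]

/-- The local ring of an étale `P`-algebra at a prime whose residue field is that of its image in
the spectrum of `P` is universal over `P`. -/
theorem of_isEtaleAt [Algebra.FinitePresentation P C] (p : Ideal C) [p.IsPrime]
    [Algebra.IsEtaleAt P p] [IsLocalization.AtPrime A p]
    (hres : ∀ a : ResidueField A, ∃ x y : P, residue A (algebraMap C A (algebraMap P C y)) ≠ 0 ∧
      a * residue A (algebraMap C A (algebraMap P C y)) =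
        residue A (algebraMap C A (algebraMap P C x))) :
    IsHenselUniversal ((algebraMap C A).comp (algebraMap P C)) := by
  intro H _ _ φ hφ
  let f : P →+* ResidueField A := (residue A).comp ((algebraMap C A).comp (algebraMap P C))
  have hf : RingHom.ker f = RingHom.ker ((residue H).comp φ) := by
    ext x
    have := congrArg (fun I => x ∈ I) hφ
    simp only [Ideal.mem_comap, ← IsLocalRing.residue_eq_zero_iff] at this
    exact (iff_of_eq this).symm
  obtain ⟨θ, hθ⟩ := exists_ringHom_of_ker_eq_of_fractions f ((residue H).comp φ) hf hres
  have hθ' : ∀ x, θ (f x) = residue H (φ x) := fun x => congrArg (fun k => k x) hθ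
  -- The map `θ` of residue fields prescribes the point of `H` over the étale neighbourhood `C_c`
  -- of `p`, and there is a unique map to `H` through this point.
  obtain ⟨c, hc, hce⟩ := Algebra.exists_etale_of_isEtaleAt (R := P) p
  let : Algebra P H := φ.toAlgebra
  have hmem : ∀ z : C, residue A (algebraMap C A z) = 0 ↔ z ∈ p := fun z => by
    rw [IsLocalRing.residue_eq_zero_iff]
    exact IsLocalization.AtPrime.to_map_mem_maximal_iff A p z
  let ψ₀ : C →ₐ[P] ResidueField H := ⟨(θ.comp (residue A)).comp (algebraMap C A), hθ'⟩
  have hψ₀ : IsUnit (ψ₀ c) := by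
    rw [isUnit_iff_ne_zero]
    intro h
    exact hc ((hmem c).mp ((map_eq_zero θ).mp h))
  let ψ₁ : Localization.Away c →ₐ[P] ResidueField H :=
    IsLocalization.Away.liftAlgHom c (f := ψ₀) hψ₀
  have hψ₁ : ∀ z, ψ₁ (algebraMap C _ z) = θ (residue A (algebraMap C A z)) := fun z =>
    IsLocalization.Away.lift_eq c (S := Localization.Away c) (g := ψ₀.toRingHom) hψ₀ z
  obtain ⟨s, hs, hsu⟩ := HenselianLocalRing.existsUnique_algHom_of_etale ψ₁
  let s' : C →+* H := s.toRingHom.comp (algebraMap C (Localization.Away c))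
  have hs' : ∀ z, residue H (s' z) = θ (residue A (algebraMap C A z)) := fun z =>
    (hs _).trans (hψ₁ z)
  have hs'u : ∀ z : p.primeCompl, IsUnit (s' z) := fun z => by
    rw [← IsLocalRing.residue_ne_zero_iff_isUnit, hs', map_ne_zero, Ne, hmem]
    exact z.2
  let ψ : A →+* H := IsLocalization.lift hs'u
  have hψ : ∀ z, ψ (algebraMap C A z) = s' z := IsLocalization.lift_eq hs'u
  refine ⟨ψ, ⟨⟨fun a ha => ?_⟩, RingHom.ext fun x => ?_⟩, fun χ ⟨hχ, hχφ⟩ => ?_⟩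
  · obtain ⟨z, t, rfl⟩ := IsLocalization.exists_mk'_eq p.primeCompl a
    have h1 : IsUnit (s' z) := by
      rw [← hψ, ← IsLocalization.mk'_spec A z t, map_mul]
      exact ha.mul ((IsLocalization.map_units A t).map ψ)
    rw [← IsLocalRing.residue_ne_zero_iff_isUnit, hs', map_ne_zero, Ne, hmem] at h1
    exact (IsLocalization.map_units A (⟨z, h1⟩ : p.primeCompl)).mul
      ((IsLocalization.map_units A t).unit⁻¹).isUnit |> fun h => by
        rwa [show IsLocalization.mk' A z t = algebraMap C A z *
          ((IsLocalization.map_units A t).unit⁻¹ : Aˣ) from by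
            rw [Units.eq_mul_inv_iff_mul_eq]; exact IsLocalization.mk'_spec A z t]
  · rw [RingHom.comp_apply, RingHom.comp_apply, hψ]
    exact ((congrArg s (IsScalarTower.algebraMap_apply P C (Localization.Away c) x)).symm).trans
      (s.commutes x)
  · have hχ' : ∀ x, χ (algebraMap C A (algebraMap P C x)) = φ x := fun x =>
      congrArg (fun k => k x) hχφ
    -- As the residue field of `A` consists of fractions of elements of `P`, each local homomorphism
    -- over `P` induces the map `θ`.
    have hχr : ∀ a, residue H (χ a) = θ (residue A a) := fun a => by
      obtain ⟨x, y, hy, hxy⟩ := hres (residue A a)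
      have hy' : θ (f y) ≠ 0 := (map_ne_zero θ).mpr hy
      have h1 : a * algebraMap C A (algebraMap P C y) - algebraMap C A (algebraMap P C x) ∈
          maximalIdeal A := by
        rw [← IsLocalRing.residue_eq_zero_iff, map_sub, map_mul, hxy, sub_self]
      rw [← comap_maximalIdeal_of_isLocalHom χ hχ, Ideal.mem_comap, map_sub, map_mul, hχ', hχ',
        ← IsLocalRing.residue_eq_zero_iff, map_sub, sub_eq_zero, map_mul, ← hθ', ← hθ'] at h1
      have h2 := congrArg θ hxy
      rw [map_mul] at h2
      exact mul_right_cancel₀ hy' (h1.trans h2.symm)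
    have hχc : IsUnit (χ (algebraMap C A c)) :=
      (IsLocalization.map_units A (⟨c, hc⟩ : p.primeCompl)).map χ
    let χ₀ : C →ₐ[P] H := ⟨χ.comp (algebraMap C A), hχ'⟩
    let χ₁ : Localization.Away c →ₐ[P] H := IsLocalization.Away.liftAlgHom c (f := χ₀) hχc
    have hχ₁ : ∀ z, χ₁ (algebraMap C _ z) = χ (algebraMap C A z) := fun z =>
      IsLocalization.Away.lift_eq c (S := Localization.Away c) (g := χ₀.toRingHom) hχc z
    have hχs : χ₁ = s := by
      refine hsu _ fun a => ?_
      have : (residue H).comp χ₁.toRingHom = ψ₁.toRingHom := by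
        refine IsLocalization.ringHom_ext (Submonoid.powers c) (RingHom.ext fun z => ?_)
        change residue H (χ₁ (algebraMap C _ z)) = ψ₁ (algebraMap C _ z)
        rw [hχ₁, hψ₁, hχr]
      exact congrArg (fun k => k a) this
    refine IsLocalization.ringHom_ext p.primeCompl (RingHom.ext fun z => ?_)
    change χ (algebraMap C A z) = ψ (algebraMap C A z)
    rw [hψ, ← hχ₁, hχs]
    rfl

/-- If a universal map `f ∘ g` factors through a local ring by a map `g` that is an epimorphism with
respect to local homomorphisms to henselian rings, such as a localization, then `f` is universal. -/
theorem of_comp {M R : Type u} [CommRing M] [CommRing R] [IsLocalRing R] {g : M →+* R}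
    {f : R →+* A} (hf : IsHenselUniversal (f.comp g)) (hfl : IsLocalHom f)
    (hg : ∀ (H : Type u) [CommRing H] [HenselianLocalRing H] (a b : R →+* H), IsLocalHom a →
      IsLocalHom b → a.comp g = b.comp g → a = b) : IsHenselUniversal f := by
  intro H _ _ φ hφ
  have hφl : IsLocalHom φ := isLocalHom_of_comap_maximalIdeal_eq φ
    (hφ.trans (comap_maximalIdeal_of_isLocalHom f hfl))
  obtain ⟨ψ, ⟨hψ, hψf⟩, hu⟩ := hf H (φ.comp g) (by
    rw [← Ideal.comap_comap, ← Ideal.comap_comap, hφ])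
  refine ⟨ψ, ⟨hψ, ?_⟩, fun χ ⟨hχ, hχf⟩ => hu χ ⟨hχ, by rw [← RingHom.comp_assoc, hχf]⟩⟩
  exact hg H _ _ (RingHom.isLocalHom_comp ψ f) hφl (by rw [RingHom.comp_assoc, hψf])

end IsHenselUniversal

/-! ### Algebras with finite closed fibre over a henselian local ring -/

section QuasiFinite

open TensorProduct

/-- An étale algebra over a henselian local ring has a section through each rational point of the
closed fibre. -/
theorem HenselianLocalRing.exists_algHom_of_bijective_residueField {Λ R' : Type u} [CommRing Λ]
    [HenselianLocalRing Λ] [CommRing R'] [Algebra Λ R'] [Algebra.Etale Λ R'] (P : Ideal R')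
    [P.IsPrime] [P.LiesOver (maximalIdeal Λ)]
    (hP : Function.Bijective (Ideal.ResidueField.mapₐ (maximalIdeal Λ) P (Algebra.ofId _ _)
      (P.over_def _))) : ∃ s : R' →ₐ[Λ] Λ, (maximalIdeal Λ).comap s = P := by
  let e₁ : (maximalIdeal Λ).ResidueField ≃ₐ[Λ] P.ResidueField := AlgEquiv.ofBijective _ hP
  let e₂ : ResidueField Λ ≃ₐ[Λ] (maximalIdeal Λ).ResidueField :=
    AlgEquiv.ofBijective (IsScalarTower.toAlgHom Λ (Λ ⧸ maximalIdeal Λ) _)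
      (Ideal.bijective_algebraMap_quotient_residueField (maximalIdeal Λ))
  let ψ : R' →ₐ[Λ] ResidueField Λ :=
    ((e₁.symm.trans e₂.symm).toAlgHom).comp (IsScalarTower.toAlgHom Λ R' P.ResidueField)
  have : IsLocalHom (algebraMap Λ Λ) := ⟨fun a ha => ha⟩
  obtain ⟨s, hs⟩ := HenselianLocalRing.exists_algHom_of_etale ψ
  refine ⟨s, ?_⟩
  ext a
  rw [Ideal.mem_comap, ← IsLocalRing.residue_eq_zero_iff]
  rw [show residue Λ (s a) = ψ a from hs a]
  change (e₁.symm.trans e₂.symm) (algebraMap R' P.ResidueField a) = 0 ↔ _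
  rw [EmbeddingLike.map_eq_zero_iff, Ideal.algebraMap_residueField_eq_zero]

/-- The image of a finite `R'`-algebra under a `Λ`-algebra map that is semilinear for a map from
`R'` to `Λ` is a finite `Λ`-module. -/
theorem AlgHom.finite_range_of_semilinear {Λ R' T E : Type*} [CommRing Λ] [CommRing R'] [CommRing T]
    [CommRing E] [Algebra Λ T] [Algebra Λ E] [Algebra R' T] [Module.Finite R' T] (φ : T →ₐ[Λ] E)
    (s : R' → Λ) (hs : ∀ (r : R') (x : T), φ (r • x) = s r • φ x) : Module.Finite Λ φ.range := by
  obtain ⟨G, hG⟩ := Module.Finite.fg_top (R := R') (M := T)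
  classical
  refine (Module.Finite.iff_fg (N := Subalgebra.toSubmodule φ.range)).mpr ⟨G.image φ, ?_⟩
  refine le_antisymm (Submodule.span_le.mpr ?_) ?_
  · rw [Finset.coe_image]
    rintro _ ⟨x, -, rfl⟩
    exact ⟨x, rfl⟩
  · rintro _ ⟨x, rfl⟩
    have hx : x ∈ Submodule.span R' (G : Set T) := hG ▸ Submodule.mem_top
    change φ x ∈ _
    induction hx using Submodule.span_induction with
    | mem x hx => exact Submodule.subset_span (Finset.mem_coe.mpr (Finset.mem_image_of_mem _ hx))
    | zero => rw [map_zero]; exact zero_mem _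
    | add x y _ _ hx hy => rw [map_add]; exact add_mem hx hy
    | smul r x _ hx => rw [hs]; exact Submodule.smul_mem _ _ hx

/-- A subalgebra of a localization of `S` is everything if it contains the image of `S` and the
inverses of the denominators. -/
theorem Subalgebra.eq_top_of_isLocalization_atPrime {Λ S E : Type*} [CommRing Λ] [CommRing S]
    [CommRing E] [Algebra Λ E] [Algebra S E] (q : Ideal S) [q.IsPrime] [IsLocalization.AtPrime E q]
    (B : Subalgebra Λ E) (f : S →+* B) (hf : ∀ x, (f x : E) = algebraMap S E x)
    (hunit : ∀ t, t ∉ q → IsUnit (f t)) : B = ⊤ := by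
  rw [eq_top_iff]
  rintro y -
  obtain ⟨x, t, rfl⟩ := IsLocalization.exists_mk'_eq q.primeCompl y
  obtain ⟨v, hv⟩ := (hunit t t.2).exists_right_inv
  have hv' : algebraMap S E t * v = 1 := by
    rw [← hf, ← Subalgebra.coe_mul, hv, Subalgebra.coe_one]
  have : IsLocalization.mk' E x t = f x * v := by
    rw [IsLocalization.mk'_eq_iff_eq_mul, mul_assoc, mul_comm (v : E), hv', mul_one, hf]
  rw [this]
  exact (f x * v).2

/-- A local algebra essentially of finite type over a henselian local ring is finite if its closed
fibre is: by Zariski's main theorem it is, after an étale extension, a direct factor of a finite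
algebra, and a henselian ring is a direct factor of each suitable étale extension. -/
theorem Module.Finite.of_henselianLocalRing (Λ E : Type u) [CommRing Λ] [HenselianLocalRing Λ]
    [CommRing E] [IsLocalRing E] [Algebra Λ E] [IsLocalHom (algebraMap Λ E)]
    [Algebra.EssFiniteType Λ E]
    [Module.Finite Λ (E ⧸ (maximalIdeal Λ).map (algebraMap Λ E))] : Module.Finite Λ E := by
  let S := Algebra.EssFiniteType.subalgebra Λ E
  let q : Ideal S := (maximalIdeal E).comap (algebraMap S E)
  have hqc : Algebra.EssFiniteType.submonoid Λ E = q.primeCompl := by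
    ext a
    change IsUnit (algebraMap S E a) ↔ ¬ (algebraMap S E a ∈ maximalIdeal E)
    rw [mem_maximalIdeal, mem_nonunits_iff, not_not]
  have : IsLocalization.AtPrime E q := by
    have := Algebra.EssFiniteType.isLocalization Λ E
    rwa [hqc] at this
  have hover : q.LiesOver (maximalIdeal Λ) := ⟨by
    rw [Ideal.under, Ideal.comap_comap, ← IsScalarTower.algebraMap_eq,
      comap_maximalIdeal_of_isLocalHom _ inferInstance]⟩
  let eE : Localization.AtPrime q ≃ₐ[S] E := IsLocalization.algEquiv q.primeCompl _ _
  have : Algebra.WeaklyQuasiFiniteAt Λ q := by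
    rw [Algebra.weaklyQuasiFiniteAt_iff, ← Ideal.over_def q (maximalIdeal Λ)]
    let f : (E ⧸ (maximalIdeal Λ).map (algebraMap Λ E)) →ₐ[Λ] (Localization.AtPrime q ⧸
        (maximalIdeal Λ).map (algebraMap Λ (Localization.AtPrime q))) :=
      Ideal.quotientMapₐ _ (eE.symm.restrictScalars Λ).toAlgHom (by
        rw [Ideal.map_le_iff_le_comap]
        intro x hx
        rw [Ideal.mem_comap, Ideal.mem_comap]
        have : (eE.symm.restrictScalars Λ).toAlgHom (algebraMap Λ E x) = algebraMap Λ _ x :=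
          (eE.symm.restrictScalars Λ).commutes x
        exact this ▸ Ideal.mem_map_of_mem _ hx)
    refine Algebra.QuasiFinite.of_surjective_algHom f ?_
    intro y
    obtain ⟨y, rfl⟩ := Ideal.Quotient.mk_surjective y
    exact ⟨Ideal.Quotient.mk _ (eE y), congrArg (Ideal.Quotient.mk _) (eE.symm_apply_apply y)⟩
  have : Algebra.QuasiFiniteAt Λ q := Algebra.QuasiFiniteAt.of_weaklyQuasiFiniteAt q
  -- Zariski's main theorem: after an étale base change `Λ → R'` the point `q` has a neighbourhood
  -- `D(e)` with `e` idempotent, which is finite over `R'` and contains no other point over `P`.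
  obtain ⟨R', _, _, _, P, _, _, e, he, P', _, _, hP'q, heP', hbij, hfin, huniq⟩ :=
    Algebra.exists_etale_isIdempotentElem_forall_liesOver_eq (maximalIdeal Λ) q
  obtain ⟨s, hs⟩ := HenselianLocalRing.exists_algHom_of_bijective_residueField P hbij
  let φ : R' ⊗[Λ] S →ₐ[Λ] E := Algebra.TensorProduct.lift ((Algebra.ofId Λ E).comp s)
    (IsScalarTower.toAlgHom Λ S E) fun _ _ => .all _ _
  have hφ : ∀ (r : R') (x : S), φ (r ⊗ₜ x) = algebraMap Λ E (s r) * algebraMap S E x :=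
    fun r x => Algebra.TensorProduct.lift_tmul _ _ _ r x
  have hφS : ∀ x : S, φ (1 ⊗ₜ x) = algebraMap S E x := fun x => by
    rw [hφ, map_one, map_one, one_mul]
  have hφR : ∀ r : R', φ (algebraMap R' _ r) = algebraMap Λ E (s r) := fun r => by
    rw [Algebra.TensorProduct.algebraMap_apply, Algebra.algebraMap_self_apply, hφ, map_one, mul_one]
  -- A prime of `E` over the closed point of `Λ` pulls back to one over `P`.
  have hlies : ∀ {B : Type u} [CommRing B] [Algebra Λ B] (f : R' ⊗[Λ] S →ₐ[Λ] B)
      (_ : ∀ r : R', f (algebraMap R' _ r) = algebraMap Λ B (s r)) (n : Ideal B)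
      (_ : n.comap (algebraMap Λ B) = maximalIdeal Λ), (n.comap f).LiesOver P := by
    intro B _ _ f hf n hn
    refine ⟨?_⟩
    ext r
    rw [← hs, Ideal.mem_comap, ← hn, Ideal.mem_comap, Ideal.under, Ideal.mem_comap,
      Ideal.mem_comap, hf]
  have hP'φ : P' = (maximalIdeal E).comap φ := by
    have := hlies φ hφR (maximalIdeal E) (comap_maximalIdeal_of_isLocalHom _ inferInstance)
    refine Ideal.eq_of_comap_eq_comap_of_bijective_residueFieldMap (p := maximalIdeal Λ) (q := P)
      hbij _ _ ?_
    rw [hP'q]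
    ext x
    exact (iff_of_eq (congrArg (· ∈ maximalIdeal E) (hφS x))).symm
  have heu : IsUnit (φ e) := by
    rw [hP'φ, Ideal.mem_comap, mem_maximalIdeal, mem_nonunits_iff, not_not] at heP'
    exact heP'
  -- The image of the finite direct factor in `E` is all of `E`.
  let φ' : Localization.Away e →ₐ[Λ] E := IsLocalization.Away.liftAlgHom e (f := φ) heu
  have hφ' : ∀ x, φ' (algebraMap _ _ x) = φ x := fun x =>
    IsLocalization.Away.lift_eq e (S := Localization.Away e) (g := φ.toRingHom) heu x
  have hφ's : ∀ (r : R') (x : Localization.Away e), φ' (r • x) = s r • φ' x := fun r x => by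
    rw [Algebra.smul_def, map_mul, IsScalarTower.algebraMap_apply R' (R' ⊗[Λ] S), hφ', hφR,
      Algebra.smul_def]
  let B := φ'.range
  have hBfin : Module.Finite Λ B := AlgHom.finite_range_of_semilinear φ' s hφ's
  let f : R' ⊗[Λ] S →ₐ[Λ] B :=
    φ'.rangeRestrict.comp (IsScalarTower.toAlgHom Λ (R' ⊗[Λ] S) (Localization.Away e))
  have hf : ∀ x, (f x : E) = φ x := hφ'
  have hfe : IsUnit (f e) :=
    (IsLocalization.Away.algebraMap_isUnit (S := Localization.Away e) e).map φ'.rangeRestrict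
  have hunit : ∀ t : S, t ∉ q → IsUnit (f (1 ⊗ₜ t)) := by
    intro t ht
    by_contra hnu
    -- A maximal ideal of the finite algebra `B` lies over the closed point of `Λ`, so that it comes
    -- from the only point over `P`.
    obtain ⟨n, hn, htn⟩ := exists_max_ideal_of_mem_nonunits hnu
    have hnΛ : n.comap (algebraMap Λ B) = maximalIdeal Λ :=
      IsLocalRing.eq_maximalIdeal (Ideal.isMaximal_comap_of_isIntegral_of_isMaximal n)
    have h1 := hlies f (fun r => Subtype.ext ((hf _).trans (hφR r))) n hnΛ
    have h2 := huniq (n.comap f) (Ideal.comap_isPrime f n) h1 fun h => hn.ne_top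
      (Ideal.eq_top_of_isUnit_mem _ h hfe)
    exact ht (hP'q.le (h2.le htn))
  have hB : B = ⊤ := Subalgebra.eq_top_of_isLocalization_atPrime q B
    (f.toRingHom.comp Algebra.TensorProduct.includeRight.toRingHom)
    (fun x => (hf _).trans (hφS x)) hunit
  exact Module.Finite.of_surjective B.val.toLinearMap fun y => ⟨⟨y, hB ▸ Algebra.mem_top⟩, rfl⟩

end QuasiFinite

/-! ### Representatives of elements of a henselization -/

section LocalRepresentatives

/-- Finitely many elements of the henselization of `R` come from the local ring `E` of an étale
neighbourhood. This local ring has the residue field of `R`, and is unramified and flat over `R`. -/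
theorem localHenselization.exists_local_rep_finite {R : Type u} [CommRing R] [IsLocalRing R]
    {ι : Type*} [Finite ι] (a : ι → localHenselization R) :
    ∃ (E : Type u) (_ : CommRing E) (_ : IsLocalRing E) (_ : Algebra R E)
      (θ : E →+* localHenselization R) (b : ι → E), Algebra.EssFiniteType R E ∧ Module.Flat R E ∧
      (maximalIdeal R).map (algebraMap R E) = maximalIdeal E ∧
      (∀ e : E, ∃ r, e - algebraMap R E r ∈ maximalIdeal E) ∧ IsLocalHom θ ∧
      (∀ r, θ (algebraMap R E r) = (toLocalHenselization R).hom r) ∧ ∀ i, θ (b i) = a i := by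
  obtain ⟨N, b, hb⟩ := exists_rep_finite a
  let q : Ideal N.pair.Ring := RingHom.ker N.point.toRingHom
  have hq : q.IsPrime := RingHom.ker_isPrime _
  let E := Localization.AtPrime q
  have hu : ∀ z : q.primeCompl, IsUnit (N.toHenselization R z) := fun z =>
    isUnit_of_toResidueField_ne_zero (by rw [toResidueField_toHenselization]; exact z.2)
  let θ : E →+* localHenselization R := IsLocalization.lift hu
  have hθ : ∀ z, θ (algebraMap _ E z) = N.toHenselization R z := IsLocalization.lift_eq hu
  have hθR : ∀ r, θ (algebraMap R E r) = (toLocalHenselization R).hom r := fun r => by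
    rw [IsScalarTower.algebraMap_apply R N.pair.Ring E, hθ, N.toHenselization_algebraMap]
  have hmem : ∀ z, algebraMap _ E z ∈ maximalIdeal E ↔ N.point z = 0 := fun z =>
    IsLocalization.AtPrime.to_map_mem_maximal_iff E q z
  have hθl : IsLocalHom θ := by
    refine ⟨fun x hx => ?_⟩
    obtain ⟨z, t, rfl⟩ := IsLocalization.exists_mk'_eq q.primeCompl x
    have h1 : IsUnit (N.toHenselization R z) := by
      rw [← hθ, ← IsLocalization.mk'_spec E z t, map_mul]
      exact hx.mul ((IsLocalization.map_units E t).map θ)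
    have h2 : z ∈ q.primeCompl := fun hz => by
      refine (h1.map (toResidueField R)).ne_zero ?_
      rw [toResidueField_toHenselization]
      exact hz
    exact (IsLocalization.AtPrime.isUnit_mk'_iff E q z t).mpr h2
  have hloc : IsLocalHom (algebraMap R E) := ⟨fun r hr => by
    have := hr.map θ
    rw [hθR] at this
    exact isUnit_of_map_unit (toLocalHenselization R).hom r this⟩
  have hess : Algebra.EssFiniteType R E := .comp R N.pair.Ring E
  have hun : Algebra.FormallyUnramified R E := .comp R N.pair.Ring E
  have hflat : Module.Flat R E := .trans R N.pair.Ring E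
  refine ⟨E, inferInstance, inferInstance, inferInstance, θ, fun i => algebraMap _ E (b i), hess,
    hflat, Algebra.FormallyUnramified.map_maximalIdeal, fun e => ?_, hθl, hθR,
    fun i => (hθ _).trans (hb i)⟩
  obtain ⟨r, hr⟩ := residue_surjective (toResidueField R (θ e))
  refine ⟨r, ?_⟩
  rw [← comap_maximalIdeal_of_isLocalHom θ hθl, Ideal.mem_comap, map_sub, hθR, mem_maximalIdeal,
    map_sub, toResidueField_toLocalHenselization, hr, sub_self]

end LocalRepresentatives

/-! ### Finite quotients of local algebras over a henselian local ring -/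

section FiniteQuotient

open Polynomial

variable {Λ E : Type u} [CommRing Λ] [CommRing E] [IsLocalRing E] [Algebra Λ E]

/-- If the closed fibre has a maximal ideal generated by `F(b)` and a residue field generated by
`b`, then the polynomials in `b` represent all elements of the closed fibre modulo each power of
`F(b)`. -/
theorem exists_sub_aeval_mem_of_maximalIdeal_eq [IsLocalRing Λ] (b : E) (F : Λ[X])
    (hm : maximalIdeal E ≤ (maximalIdeal Λ).map (algebraMap Λ E) ⊔ Ideal.span {aeval b F})
    (hres : ∀ e : E, ∃ p : Λ[X], e - aeval b p ∈ maximalIdeal E) (j : ℕ) (e : E) :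
    ∃ p : Λ[X], e - aeval b p ∈
      (maximalIdeal Λ).map (algebraMap Λ E) ⊔ Ideal.span {aeval b F ^ j} := by
  induction j with
  | zero => exact ⟨0, by simp⟩
  | succ j ih =>
    obtain ⟨p, hp⟩ := ih
    obtain ⟨μ, hμ, _, hw, h⟩ := Submodule.mem_sup.mp hp
    obtain ⟨w, rfl⟩ := Ideal.mem_span_singleton'.mp hw
    obtain ⟨p', hp'⟩ := hres w
    obtain ⟨μ', hμ', _, hw', h'⟩ := Submodule.mem_sup.mp (hm hp')
    obtain ⟨v, rfl⟩ := Ideal.mem_span_singleton'.mp hw'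
    refine ⟨p + F ^ j * p', Submodule.mem_sup.mpr ⟨μ + aeval b F ^ j * μ',
      add_mem hμ (Ideal.mul_mem_left _ _ hμ'), v * aeval b F ^ (j + 1),
      Ideal.mem_span_singleton'.mpr ⟨v, rfl⟩, ?_⟩⟩
    rw [map_add, map_mul, map_pow]
    linear_combination h + aeval b F ^ j * h'

/-- Let `g` be an element of a local ring `E` over a henselian local ring `Λ` that is, modulo the
maximal ideal of `Λ`, the product of a unit and a power of `F(b)`. If `F(b)` generates the maximal
ideal of the closed fibre, whose residue field is generated by `b`, then `E / (g)` is a finite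
`Λ`-algebra generated by `b`. -/
theorem finite_quotient_and_exists_dvd_sub_aeval [HenselianLocalRing Λ]
    [IsLocalHom (algebraMap Λ E)] [Algebra.EssFiniteType Λ E] (b : E) (F : Λ[X]) (hF : F.Monic)
    (hm : maximalIdeal E ≤ (maximalIdeal Λ).map (algebraMap Λ E) ⊔ Ideal.span {aeval b F})
    (hres : ∀ e : E, ∃ p : Λ[X], e - aeval b p ∈ maximalIdeal E) (g v : E) (hv : IsUnit v) (j : ℕ)
    (hg : g - v * aeval b F ^ j ∈ (maximalIdeal Λ).map (algebraMap Λ E))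
    (hgm : g ∈ maximalIdeal E) :
    Module.Finite Λ (E ⧸ Ideal.span {g}) ∧ ∀ e : E, ∃ p : Λ[X], g ∣ e - aeval b p := by
  let Q := E ⧸ Ideal.span {g}
  have hne : Ideal.span {g} ≠ ⊤ := fun h =>
    (Ideal.ne_top_iff_one _).mp (maximalIdeal.isMaximal E).ne_top
      ((Ideal.span_singleton_le_iff_mem _).mpr hgm (h ▸ Submodule.mem_top))
  have hQn : Nontrivial Q := Ideal.Quotient.nontrivial_iff.mpr hne
  have hQl : IsLocalRing Q := .of_surjective' (Ideal.Quotient.mk (Ideal.span {g}))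
    Ideal.Quotient.mk_surjective
  have hEQ : IsLocalHom (Ideal.Quotient.mk (Ideal.span {g})) :=
    .of_surjective _ Ideal.Quotient.mk_surjective
  have hΛQ : IsLocalHom (algebraMap Λ Q) := by
    have : algebraMap Λ Q = (Ideal.Quotient.mk (Ideal.span {g})).comp (algebraMap Λ E) := rfl
    rw [this]
    exact RingHom.isLocalHom_comp _ _
  let J := (maximalIdeal Λ).map (algebraMap Λ Q)
  let mkQ : E →ₐ[Λ] Q := Ideal.Quotient.mkₐ Λ _
  let π : E →ₐ[Λ] Q ⧸ J := (Ideal.Quotient.mkₐ Λ J).comp mkQ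
  have hπJ : ∀ x ∈ (maximalIdeal Λ).map (algebraMap Λ E), mkQ x ∈ J := by
    intro x hx
    have : (maximalIdeal Λ).map (algebraMap Λ E) ≤ J.comap mkQ := by
      rw [Ideal.map_le_iff_le_comap]
      exact fun l hl => Ideal.mem_map_of_mem (algebraMap Λ Q) hl
    exact this hx
  have hπ0 : ∀ x ∈ (maximalIdeal Λ).map (algebraMap Λ E), π x = 0 := fun x hx =>
    Ideal.Quotient.eq_zero_iff_mem.mpr (hπJ x hx)
  have hmkg : mkQ g = 0 := Ideal.Quotient.eq_zero_iff_mem.mpr (Ideal.mem_span_singleton_self g)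
  have hπF : π (aeval b F ^ j) = 0 := by
    have h1 : π g = 0 := by
      change Ideal.Quotient.mkₐ Λ J (mkQ g) = 0
      rw [hmkg, map_zero]
    have h2 := hπ0 _ hg
    rw [map_sub, h1, zero_sub, neg_eq_zero, map_mul] at h2
    exact (hv.map π).mul_right_eq_zero.mp h2
  -- The closed fibre of `E / (g)` is killed by a power of `F(b)`, so that polynomials in `b` fill
  -- it. As `F` is monic, polynomials of bounded degree suffice.
  have hspan : ∀ e : E, ∃ p : Λ[X], π (e - aeval b p) = 0 := by
    intro e
    obtain ⟨p, hp⟩ := exists_sub_aeval_mem_of_maximalIdeal_eq b F hm hres j e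
    obtain ⟨μ, hμ, _, hw, h⟩ := Submodule.mem_sup.mp hp
    obtain ⟨w, rfl⟩ := Ideal.mem_span_singleton'.mp hw
    exact ⟨p, by rw [← h, map_add, hπ0 μ hμ, map_mul, hπF, mul_zero, add_zero]⟩
  have hfin₀ : Module.Finite Λ (Q ⧸ J) := by
    have hroot : aeval (π b) (F ^ j) = 0 := by
      rw [aeval_algHom_apply, map_pow, hπF]
    let ρ : AdjoinRoot (F ^ j) →ₐ[Λ] Q ⧸ J := AdjoinRoot.liftAlgHom _ (Algebra.ofId _ _) (π b) hroot
    have : Module.Finite Λ (AdjoinRoot (F ^ j)) := (hF.pow j).finite_adjoinRoot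
    refine Module.Finite.of_surjective ρ.toLinearMap fun y => ?_
    obtain ⟨y, rfl⟩ := Ideal.Quotient.mk_surjective y
    obtain ⟨e, rfl⟩ := Ideal.Quotient.mk_surjective y
    obtain ⟨p, hp⟩ := hspan e
    refine ⟨AdjoinRoot.mk _ p, ?_⟩
    change ρ (AdjoinRoot.mk _ p) = π e
    rw [map_sub, sub_eq_zero] at hp
    rw [hp, ← aeval_algHom_apply]
    exact AdjoinRoot.lift_mk hroot p
  have hfin : Module.Finite Λ Q := Module.Finite.of_henselianLocalRing Λ Q
  refine ⟨hfin, fun e => ?_⟩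
  -- By Nakayama's lemma the polynomials in `b` make up the finite module `E / (g)`.
  have hNak : (⊤ : Submodule Λ Q) ≤ LinearMap.range (mkQ.comp (aeval b)).toLinearMap := by
    refine Submodule.le_of_le_smul_of_le_jacobson_bot (I := maximalIdeal Λ) hfin.fg_top
      (maximalIdeal_le_jacobson _) ?_
    rintro y -
    obtain ⟨e, rfl⟩ := Ideal.Quotient.mk_surjective y
    obtain ⟨p, hp⟩ := hspan e
    have h1 : mkQ (e - aeval b p) ∈ maximalIdeal Λ • (⊤ : Submodule Λ Q) := by
      rw [Ideal.smul_top_eq_map]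
      exact Ideal.Quotient.eq_zero_iff_mem.mp hp
    refine Submodule.mem_sup.mpr ⟨mkQ (aeval b p), ⟨p, rfl⟩, _, h1, ?_⟩
    rw [map_sub, add_sub_cancel]
    rfl
  obtain ⟨p, hp⟩ := hNak (Submodule.mem_top (x := mkQ e))
  refine ⟨p, Ideal.mem_span_singleton.mp (Ideal.Quotient.eq_zero_iff_mem.mp ?_)⟩
  change mkQ _ = 0
  rw [map_sub, sub_eq_zero]
  exact hp.symm

end FiniteQuotient

/-! ### Finite quotients of a henselization of the affine line -/

section FiniteOverHenselization

open Polynomial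

/-- A ring maps to the henselization of its local ring at a prime by a universal map. -/
theorem IsHenselUniversal.toLocalHenselization_comp_localization {M : Type u} [CommRing M]
    (y : Ideal M) [y.IsPrime] (R : Type u) [CommRing R] [IsLocalRing R] [Algebra M R]
    [IsLocalization.AtPrime R y] :
    IsHenselUniversal ((_root_.toLocalHenselization R).hom.comp (algebraMap M R)) := by
  have h : IsHenselUniversal ((algebraMap M R).comp (algebraMap M M)) := by
    refine IsHenselUniversal.of_isEtaleAt (P := M) (C := M) y fun a => ?_
    obtain ⟨a, rfl⟩ := residue_surjective a
    obtain ⟨x, t, rfl⟩ := IsLocalization.exists_mk'_eq y.primeCompl a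
    refine ⟨x, t, ?_, ?_⟩
    · exact ((IsLocalization.map_units _ t).map (residue _)).ne_zero
    · rw [← map_mul]
      exact congrArg _ (IsLocalization.mk'_spec _ x t)
  exact h.comp (toLocalHenselization _) inferInstance

/-- Finitely many elements of a henselian local ring `A` that is universal over `M` come from a flat
unramified local `M`-algebra essentially of finite type. -/
theorem IsHenselUniversal.exists_local_rep_finite {M A : Type u} [CommRing M] [CommRing A]
    [HenselianLocalRing A] {f : M →+* A} (hf : IsHenselUniversal f) {ι : Type*} [Finite ι]
    (a : ι → A) :
    ∃ (E : Type u) (_ : CommRing E) (_ : IsLocalRing E) (_ : Algebra M E)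
      (θ : E →+* A) (b : ι → E), Algebra.EssFiniteType M E ∧ Module.Flat M E ∧
      ((maximalIdeal A).comap f).map (algebraMap M E) = maximalIdeal E ∧
      (∀ e : E, ∃ x t : M, f t ∉ maximalIdeal A ∧
        algebraMap M E t * e - algebraMap M E x ∈ maximalIdeal E) ∧ IsLocalHom θ ∧
      θ.comp (algebraMap M E) = f ∧ ∀ i, θ (b i) = a i := by
  let y := (maximalIdeal A).comap f
  let R := Localization.AtPrime y
  have hR := IsHenselUniversal.toLocalHenselization_comp_localization y R
  obtain ⟨σ, hσ⟩ := hf.exists_ringEquiv hR (by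
    rw [← Ideal.comap_comap, comap_maximalIdeal_of_isLocalHom
      (_root_.toLocalHenselization R).hom inferInstance]
    exact (IsLocalization.AtPrime.under_maximalIdeal _ y).symm)
  obtain ⟨E, _, _, _, θ, b, hess, hflat, hmax, hres, hθl, hθ, hb⟩ :=
    localHenselization.exists_local_rep_finite (R := R) fun i => σ (a i)
  let : Algebra M E := ((algebraMap R E).comp (algebraMap M R)).toAlgebra
  have : IsScalarTower M R E := .of_algebraMap_eq' rfl
  have : Module.Flat M R := IsLocalization.flat R y.primeCompl
  have : Algebra.EssFiniteType M R := .of_isLocalization R y.primeCompl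
  refine ⟨E, inferInstance, inferInstance, inferInstance, σ.symm.toRingHom.comp θ, b,
    .comp M R E, .trans M R E, ?_, fun e => ?_, ?_, ?_, fun i => ?_⟩
  · rw [IsScalarTower.algebraMap_eq M R E, ← Ideal.map_map,
      show y.map (algebraMap M R) = _ from IsLocalization.AtPrime.map_eq_maximalIdeal y R, hmax]
  · obtain ⟨r, hr⟩ := hres e
    obtain ⟨x, t, rfl⟩ := IsLocalization.exists_mk'_eq y.primeCompl r
    refine ⟨x, t, t.2, ?_⟩
    rw [IsScalarTower.algebraMap_apply M R E, IsScalarTower.algebraMap_apply M R E,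
      ← IsLocalization.mk'_spec' R x t, map_mul, ← mul_sub]
    exact Ideal.mul_mem_left _ _ hr
  · have : IsLocalHom σ.symm.toRingHom := ⟨fun x hx => by simpa using hx.map σ⟩
    exact RingHom.isLocalHom_comp _ _
  · refine RingHom.ext fun m => σ.injective ?_
    change σ (σ.symm (θ _)) = _
    rw [RingEquiv.apply_symm_apply, IsScalarTower.algebraMap_apply M R E, hθ]
    exact (congrArg (fun k => k m) hσ).symm
  · change σ.symm (θ _) = _
    rw [hb, RingEquiv.symm_apply_apply]

/-- Let `A` be a local `Λ`-algebra that is the henselization of `Λ[X]` at a point of the closed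
fibre, given by `F`. Then `A / (g)` is finite over `Λ` and generated by the coordinate if `g` is,
modulo the maximal ideal of `Λ`, the product of a unit and a power of `F`. -/
theorem IsHenselUniversal.finite_quotient_and_exists_dvd_sub_aeval {Λ A : Type u} [CommRing Λ]
    [CommRing A] [HenselianLocalRing Λ] [HenselianLocalRing A] [Algebra Λ A]
    [IsLocalHom (algebraMap Λ A)] (b : A)
    (hb : IsHenselUniversal (aeval (R := Λ) b).toRingHom) (F : Λ[X]) (hF : F.Monic)
    (hm : ∀ p : Λ[X], aeval b p ∈ maximalIdeal A →
      p ∈ (maximalIdeal Λ).map (C : Λ →+* Λ[X]) ⊔ Ideal.span {F})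
    (hres : ∀ a : A, ∃ p : Λ[X], a - aeval b p ∈ maximalIdeal A) (g v : A) (hv : IsUnit v) (j : ℕ)
    (hg : g - v * aeval b F ^ j ∈ (maximalIdeal Λ).map (algebraMap Λ A)) :
    Module.Finite Λ (A ⧸ Ideal.span {g}) ∧ ∀ a : A, ∃ p : Λ[X], g ∣ a - aeval b p := by
  by_cases hgm : g ∈ maximalIdeal A
  swap
  · have hgu : IsUnit g := by rwa [mem_maximalIdeal, mem_nonunits_iff, not_not] at hgm
    have : Subsingleton (A ⧸ Ideal.span {g}) :=
      Ideal.Quotient.subsingleton_iff.mpr (Ideal.span_singleton_eq_top.mpr hgu)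
    exact ⟨inferInstance, fun a => ⟨0, hgu.dvd⟩⟩
  -- Finitely many elements witness the hypothesis on `g`. They and any further element `a` come
  -- from a local algebra essentially of finite type, where the criterion applies.
  obtain ⟨n, c, l, hcl⟩ := Submodule.mem_span_set'.mp hg
  choose l' hl' hll' using fun i => (l i).2
  have key : ∀ a : A, ∃ (E : Type u) (_ : CommRing E) (_ : Algebra Λ E) (θ : E →ₐ[Λ] A)
      (b' g' a' : E), θ b' = b ∧ θ g' = g ∧ θ a' = a ∧ Module.Finite Λ (E ⧸ Ideal.span {g'}) ∧
        ∀ e : E, ∃ p : Λ[X], g' ∣ e - aeval b' p := by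
    intro a
    obtain ⟨E, _, _, _, θ, w, hess, -, hmax, hres', hθl, hθ, hw⟩ :=
      hb.exists_local_rep_finite (Sum.elim c ![v, a])
    have hθ' : ∀ p : Λ[X], θ (algebraMap Λ[X] E p) = aeval b p :=
      fun p => congrArg (fun k => k p) hθ
    let : Algebra Λ E := ((algebraMap Λ[X] E).comp C).toAlgebra
    have : IsScalarTower Λ Λ[X] E := .of_algebraMap_eq' rfl
    have hθΛ : ∀ l, θ (algebraMap Λ E l) = algebraMap Λ A l := fun l =>
      (hθ' (C l)).trans (aeval_C b l)
    let θ' : E →ₐ[Λ] A := ⟨θ, hθΛ⟩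
    have : Algebra.EssFiniteType Λ E := .comp Λ Λ[X] E
    have : IsLocalHom (algebraMap Λ E) := ⟨fun l h => by
      have := h.map θ
      rw [hθΛ] at this
      exact isUnit_of_map_unit (algebraMap Λ A) l this⟩
    let b' : E := algebraMap Λ[X] E X
    have hb' : ∀ p : Λ[X], aeval b' p = algebraMap Λ[X] E p := fun p => by
      rw [aeval_algebraMap_apply, aeval_X_left_apply]
    have hcomap := comap_maximalIdeal_of_isLocalHom θ hθl
    have hmE : ∀ p : Λ[X], aeval b p ∈ maximalIdeal A → algebraMap Λ[X] E p ∈ maximalIdeal E :=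
      fun p hp => by rw [← hcomap, Ideal.mem_comap, hθ']; exact hp
    let g' : E := w (.inr 0) * aeval b' F ^ j + ∑ i, w (.inl i) * algebraMap Λ E (l' i)
    have hg' : θ g' = g := by
      have h1 : θ (w (.inr 0)) = v := hw _
      have h2 : ∀ i, θ (w (.inl i)) = c i := fun i => hw _
      simp only [g', map_add, map_mul, map_sum, map_pow, h1, h2, hb', hθ', hθΛ, hll']
      exact (sub_eq_iff_eq_add'.mp hcl.symm).symm
    refine ⟨E, inferInstance, inferInstance, θ', b', g', w (.inr 1), (hθ' X).trans (aeval_X b), hg',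
      hw _, ?_⟩
    refine _root_.finite_quotient_and_exists_dvd_sub_aeval b' F hF ?_ ?_ g' (w (.inr 0)) ?_ j ?_ ?_
    · rw [← hmax, Ideal.map_le_iff_le_comap]
      intro p hp
      have h1 := Ideal.mem_map_of_mem (algebraMap Λ[X] E) (hm p hp)
      rw [Ideal.map_sup, Ideal.map_map, Ideal.map_span, Set.image_singleton, ← hb'] at h1
      exact h1
    · intro e
      obtain ⟨x, t, ht, hxt⟩ := hres' e
      -- The denominator `t` is inverted in the residue field by another polynomial.
      obtain ⟨u, hu⟩ : IsUnit (aeval b t) := by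
        rw [mem_maximalIdeal, mem_nonunits_iff, not_not] at ht
        exact ht
      obtain ⟨s, hs⟩ := hres ↑u⁻¹
      have h1 : algebraMap Λ[X] E (1 - t * s) ∈ maximalIdeal E := hmE _ (by
        have : aeval b (1 - t * s) = aeval b t * (↑u⁻¹ - aeval b s) := by
          rw [map_sub, map_mul, map_one, mul_sub, ← hu, Units.mul_inv]
        rw [this]
        exact Ideal.mul_mem_left _ _ hs)
      refine ⟨s * x, ?_⟩
      have : e - aeval b' (s * x) = algebraMap Λ[X] E (1 - t * s) * e +
          algebraMap Λ[X] E s * (algebraMap Λ[X] E t * e - algebraMap Λ[X] E x) := by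
        rw [hb', map_sub, map_mul, map_mul, map_one]
        ring
      rw [this]
      exact add_mem (Ideal.mul_mem_right _ _ h1) (Ideal.mul_mem_left _ _ hxt)
    · refine isUnit_of_map_unit θ _ ?_
      rwa [show θ (w (.inr 0)) = v from hw _]
    · rw [add_sub_cancel_left]
      exact Ideal.sum_mem _ fun i _ => Ideal.mul_mem_left _ _ (Ideal.mem_map_of_mem _ (hl' i))
    · rw [← hcomap, Ideal.mem_comap, hg']
      exact hgm
  have hsurj : ∀ a : A, ∃ p : Λ[X], g ∣ a - aeval b p := by
    intro a
    obtain ⟨E, _, _, θ, b', g', a', hb', hg', ha', -, h⟩ := key a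
    obtain ⟨p, hp⟩ := h a'
    refine ⟨p, ?_⟩
    have := map_dvd θ hp
    rwa [hg', map_sub, ha', ← aeval_algHom_apply, hb'] at this
  refine ⟨?_, hsurj⟩
  obtain ⟨E, _, _, θ, b', g', a', hb', hg', -, hfin, -⟩ := key 0
  let ρ : (E ⧸ Ideal.span {g'}) →ₐ[Λ] (A ⧸ Ideal.span {g}) := Ideal.quotientMapₐ _ θ (by
    rw [Ideal.span_singleton_le_iff_mem, Ideal.mem_comap]
    change θ g' ∈ _
    rw [hg']
    exact Ideal.mem_span_singleton_self g)
  refine Module.Finite.of_surjective ρ.toLinearMap fun a => ?_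
  obtain ⟨a, rfl⟩ := Ideal.Quotient.mk_surjective a
  obtain ⟨p, hp⟩ := hsurj a
  refine ⟨Ideal.Quotient.mk _ (aeval b' p), ?_⟩
  change Ideal.Quotient.mk _ (θ (aeval b' p)) = _
  rw [← aeval_algHom_apply, hb']
  exact (Ideal.Quotient.eq.mpr (Ideal.mem_span_singleton.mpr hp)).symm

end FiniteOverHenselization

/-! ### Curves in the spectrum of a noetherian local ring -/

section Curve

/-- A nonzerodivisor modulo `I` remains one after flat base change. -/
theorem Module.Flat.mem_map_of_mul_mem {P E : Type*} [CommRing P] [CommRing E] [Algebra P E]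
    [Module.Flat P E] (I : Ideal P) (s : P) (h : ∀ x, s * x ∈ I → x ∈ I) (y : E)
    (hy : algebraMap P E s * y ∈ I.map (algebraMap P E)) : y ∈ I.map (algebraMap P E) := by
  have h1 : IsSMulRegular (P ⧸ I) s := (isSMulRegular_quotient_iff_mem_of_smul_mem I s).mpr h
  have h2 := h1.lTensor E
  let e := Algebra.TensorProduct.quotIdealMapEquivTensorQuot E I
  have h3 : e (Ideal.Quotient.mk _ y) = 0 := by
    refine h2 ?_
    change s • _ = s • _
    rw [smul_zero, ← algebraMap_smul E s, ← map_smul, Algebra.smul_def]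
    have : algebraMap E (E ⧸ I.map (algebraMap P E)) (algebraMap P E s) * Ideal.Quotient.mk _ y =
        Ideal.Quotient.mk _ (algebraMap P E s * y) := rfl
    rw [this, Ideal.Quotient.eq_zero_iff_mem.mpr hy, map_zero]
  exact Ideal.Quotient.eq_zero_iff_mem.mp ((EmbeddingLike.map_eq_zero_iff (f := e)).mp h3)

variable {B : Type*} [CommRing B] [IsNoetherianRing B] [IsLocalRing B]

/-- A nonzero element does not vanish on all the hypersurfaces `t = s ^ N`. Indeed an element that
vanishes on all of them is divisible by `t` by Krull's intersection theorem in `B / (t)`, and the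
quotient has the same property because `s` is a nonzerodivisor on each hypersurface; so the ideal of
these elements is zero by Nakayama's lemma. -/
theorem exists_notMem_span_sub_pow {t s : B} (ht : t ∈ maximalIdeal B) (hs : s ∈ maximalIdeal B)
    (hreg : ∀ N, 1 ≤ N → ∀ x, s * x ∈ Ideal.span {t - s ^ N} → x ∈ Ideal.span {t - s ^ N})
    {g : B} (hg : g ≠ 0) : ∃ N, 1 ≤ N ∧ g ∉ Ideal.span {t - s ^ N} := by
  by_contra! hcon
  let W : Ideal B := ⨅ N : ℕ, Ideal.span {t - s ^ (N + 1)}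
  have hpow : ∀ N, 1 ≤ N → ∀ k x, s ^ k * x ∈ Ideal.span {t - s ^ N} →
      x ∈ Ideal.span {t - s ^ N} := by
    intro N hN k
    induction k with
    | zero => intro x hx; rwa [pow_zero, one_mul] at hx
    | succ k ih => intro x hx; exact ih x (hreg N hN _ (by rwa [← mul_assoc, ← pow_succ']))
  have hW : W ≤ Ideal.span {t} • W := by
    intro w hw
    have hw' : ∀ N : ℕ, w ∈ Ideal.span {t - s ^ (N + 1)} := fun N => (Ideal.mem_iInf.mp hw) N
    have h1 : Ideal.Quotient.mk (Ideal.span {t}) w ∈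
        (⨅ i : ℕ, maximalIdeal B ^ i • ⊤ : Submodule B (B ⧸ Ideal.span {t})) := by
      rw [Submodule.mem_iInf]
      intro i
      obtain ⟨c, hc⟩ := Ideal.mem_span_singleton'.mp (hw' i)
      have h2 : Ideal.Quotient.mk (Ideal.span {t}) w = s ^ i •
          Ideal.Quotient.mk (Ideal.span {t}) (- c * s) := by
        rw [Algebra.smul_def, Ideal.Quotient.algebraMap_eq, ← map_mul, Ideal.Quotient.eq, ← hc]
        exact Ideal.mem_span_singleton'.mpr ⟨c, by ring⟩
      rw [h2]
      exact Submodule.smul_mem_smul (Ideal.pow_mem_pow hs i) Submodule.mem_top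
    rw [Ideal.iInf_pow_smul_eq_bot_of_isLocalRing (maximalIdeal B) Ideal.IsPrime.ne_top',
      Submodule.mem_bot, Ideal.Quotient.eq_zero_iff_mem] at h1
    obtain ⟨h, rfl⟩ := Ideal.mem_span_singleton.mp h1
    refine Submodule.smul_mem_smul (Ideal.mem_span_singleton_self t)
      (Ideal.mem_iInf.mpr fun N => ?_)
    refine hpow _ (Nat.le_add_left 1 N) (N + 1) h ?_
    have : s ^ (N + 1) * h = t * h - (t - s ^ (N + 1)) * h := by ring
    rw [this]
    exact sub_mem (hw' N) (Ideal.mul_mem_right _ _ (Ideal.mem_span_singleton_self _))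
  have hW0 : W = ⊥ := Submodule.eq_bot_of_le_smul_of_le_jacobson_bot _ W
    (IsNoetherian.noetherian W) hW
    (((Ideal.span_singleton_le_iff_mem _).mpr ht).trans (maximalIdeal_le_jacobson _))
  refine hg ((Submodule.mem_bot B).mp (hW0 ▸ Ideal.mem_iInf.mpr fun N => ?_))
  exact hcon _ (Nat.le_add_left 1 N)

/-- A nonzero element remains nonzero on a suitable curve `T i = s ^ e i`. -/
theorem exists_notMem_span_image_sub_pow {ι : Type*} [DecidableEq ι] {T : ι → B} {s : B}
    (hT : ∀ i, T i ∈ maximalIdeal B) (hs : s ∈ maximalIdeal B)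
    (hreg : ∀ (J : Finset ι) (e : ι → ℕ), (∀ i, 1 ≤ e i) →
      ∀ x, s * x ∈ Ideal.span ((fun i => T i - s ^ e i) '' J) →
        x ∈ Ideal.span ((fun i => T i - s ^ e i) '' J))
    {g : B} (hg : g ≠ 0) (J : Finset ι) :
    ∃ e : ι → ℕ, (∀ i, 1 ≤ e i) ∧ g ∉ Ideal.span ((fun i => T i - s ^ e i) '' J) := by
  induction J using Finset.induction_on with
  | empty => exact ⟨fun _ => 1, fun _ => le_rfl, by simpa using hg⟩
  | insert a J ha ih =>
    obtain ⟨e, he, hge⟩ := ih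
    let I := Ideal.span ((fun i => T i - s ^ e i) '' (J : Set ι))
    have hI : I ≤ maximalIdeal B := by
      refine Ideal.span_le.mpr ?_
      rintro _ ⟨i, -, rfl⟩
      exact sub_mem (hT i) (Ideal.pow_mem_of_mem _ hs _ (he i))
    have : Nontrivial (B ⧸ I) := Ideal.Quotient.nontrivial_iff.mpr fun h =>
      (maximalIdeal.isMaximal B).ne_top (top_le_iff.mp (h ▸ hI))
    have : IsLocalRing (B ⧸ I) := .of_surjective' (Ideal.Quotient.mk I) Ideal.Quotient.mk_surjective
    have hl : IsLocalHom (Ideal.Quotient.mk I) := .of_surjective _ Ideal.Quotient.mk_surjective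
    have hm : ∀ x ∈ maximalIdeal B, Ideal.Quotient.mk I x ∈ maximalIdeal (B ⧸ I) := fun x hx => by
      rwa [← Ideal.mem_comap, comap_maximalIdeal_of_isLocalHom _ hl]
    -- Ideals of `B` that contain `I` and one more generator are seen in the quotient by `I`.
    have hspan : ∀ N, Ideal.span ((fun i => T i - s ^ Function.update e a N i) ''
        (insert a J : Finset ι)) = Ideal.span {T a - s ^ N} ⊔ I := by
      intro N
      rw [Finset.coe_insert, Set.image_insert_eq, Function.update_self, Ideal.span_insert]
      congr 2
      refine Set.image_congr fun i hi => ?_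
      rw [Function.update_of_ne (fun h : i = a => ha (h ▸ Finset.mem_coe.mp hi))]
    have hquot : ∀ N x, Ideal.Quotient.mk I x ∈
        Ideal.span {Ideal.Quotient.mk I (T a) - Ideal.Quotient.mk I s ^ N} ↔
          x ∈ Ideal.span {T a - s ^ N} ⊔ I := by
      intro N x
      rw [← map_pow, ← map_sub, ← Set.image_singleton, ← Ideal.map_span,
        ← Ideal.mem_quotient_iff_mem_sup]
    have hupd : ∀ N, 1 ≤ N → ∀ i, 1 ≤ Function.update e a N i := by
      intro N hN i
      by_cases h : i = a
      · subst h; rwa [Function.update_self]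
      · rw [Function.update_of_ne h]; exact he i
    -- One more equation is imposed in the quotient by the previous ones.
    obtain ⟨N, hN, hgN⟩ := exists_notMem_span_sub_pow (hm _ (hT a)) (hm _ hs) (fun N hN x hx => by
      obtain ⟨x, rfl⟩ := Ideal.Quotient.mk_surjective x
      rw [← map_mul, hquot, ← hspan] at hx
      rw [hquot, ← hspan]
      exact hreg _ _ (hupd N hN) x hx)
      (g := Ideal.Quotient.mk I g) (fun h => hge (Ideal.Quotient.eq_zero_iff_mem.mp h))
    exact ⟨Function.update e a N, hupd N hN, fun h => hgN (by rwa [hquot, ← hspan])⟩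

/-- In a noetherian local ring with principal maximal ideal, such as a discrete valuation ring,
each nonzero element is the product of a unit and a power of the generator. -/
theorem exists_isUnit_mul_pow_of_maximalIdeal_le_span {s : B}
    (hm : maximalIdeal B ≤ Ideal.span {s}) (hs : s ∈ maximalIdeal B) {g : B} (hg : g ≠ 0) :
    ∃ (j : ℕ) (v : B), IsUnit v ∧ g = v * s ^ j := by
  have hex : ∃ n, g ∉ Ideal.span {s ^ n} := by
    by_contra! h
    refine hg ((Submodule.mem_bot B).mp ?_)
    rw [← Ideal.iInf_pow_eq_bot_of_isLocalRing (maximalIdeal B) Ideal.IsPrime.ne_top']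
    refine Ideal.mem_iInf.mpr fun n => ?_
    exact (Ideal.span_singleton_le_iff_mem _).mpr (Ideal.pow_mem_pow hs n) (h n)
  classical
  obtain ⟨n, hn, hmin⟩ : ∃ n, g ∉ Ideal.span {s ^ n} ∧ ∀ k < n, g ∈ Ideal.span {s ^ k} :=
    ⟨Nat.find hex, Nat.find_spec hex, fun k hk => not_not.mp (Nat.find_min hex hk)⟩
  cases n with
  | zero => exact (hn (by simp)).elim
  | succ j =>
    obtain ⟨v, hv⟩ := Ideal.mem_span_singleton'.mp (hmin j (Nat.lt_succ_self j))
    refine ⟨j, v, ?_, hv.symm⟩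
    by_contra hvu
    obtain ⟨w, rfl⟩ := Ideal.mem_span_singleton'.mp (hm ((mem_maximalIdeal v).mpr hvu))
    exact hn (Ideal.mem_span_singleton'.mpr ⟨w, by rw [← hv, pow_succ']; ring⟩)

end Curve

/-! ### Curves in the fibre of a henselized affine space -/

section CurveInSmooth

open MvPolynomial

variable {D ι : Type u} [CommRing D]

/-- The equations `T i = F ^ e i`, with `F` a polynomial in the last variable alone, cut out of the
affine space over the domain `D / σ` an integral scheme, as they eliminate the variables `T i`. So
`F` is a nonzerodivisor on it if it does not vanish modulo `σ`. -/
theorem MvPolynomial.mem_of_mul_mem_span_sub_pow (σ : Ideal D) [σ.IsPrime]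
    {F : Polynomial D} (hF : F ∉ σ.map (Polynomial.C : D →+* Polynomial D)) (J : Finset ι)
    (e : ι → ℕ) (x : MvPolynomial (Option ι) D) :
    let s : MvPolynomial (Option ι) D := Polynomial.aeval (X none) F
    let I := σ.map (C : D →+* MvPolynomial (Option ι) D) ⊔
      Ideal.span ((fun i => X (some i) - s ^ e i) '' J)
    s * x ∈ I → x ∈ I := by
  classical
  intro s I hx
  -- The map `ε` eliminates the variables in `J`; its kernel modulo `σ` is the ideal `I`.
  let ε : MvPolynomial (Option ι) D →ₐ[D] MvPolynomial (Option ι) D :=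
    aeval fun o => o.elim (X none) fun i => if i ∈ J then s ^ e i else X (some i)
  have hεn : ε (X none) = X none := aeval_X _ _
  have hεs : ε s = s := by
    simp only [s]
    rw [← Polynomial.aeval_algHom_apply, hεn]
  have hεJ : ∀ i ∈ J, ε (X (some i)) = s ^ e i := fun i hi =>
    (aeval_X _ _).trans (if_pos hi)
  have hεJ' : ∀ i ∉ J, ε (X (some i)) = X (some i) := fun i hi =>
    (aeval_X _ _).trans (if_neg hi)
  have hεC : ∀ d, ε (C d) = C d := fun d => ε.commutes d
  have hsub : ∀ p, p - ε p ∈ I := by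
    intro p
    rw [← Ideal.Quotient.eq]
    have : (Ideal.Quotient.mkₐ D I) = (Ideal.Quotient.mkₐ D I).comp ε := by
      refine MvPolynomial.algHom_ext fun o => ?_
      change Ideal.Quotient.mk I _ = Ideal.Quotient.mk I (ε _)
      cases o with
      | none => rw [hεn]
      | some i =>
        by_cases hi : i ∈ J
        · rw [hεJ i hi, Ideal.Quotient.eq]
          exact Ideal.mem_sup_right (Ideal.subset_span ⟨i, hi, rfl⟩)
        · rw [hεJ' i hi]
    exact congrArg (fun k => k p) this
  have hεI : ∀ p ∈ I, ε p ∈ σ.map (C : D →+* MvPolynomial (Option ι) D) := by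
    have : I ≤ (σ.map (C : D →+* MvPolynomial (Option ι) D)).comap ε := by
      refine sup_le (Ideal.map_le_iff_le_comap.mpr fun d hd => ?_) (Ideal.span_le.mpr ?_)
      · rw [Ideal.mem_comap, Ideal.mem_comap, hεC]
        exact Ideal.mem_map_of_mem _ hd
      · rintro _ ⟨i, hi, rfl⟩
        rw [SetLike.mem_coe, Ideal.mem_comap, map_sub, map_pow, hεJ i hi, hεs, sub_self]
        exact zero_mem _
    exact fun p hp => this hp
  have hprime : (σ.map (C : D →+* MvPolynomial (Option ι) D)).IsPrime := by
    rw [← Ideal.Quotient.isDomain_iff_prime]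
    exact (quotientEquivQuotientMvPolynomial σ).symm.toMulEquiv.isDomain _
  have hs : s ∉ σ.map (C : D →+* MvPolynomial (Option ι) D) := by
    intro h
    let ρ : MvPolynomial (Option ι) D →ₐ[D] Polynomial D := aeval fun _ => Polynomial.X
    have h1 := Ideal.mem_map_of_mem ρ h
    have h2 : ρ s = F := by
      simp only [s]
      rw [← Polynomial.aeval_algHom_apply, aeval_X, Polynomial.aeval_X_left_apply]
    have h3 : (ρ : MvPolynomial (Option ι) D →+* Polynomial D).comp C = Polynomial.C :=
      RingHom.ext fun d => ρ.commutes d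
    rw [h2, ← Ideal.map_coe ρ, Ideal.map_map, h3] at h1
    exact hF h1
  have h1 := hεI _ hx
  rw [map_mul, hεs] at h1
  have h2 := (hprime.mem_or_mem h1).resolve_left hs
  rw [← sub_add_cancel x (ε x)]
  exact add_mem (hsub x) (Ideal.mem_sup_left h2)

/-- The fibre over a point of a local scheme essentially of finite type is noetherian. -/
theorem Algebra.EssFiniteType.isNoetherianRing_quotient_map {E : Type u} [CommRing E]
    [IsLocalRing E] [Algebra D E] [Algebra.EssFiniteType D E] :
    IsNoetherianRing (E ⧸ ((maximalIdeal E).comap (algebraMap D E)).map (algebraMap D E)) := by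
  let σ := (maximalIdeal E).comap (algebraMap D E)
  let B := E ⧸ σ.map (algebraMap D E)
  have h1 : σ ≤ RingHom.ker (algebraMap D B) := fun d hd =>
    Ideal.Quotient.eq_zero_iff_mem.mpr (Ideal.mem_map_of_mem _ hd)
  have h2 : σ.primeCompl ≤ (IsUnit.submonoid B).comap (algebraMap D B) := fun d hd => by
    have : IsUnit (algebraMap D E d) := by
      by_contra h
      exact hd ((mem_maximalIdeal _).mpr h)
    exact this.map (Ideal.Quotient.mk (σ.map (algebraMap D E)))
  let : Algebra σ.ResidueField B := (Ideal.ResidueField.lift σ (algebraMap D B) h1 h2).toAlgebra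
  have : IsScalarTower D σ.ResidueField B := .of_algebraMap_eq fun d =>
    (Ideal.ResidueField.lift_algebraMap σ _ h1 h2 d).symm
  have : Algebra.EssFiniteType σ.ResidueField B := .of_comp D _ _
  exact Algebra.EssFiniteType.isNoetherianRing σ.ResidueField B

/-- Let `A` be the henselization of an affine space over `D` at a point over `σ`, where the last
coordinate satisfies the equation `F` and the other ones vanish. Modulo the equations of a suitable
curve `T i = F ^ e i` in the fibre over `σ`, an element of `A` that does not vanish on the fibre is
the product of a unit and a power of the parameter `F`. -/
theorem IsHenselUniversal.exists_sub_mul_pow_mem [Finite ι] {A : Type u} [CommRing A]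
    [HenselianLocalRing A] {f : MvPolynomial (Option ι) D →+* A} (hf : IsHenselUniversal f)
    (σ : Ideal D) [σ.IsPrime] (hσ : (maximalIdeal A).comap (f.comp C) = σ)
    {F : Polynomial D} (hF : F ∉ σ.map (Polynomial.C : D →+* Polynomial D)) :
    let s : MvPolynomial (Option ι) D := Polynomial.aeval (X none) F
    f s ∈ maximalIdeal A → (∀ i, f (X (some i)) ∈ maximalIdeal A) →
    (∀ p, f p ∈ maximalIdeal A → ∃ c, f c ∉ maximalIdeal A ∧
      c * p ∈ σ.map (C : D →+* MvPolynomial (Option ι) D) ⊔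
        Ideal.span (Set.range fun i => X (some i)) ⊔ Ideal.span {s}) →
    ∀ g : A, g ∉ σ.map (f.comp C) → ∃ e : ι → ℕ, (∀ i, 1 ≤ e i) ∧ ∃ (j : ℕ) (v : A), IsUnit v ∧
      g - v * f s ^ j ∈ (σ.map (C : D →+* MvPolynomial (Option ι) D) ⊔
        Ideal.span (Set.range fun i => X (some i) - s ^ e i)).map f := by
  classical
  intro s hs hT hmax g hg
  have := Fintype.ofFinite ι
  obtain ⟨E, _, _, _, θ, w, hess, hflat, hmE, -, hθl, hθ, hw⟩ :=
    hf.exists_local_rep_finite fun _ : Unit => g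
  let P := MvPolynomial (Option ι) D
  have hθ' : ∀ p, θ (algebraMap P E p) = f p := fun p => congrArg (fun k => k p) hθ
  have hcomap := comap_maximalIdeal_of_isLocalHom θ hθl
  have hmem : ∀ p, algebraMap P E p ∈ maximalIdeal E ↔ f p ∈ maximalIdeal A := fun p => by
    rw [← hcomap, Ideal.mem_comap, hθ']
  let : Algebra D E := ((algebraMap P E).comp C).toAlgebra
  have : IsScalarTower D P E := .of_algebraMap_eq' rfl
  have : Algebra.EssFiniteType D E := .comp D P E
  have hσE : (maximalIdeal E).comap (algebraMap D E) = σ := by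
    rw [← hσ]
    ext d
    exact hmem (C d)
  let Iσ := σ.map (algebraMap D E)
  have hIσ : Iσ ≤ maximalIdeal E := by
    rw [Ideal.map_le_iff_le_comap, hσE]
  let B := E ⧸ Iσ
  have : IsNoetherianRing B := by
    have := Algebra.EssFiniteType.isNoetherianRing_quotient_map (D := D) (E := E)
    rwa [hσE] at this
  have : Nontrivial B := Ideal.Quotient.nontrivial_iff.mpr fun h =>
    (maximalIdeal.isMaximal E).ne_top (top_le_iff.mp (h ▸ hIσ))
  have : IsLocalRing B := .of_surjective' (Ideal.Quotient.mk Iσ) Ideal.Quotient.mk_surjective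
  have hBl : IsLocalHom (Ideal.Quotient.mk Iσ) := .of_surjective _ Ideal.Quotient.mk_surjective
  have hBm := comap_maximalIdeal_of_isLocalHom _ hBl
  let β : P →+* B := (Ideal.Quotient.mk Iσ).comp (algebraMap P E)
  have hβm : ∀ p, f p ∈ maximalIdeal A → β p ∈ maximalIdeal B := fun p hp => by
    have := (hmem p).mpr hp
    rwa [← hBm, Ideal.mem_comap] at this
  -- The ideal of the curve in `E`, and its image in the fibre `B`.
  let I : Finset ι → (ι → ℕ) → Ideal P := fun J e => σ.map (C : D →+* P) ⊔
    Ideal.span ((fun i => X (some i) - s ^ e i) '' J)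
  have hI : ∀ (J : Finset ι) (e : ι → ℕ) (x : E), Ideal.Quotient.mk Iσ x ∈
      Ideal.span ((fun i => β (X (some i)) - β s ^ e i) '' J) ↔
        x ∈ (I J e).map (algebraMap P E) := by
    intro J e x
    have h1 : (fun i => β (X (some i)) - β s ^ e i) '' (J : Set ι) =
        Ideal.Quotient.mk Iσ '' ((algebraMap P E) '' ((fun i => X (some i) - s ^ e i) '' J)) := by
      rw [Set.image_image, Set.image_image]
      refine Set.image_congr fun i _ => ?_
      rw [← map_pow, ← map_sub]
      rfl
    rw [h1, ← Ideal.map_span, ← Ideal.map_span, Ideal.mem_quotient_iff_mem_sup, Ideal.map_sup,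
      Ideal.map_map, sup_comm]
    rfl
  have hg0 : Ideal.Quotient.mk Iσ (w ()) ≠ 0 := by
    intro h
    have h1 := Ideal.mem_map_of_mem θ (Ideal.Quotient.eq_zero_iff_mem.mp h)
    rw [hw, Ideal.map_map] at h1
    have h2 : θ.comp (algebraMap D E) = f.comp C := by rw [← hθ]; rfl
    rw [h2] at h1
    exact hg h1
  -- By flatness of `E` the parameter `s` is a nonzerodivisor modulo each part of the equations
  -- of the curve, as it is one in affine space.
  obtain ⟨e, he, hge⟩ := exists_notMem_span_image_sub_pow (fun i => hβm _ (hT i)) (hβm _ hs)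
    (fun J e _ x hx => by
      obtain ⟨x, rfl⟩ := Ideal.Quotient.mk_surjective x
      have h1 : β s * Ideal.Quotient.mk Iσ x = Ideal.Quotient.mk Iσ (algebraMap P E s * x) := rfl
      rw [h1, hI] at hx
      rw [hI]
      exact Module.Flat.mem_map_of_mul_mem _ s
        (fun x => MvPolynomial.mem_of_mul_mem_span_sub_pow σ hF J e x) _ hx) hg0 Finset.univ
  refine ⟨e, he, ?_⟩
  rw [hI] at hge
  let IC := (I Finset.univ e).map (algebraMap P E)
  have hICm : IC ≤ maximalIdeal E := by
    refine Ideal.map_le_iff_le_comap.mpr (sup_le (Ideal.map_le_iff_le_comap.mpr fun d hd => ?_)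
      (Ideal.span_le.mpr ?_))
    · rw [Ideal.mem_comap, Ideal.mem_comap, hmem]
      rw [← hσ] at hd
      exact hd
    · rintro _ ⟨i, -, rfl⟩
      rw [SetLike.mem_coe, Ideal.mem_comap, hmem, map_sub, map_pow]
      exact sub_mem (hT i) (Ideal.pow_mem_of_mem _ hs _ (he i))
  have hσIC : Iσ ≤ IC := by
    refine Ideal.map_le_iff_le_comap.mpr fun d hd => ?_
    exact Ideal.mem_map_of_mem (algebraMap P E) (Ideal.mem_sup_left (Ideal.mem_map_of_mem C hd))
  let Q := E ⧸ IC
  have : IsNoetherianRing Q := isNoetherianRing_of_surjective B Q (Ideal.Quotient.factor hσIC)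
    (Ideal.Quotient.factor_surjective hσIC)
  have : Nontrivial Q := Ideal.Quotient.nontrivial_iff.mpr fun h =>
    (maximalIdeal.isMaximal E).ne_top (top_le_iff.mp (h ▸ hICm))
  have : IsLocalRing Q := .of_surjective' (Ideal.Quotient.mk IC) Ideal.Quotient.mk_surjective
  have hQl : IsLocalHom (Ideal.Quotient.mk IC) := .of_surjective _ Ideal.Quotient.mk_surjective
  have hQm := comap_maximalIdeal_of_isLocalHom _ hQl
  -- The maximal ideal of the curve `Q` is generated by the parameter: `T i` is a power of it.
  let sE := algebraMap P E s
  have hmaxE : maximalIdeal E ≤ IC ⊔ Ideal.span {sE} := by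
    rw [← hmE, Ideal.map_le_iff_le_comap]
    intro p hp
    obtain ⟨c, hc, hcp⟩ := hmax p hp
    have hcu : IsUnit (algebraMap P E c) := by
      by_contra h
      exact hc ((hmem c).mp ((mem_maximalIdeal _).mpr h))
    rw [Ideal.mem_comap, ← Ideal.unit_mul_mem_iff_mem _ hcu, ← map_mul]
    have hle : σ.map (C : D →+* P) ⊔ Ideal.span (Set.range fun i => X (some i)) ⊔ Ideal.span {s} ≤
        (IC ⊔ Ideal.span {sE}).comap (algebraMap P E) := by
      have hsE : sE ∈ IC ⊔ Ideal.span {sE} := Ideal.mem_sup_right (Ideal.mem_span_singleton_self _)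
      refine sup_le (sup_le (Ideal.map_le_iff_le_comap.mpr fun d hd => ?_) (Ideal.span_le.mpr ?_))
        ((Ideal.span_singleton_le_iff_mem _).mpr hsE)
      · exact Ideal.mem_sup_left (hσIC (Ideal.mem_map_of_mem _ hd))
      · rintro _ ⟨i, rfl⟩
        have h1 : algebraMap P E (X (some i) - s ^ e i) ∈ IC := Ideal.mem_map_of_mem _
          (Ideal.mem_sup_right (Ideal.subset_span ⟨i, Finset.mem_coe.mpr (Finset.mem_univ i), rfl⟩))
        have h2 : algebraMap P E (X (some i)) =
            algebraMap P E (X (some i) - s ^ e i) + sE ^ e i := by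
          rw [map_sub, map_pow, sub_add_cancel]
        rw [SetLike.mem_coe, Ideal.mem_comap, h2]
        exact add_mem (Ideal.mem_sup_left h1) (Ideal.pow_mem_of_mem _ hsE _ (he i))
    exact hle hcp
  obtain ⟨j, v, hv, hgv⟩ := exists_isUnit_mul_pow_of_maximalIdeal_le_span
    (s := Ideal.Quotient.mk IC sE) (g := Ideal.Quotient.mk IC (w ())) (by
      intro x hx
      obtain ⟨x, rfl⟩ := Ideal.Quotient.mk_surjective x
      rw [← Set.image_singleton, ← Ideal.map_span, Ideal.mem_quotient_iff_mem_sup, sup_comm]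
      refine hmaxE ?_
      rw [← hQm]
      exact hx) (by
      rw [← Ideal.mem_comap, hQm]
      exact (hmem s).mpr hs) fun h => hge (Ideal.Quotient.eq_zero_iff_mem.mp h)
  obtain ⟨v, rfl⟩ := Ideal.Quotient.mk_surjective v
  refine ⟨j, θ v, (isUnit_of_map_unit _ _ hv).map θ, ?_⟩
  rw [← map_pow, ← map_mul, Ideal.Quotient.eq] at hgv
  have h1 := Ideal.mem_map_of_mem θ hgv
  rw [Ideal.map_map, hθ, map_sub, hw, map_mul, map_pow, hθ'] at h1
  have h2 : (fun i => X (some i) - s ^ e i) '' ((Finset.univ : Finset ι) : Set ι) =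
      Set.range fun i => X (some i) - s ^ e i := by rw [Finset.coe_univ, Set.image_univ]
  rw [← h2]
  exact h1

end CurveInSmooth

/-! ### Simple extensions of fields of fractions -/

section SimpleExtension

open Polynomial

variable {D k K : Type*} [CommRing D] [Field k] [Field K] [Algebra D k] [Algebra k K]

/-- Polynomials over a field of fractions have common denominators. -/
theorem exists_map_eq_C_mul_of_fractions
    (hfrac : ∀ a : k, ∃ x y : D, algebraMap D k y ≠ 0 ∧ a * algebraMap D k y = algebraMap D k x)
    (p : k[X]) : ∃ (d : D) (F : D[X]), algebraMap D k d ≠ 0 ∧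
      F.map (algebraMap D k) = C (algebraMap D k d) * p := by
  induction p using Polynomial.induction_on' with
  | add p q hp hq =>
    obtain ⟨d, F, hd, hF⟩ := hp
    obtain ⟨d', F', hd', hF'⟩ := hq
    refine ⟨d * d', C d' * F + C d * F', by rw [map_mul]; exact mul_ne_zero hd hd', ?_⟩
    rw [Polynomial.map_add, Polynomial.map_mul, Polynomial.map_mul, hF, hF', Polynomial.map_C,
      Polynomial.map_C, map_mul, C_mul]
    ring
  | monomial n a =>
    obtain ⟨x, y, hy, hxy⟩ := hfrac a
    exact ⟨y, monomial n x, hy, by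
      rw [Polynomial.map_monomial, C_mul_monomial, mul_comm, hxy]⟩

/-- In a finite simple extension of the field of fractions of `D` that consists of fractions of
elements of `R`, there is a generator in the image of `R`. -/
theorem exists_adjoin_algebraMap_eq_top {R : Type*} [CommRing R] [Algebra D R] [Algebra R K]
    [Algebra D K] [IsScalarTower D k K] [IsScalarTower D R K] [Algebra.IsAlgebraic k K]
    (hfrac : ∀ a : k, ∃ x y : D, algebraMap D k y ≠ 0 ∧ a * algebraMap D k y = algebraMap D k x)
    (hfrac' : ∀ a : K, ∃ x y : R, algebraMap R K y ≠ 0 ∧ a * algebraMap R K y = algebraMap R K x)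
    {α : K} (hα : IntermediateField.adjoin k {α} = ⊤) :
    ∃ b : R, IntermediateField.adjoin k {algebraMap R K b} = ⊤ := by
  obtain ⟨x, y, hy, hxy⟩ := hfrac' α
  -- A multiple of the denominator `y` comes from `D`.
  have hinv := (Algebra.IsIntegral.isIntegral (R := k) (algebraMap R K y)).inv_mem_adjoin
  rw [Algebra.adjoin_singleton_eq_range_aeval] at hinv
  obtain ⟨q, hq⟩ := hinv
  obtain ⟨d, Q, hd, hQ⟩ := exists_map_eq_C_mul_of_fractions hfrac q
  have hdK : algebraMap D K d ≠ 0 := by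
    rw [IsScalarTower.algebraMap_apply D k K]
    exact (_root_.map_ne_zero _).mpr hd
  have h1 : algebraMap R K (aeval y Q) = algebraMap D K d * (algebraMap R K y)⁻¹ := by
    rw [← aeval_algebraMap_apply, ← aeval_map_algebraMap k, hQ, map_mul, aeval_C, ← hq,
      ← IsScalarTower.algebraMap_apply]
    rfl
  have h2 : algebraMap R K (x * aeval y Q) = algebraMap D K d * α := by
    rw [map_mul, h1, ← hxy]
    field_simp
  refine ⟨x * aeval y Q, ?_⟩
  rw [h2, eq_top_iff, ← hα, IntermediateField.adjoin_simple_le_iff]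
  -- The factor `d` is a nonzero scalar.
  have h3 : α = algebraMap k K (algebraMap D k d)⁻¹ * (algebraMap D K d * α) := by
    rw [map_inv₀, ← IsScalarTower.algebraMap_apply, inv_mul_cancel_left₀ hdK]
  exact (congrArg (· ∈ IntermediateField.adjoin k {algebraMap D K d * α}) h3).mpr (mul_mem
    (IntermediateField.algebraMap_mem _ _) (IntermediateField.mem_adjoin_simple_self k _))

variable [Algebra D K] [IsScalarTower D k K] [Algebra.IsAlgebraic k K]

/-- Every element of a simple extension is a polynomial in the generator, up to a denominator. -/
theorem exists_mul_eq_aeval_of_adjoin_eq_top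
    (hfrac : ∀ a : k, ∃ x y : D, algebraMap D k y ≠ 0 ∧ a * algebraMap D k y = algebraMap D k x)
    {α : K} (hα : IntermediateField.adjoin k {α} = ⊤) (a : K) :
    ∃ (d : D) (F : D[X]), algebraMap D K d ≠ 0 ∧ a * algebraMap D K d = aeval α F := by
  have ha : a ∈ (IntermediateField.adjoin k {α}).toSubalgebra := hα ▸ IntermediateField.mem_top
  rw [IntermediateField.adjoin_simple_toSubalgebra_of_isAlgebraic
    (Algebra.IsAlgebraic.isAlgebraic α), Algebra.adjoin_singleton_eq_range_aeval] at ha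
  obtain ⟨q, rfl⟩ := ha
  obtain ⟨d, F, hd, hF⟩ := exists_map_eq_C_mul_of_fractions hfrac q
  refine ⟨d, F, ?_, ?_⟩
  · rw [IsScalarTower.algebraMap_apply D k K]
    exact (_root_.map_ne_zero _).mpr hd
  · rw [← aeval_map_algebraMap k, hF, map_mul, aeval_C, ← IsScalarTower.algebraMap_apply, mul_comm]
    rfl

end SimpleExtension

/-! ### Bases of values of a derivation -/

section Coordinates

open Polynomial

/-- If the vector space `V` of dimension `m + 1` is spanned by the values of a derivation, and the
field `K` is generated by the class of `b₀`, then there is a basis that consists of the values of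
the derivation at one element congruent to `b₀` and at elements congruent to zero. -/
theorem Derivation.exists_basis_option {D R K V : Type*} [CommRing D] [CommRing R] [Field K]
    [Algebra D R] [Algebra R K] [Algebra D K] [IsScalarTower D R K] [AddCommGroup V] [Module D V]
    [Module R V] [Module K V] [IsScalarTower D R V] [IsScalarTower R K V]
    (δ : Derivation D R V) (hspan : Submodule.span K (Set.range δ) = ⊤) {m : ℕ}
    (hV : Module.finrank K V = m + 1) (b₀ : R)
    (hb₀ : ∀ a : K, ∃ (d : D) (F : D[X]), algebraMap D K d ≠ 0 ∧
      a * algebraMap D K d = aeval (algebraMap R K b₀) F) :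
    ∃ (b : R) (t : Fin m → R) (v : Module.Basis (Option (Fin m)) K V),
      algebraMap R K b = algebraMap R K b₀ ∧ (∀ i, algebraMap R K (t i) = 0) ∧
        v none = δ b ∧ ∀ i, v (some i) = δ (t i) := by
  have : FiniteDimensional K V := Module.finite_of_finrank_eq_succ hV
  let N : Set V := δ '' {u | algebraMap R K u = 0}
  have hN : ⊤ ≤ Submodule.span K (insert (δ b₀) N) := by
    rw [← hspan, Submodule.span_le]
    rintro _ ⟨c, rfl⟩
    obtain ⟨d, F, hd, hF⟩ := hb₀ (algebraMap R K c)
    have h1 : δ (d • c - aeval b₀ F) ∈ Submodule.span K (insert (δ b₀) N) := by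
      refine Submodule.subset_span (Set.mem_insert_of_mem _ ⟨_, ?_, rfl⟩)
      change algebraMap R K _ = 0
      rw [map_sub, Algebra.smul_def, map_mul, ← IsScalarTower.algebraMap_apply,
        mul_comm, hF, aeval_algebraMap_apply, sub_self]
    have h2 : aeval b₀ (derivative F) • δ b₀ ∈ Submodule.span K (insert (δ b₀) N) := by
      rw [← algebraMap_smul K]
      exact Submodule.smul_mem _ _ (Submodule.subset_span (Set.mem_insert _ _))
    have h3 : algebraMap D K d • δ c ∈ Submodule.span K (insert (δ b₀) N) := by
      have := add_mem h1 h2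
      rwa [map_sub, Derivation.map_smul, Derivation.map_aeval, sub_add_cancel,
        ← algebraMap_smul R d, ← algebraMap_smul K (algebraMap D R d),
        ← IsScalarTower.algebraMap_apply] at this
    exact (Submodule.smul_mem_iff _ hd).mp h3
  obtain ⟨b, hb, hδb, hbN⟩ : ∃ b, algebraMap R K b = algebraMap R K b₀ ∧ δ b ≠ 0 ∧
      ⊤ ≤ Submodule.span K (insert (δ b) N) := by
    -- If the differential of `b₀` vanishes, an element of the kernel with nonzero differential is
    -- added to `b₀`.
    by_cases h0 : δ b₀ = 0
    · rw [h0, Submodule.span_insert_zero] at hN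
      obtain ⟨_, ⟨u, hu, rfl⟩, hu0⟩ : ∃ x ∈ N, x ≠ 0 := by
        by_contra! h
        have h1 : Submodule.span K N = ⊥ := Submodule.span_eq_bot.mpr h
        rw [h1] at hN
        have h2 : Module.finrank K (⊤ : Submodule K V) = 0 := by
          rw [show (⊤ : Submodule K V) = ⊥ from le_bot_iff.mp hN, finrank_bot]
        rw [finrank_top, hV] at h2
        exact Nat.succ_ne_zero _ h2
      refine ⟨b₀ + u, ?_, ?_, hN.trans (Submodule.span_mono (Set.subset_insert _ _))⟩
      · rw [map_add, show algebraMap R K u = 0 from hu, add_zero]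
      · rwa [map_add, h0, zero_add]
    · exact ⟨b₀, rfl, h0, hN⟩
  have hli : LinearIndepOn K id {δ b} := LinearIndepOn.singleton hδb
  have hsub : {δ b} ⊆ insert (δ b) N := Set.singleton_subset_iff.mpr (Set.mem_insert _ _)
  let v := Module.Basis.extendLe hli hsub hbN
  let x₀ : hli.extend hsub := ⟨δ b, hli.subset_extend hsub (Set.mem_singleton _)⟩
  have := Module.Finite.finite_basis v
  have hcard : Nat.card {x : hli.extend hsub // x ≠ x₀} = m := by
    classical
    have h1 := Module.finrank_eq_nat_card_basis v
    rw [hV, ← Nat.card_congr (Equiv.optionSubtypeNe x₀), Finite.card_option] at h1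
    exact (Nat.succ_injective h1).symm
  classical
  let e₁ : Fin m ≃ {x : hli.extend hsub // x ≠ x₀} := (Finite.equivFinOfCardEq hcard).symm
  let e : Option (Fin m) ≃ hli.extend hsub :=
    (Equiv.optionCongr e₁).trans (Equiv.optionSubtypeNe x₀)
  have hmem : ∀ i, ((e₁ i : hli.extend hsub) : V) ∈ N := fun i => by
    refine (hli.extend_subset hsub (e₁ i).1.2).resolve_left fun h => (e₁ i).2 (Subtype.ext h)
  choose t ht hδt using hmem
  refine ⟨b, t, v.reindex e.symm, hb, ht, ?_, fun i => ?_⟩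
  · rw [Module.Basis.reindex_apply, Module.Basis.extendLe_apply_self]
    rfl
  · rw [Module.Basis.reindex_apply, Module.Basis.extendLe_apply_self, hδt]
    rfl

end Coordinates

/-! ### Étale coordinates of a smooth algebra -/

section EtaleCoordinates

open KaehlerDifferential TensorProduct

/-- Elements of a formally smooth algebra whose differentials are a basis of the module of
differentials define a formally étale map from the polynomial ring. -/
theorem Algebra.FormallyEtale.of_basis_kaehlerDifferential {D L τ : Type u} [CommRing D]
    [CommRing L] [Algebra D L] [Algebra.FormallySmooth D L] [Algebra (MvPolynomial τ D) L]
    [IsScalarTower D (MvPolynomial τ D) L] (b : Module.Basis τ L Ω[L⁄D])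
    (hb : ∀ o, b o = KaehlerDifferential.D D L (algebraMap (MvPolynomial τ D) L (.X o))) :
    Algebra.FormallyEtale (MvPolynomial τ D) L := by
  let P := MvPolynomial τ D
  let v : Module.Basis τ L (L ⊗[P] Ω[P⁄D]) := (mvPolynomialBasis D τ).baseChange L
  have hbij : Function.Bijective (mapBaseChange D P L) := by
    have : mapBaseChange D P L = (v.equiv b (Equiv.refl τ)).toLinearMap := by
      refine v.ext fun o => ?_
      rw [LinearEquiv.coe_coe, Module.Basis.equiv_apply, Module.Basis.baseChange_apply,
        mvPolynomialBasis_apply, mapBaseChange_tmul, one_smul, map_D, Equiv.refl_apply, hb]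
    rw [this]
    exact (v.equiv b (Equiv.refl τ)).bijective
  refine ⟨subsingleton_of_forall_eq 0 fun w => ?_, subsingleton_of_forall_eq 0 fun w => ?_⟩
  · obtain ⟨w, rfl⟩ := map_surjective D P L w
    exact (exact_mapBaseChange_map D P L w).mpr (hbij.2 w)
  · have h1 : Algebra.H1Cotangent.δ D P L w = 0 := by
      apply hbij.1
      rw [map_zero]
      exact (Algebra.H1Cotangent.exact_δ_mapBaseChange D P L _).mpr ⟨w, rfl⟩
    obtain ⟨w, rfl⟩ := (Algebra.H1Cotangent.exact_map_δ D P L w).mp h1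
    rw [Subsingleton.elim w 0, map_zero]

variable {D R : Type u} [CommRing D] [CommRing R] [Algebra D R] (p : Ideal R) [p.IsPrime]

/-- At a point of a standard smooth scheme of positive relative dimension `m + 1` whose residue
field is generated by the class of `b₀`, there are étale coordinates such that one of them has this
class at the point, and the others vanish there. -/
theorem exists_isEtaleAt_mvPolynomial {m : ℕ}
    [Algebra.IsStandardSmoothOfRelativeDimension (m + 1) D R] (b₀ : R)
    (hb₀ : ∀ a : ResidueField (Localization.AtPrime p), ∃ (d : D) (F : Polynomial D),
      algebraMap D (ResidueField (Localization.AtPrime p)) d ≠ 0 ∧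
      a * algebraMap D _ d = Polynomial.aeval (algebraMap R _ b₀) F) :
    ∃ f : MvPolynomial (Option (ULift.{u} (Fin m))) D →ₐ[D] R, f (.X none) - b₀ ∈ p ∧
      (∀ i, f (.X (some i)) ∈ p) ∧
      letI := f.toRingHom.toAlgebra
      Algebra.IsEtaleAt (MvPolynomial (Option (ULift.{u} (Fin m))) D) p := by
  let L := Localization.AtPrime p
  let K := ResidueField L
  let V := K ⊗[L] Ω[L⁄D]
  have hnt : Nontrivial R := ⟨0, 1, fun h => (Ideal.ne_top_iff_one p).mp Ideal.IsPrime.ne_top'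
    (h ▸ zero_mem p)⟩
  have : Algebra.IsStandardSmooth D R :=
    Algebra.IsStandardSmoothOfRelativeDimension.isStandardSmooth (m + 1)
  have hsm : Algebra.FormallySmooth D R := inferInstance
  have hsmL : Algebra.FormallySmooth R L := .of_isLocalization p.primeCompl
  have hetL : Algebra.FormallyEtale R L := .of_isLocalization p.primeCompl
  have : Algebra.FormallySmooth D L := .comp D R L
  let e : L ⊗[R] Ω[R⁄D] ≃ₗ[L] Ω[L⁄D] := tensorKaehlerEquivOfFormallyEtale D R L
  have hfree : Module.Free L Ω[L⁄D] := .of_equiv e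
  have hfin : Module.Finite L Ω[L⁄D] := .equiv e
  have hrank : Module.finrank K V = m + 1 := by
    rw [Module.finrank_baseChange, ← e.finrank_eq, Module.finrank_baseChange]
    exact Module.finrank_eq_of_rank_eq
      (Algebra.IsStandardSmoothOfRelativeDimension.rank_kaehlerDifferential (m + 1))
  let δ : Derivation D R V :=
    ((TensorProduct.mk L K Ω[L⁄D] 1).restrictScalars R).compDer
      ((KaehlerDifferential.D D L).compAlgebraMap R)
  have hδ : ∀ c, δ c = 1 ⊗ₜ KaehlerDifferential.D D L (algebraMap R L c) := fun c => rfl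
  have hspan : Submodule.span K (Set.range δ) = ⊤ := by
    have h1 : ∀ ω : Ω[L⁄D], (1 : K) ⊗ₜ[L] ω ∈ Submodule.span K (Set.range δ) := by
      intro ω
      have hω : ω ∈ Submodule.span L (Set.range (map D D R L ∘ KaehlerDifferential.D D R)) := by
        rw [span_range_map_derivation_of_isLocalization D R L p.primeCompl]
        exact Submodule.mem_top
      induction hω using Submodule.span_induction with
      | mem ω hω =>
        obtain ⟨c, rfl⟩ := hω
        refine Submodule.subset_span ⟨c, ?_⟩
        rw [hδ, Function.comp_apply, map_D]
      | zero => rw [tmul_zero]; exact zero_mem _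
      | add ω ω' _ _ h h' => rw [tmul_add]; exact add_mem h h'
      | smul l ω _ h =>
        rw [tmul_smul, ← algebraMap_smul K l]
        exact Submodule.smul_mem _ _ h
    rw [eq_top_iff]
    rintro x -
    induction x using TensorProduct.induction_on with
    | zero => exact zero_mem _
    | add x y hx hy => exact add_mem hx hy
    | tmul a ω =>
      have : a ⊗ₜ[L] ω = a • ((1 : K) ⊗ₜ[L] ω) := by rw [smul_tmul', smul_eq_mul, mul_one]
      rw [this]
      exact Submodule.smul_mem _ _ (h1 ω)
  obtain ⟨b, t, v, hb, ht, hvn, hvs⟩ := δ.exists_basis_option hspan hrank b₀ hb₀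
  have hp : ∀ c : R, algebraMap R K c = 0 → c ∈ p := fun c hc => by
    rw [IsScalarTower.algebraMap_apply R L K] at hc
    exact (IsLocalization.AtPrime.to_map_mem_maximal_iff L p c).mp ((residue_eq_zero_iff _).mp hc)
  let x : Option (ULift.{u} (Fin m)) → R := fun o => o.elim b fun i => t i.down
  let f : MvPolynomial (Option (ULift.{u} (Fin m))) D →ₐ[D] R := MvPolynomial.aeval x
  have hf : ∀ o, f (.X o) = x o := MvPolynomial.aeval_X x
  refine ⟨f, ?_, fun i => ?_, ?_⟩
  · rw [hf]
    exact hp _ (by rw [map_sub, sub_eq_zero]; exact hb)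
  · rw [hf]
    exact hp _ (ht i.down)
  · let : Algebra (MvPolynomial (Option (ULift.{u} (Fin m))) D) R := f.toRingHom.toAlgebra
    have : IsScalarTower D (MvPolynomial (Option (ULift.{u} (Fin m))) D) R :=
      .of_algebraMap_eq fun d => (f.commutes d).symm
    have : IsScalarTower D (MvPolynomial (Option (ULift.{u} (Fin m))) D) L :=
      .of_algebraMap_eq fun d => by
        rw [IsScalarTower.algebraMap_apply D R L,
          IsScalarTower.algebraMap_apply D (MvPolynomial (Option (ULift.{u} (Fin m))) D) R]
        rfl
    let w : Option (ULift.{u} (Fin m)) → Ω[L⁄D] := fun o =>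
      KaehlerDifferential.D D L (algebraMap R L (x o))
    let v' := v.reindex (Equiv.optionCongr Equiv.ulift.symm)
    have hw : ∀ o, 1 ⊗ₜ w o = v' o := by
      intro o
      rw [Module.Basis.reindex_apply]
      cases o with
      | none => exact hvn.symm
      | some i => exact (hvs i.down).symm
    have hli : LinearIndependent L w := Module.IsLocalRing.linearIndependent_of_flat w (by
      have : TensorProduct.mk L K Ω[L⁄D] 1 ∘ w = v' := funext hw
      rw [this]
      exact v'.linearIndependent)
    have hsp : ⊤ ≤ Submodule.span L (Set.range w) := (span_eq_top_of_tmul_eq_basis w v' hw).ge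
    refine Algebra.FormallyEtale.of_basis_kaehlerDifferential (Module.Basis.mk hli hsp) fun o => ?_
    rw [Module.Basis.mk_apply]
    exact congrArg (fun c => KaehlerDifferential.D D L (algebraMap R L c)) (hf o).symm

end EtaleCoordinates

/-! ### Henselizations of affine spaces -/

section HenselizedAffineSpace

open MvPolynomial

/-- Modulo an ideal that contains the variables, a polynomial is its constant coefficient. -/
theorem MvPolynomial.map_mem_iff_map_constantCoeff_mem {D ι B : Type*} [CommRing D] [CommRing B]
    (φ : MvPolynomial ι D →+* B) (I : Ideal B) (hφ : ∀ i, φ (X i) ∈ I) (p : MvPolynomial ι D) :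
    φ p ∈ I ↔ φ (C (constantCoeff p)) ∈ I := by
  have : (Ideal.Quotient.mk I).comp φ =
      ((Ideal.Quotient.mk I).comp φ).comp ((C : D →+* MvPolynomial ι D).comp constantCoeff) := by
    refine MvPolynomial.ringHom_ext (fun d => ?_) fun i => ?_
    · rw [RingHom.comp_apply _ (C.comp constantCoeff), RingHom.comp_apply C, constantCoeff_C]
    · rw [RingHom.comp_apply _ (C.comp constantCoeff), RingHom.comp_apply C, constantCoeff_X,
        map_zero, map_zero]
      exact Ideal.Quotient.eq_zero_iff_mem.mpr (hφ i)
  rw [← Ideal.Quotient.eq_zero_iff_mem, ← Ideal.Quotient.eq_zero_iff_mem]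
  exact iff_of_eq (congrArg (fun k : MvPolynomial ι D →+* B ⧸ I => k p = 0) this)

/-- A prime of a polynomial ring that contains the variables is determined by its restriction to
the coefficients; more generally this holds for inverse images of ideals. -/
theorem MvPolynomial.comap_eq_comap_of_comap_C_eq {D ι B B' : Type*} [CommRing D] [CommRing B]
    [CommRing B'] (φ : MvPolynomial ι D →+* B) (φ' : MvPolynomial ι D →+* B') (I : Ideal B)
    (I' : Ideal B') (hφ : ∀ i, φ (X i) ∈ I) (hφ' : ∀ i, φ' (X i) ∈ I')
    (h : I.comap (φ.comp C) = I'.comap (φ'.comp C)) : I.comap φ = I'.comap φ' := by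
  ext p
  rw [Ideal.mem_comap, Ideal.mem_comap, map_mem_iff_map_constantCoeff_mem φ I hφ,
    map_mem_iff_map_constantCoeff_mem φ' I' hφ']
  exact iff_of_eq (congrArg (constantCoeff p ∈ ·) h)

theorem IsLocalRing.mem_maximalIdeal_iff_eq_zero {H : Type*} [Field H] (a : H) :
    a ∈ maximalIdeal H ↔ a = 0 := by
  rw [mem_maximalIdeal, mem_nonunits_iff, isUnit_iff_ne_zero, not_not]

variable {D ι Λ : Type u} [CommRing D] [CommRing Λ] [IsLocalRing Λ] [Algebra (MvPolynomial ι D) Λ]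
  [Algebra D Λ] [IsScalarTower D (MvPolynomial ι D) Λ]

/-- The residue field of an affine space at the origin over a point is that of the point. -/
theorem IsHenselUniversal.exists_mul_eq_algebraMap_residueField
    (hΛ : IsHenselUniversal (algebraMap (MvPolynomial ι D) Λ))
    (hX : ∀ i, algebraMap (MvPolynomial ι D) Λ (X i) ∈ maximalIdeal Λ) (a : ResidueField Λ) :
    ∃ x y : D, algebraMap D (ResidueField Λ) y ≠ 0 ∧
      a * algebraMap D _ y = algebraMap D _ x := by
  let σ : Ideal D := (maximalIdeal Λ).comap (algebraMap D Λ)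
  let H := σ.ResidueField
  let φ : MvPolynomial ι D →ₐ[D] H := aeval 0
  have hC : (algebraMap (MvPolynomial ι D) Λ).comp C = algebraMap D Λ :=
    (IsScalarTower.algebraMap_eq D (MvPolynomial ι D) Λ).symm
  have hφC : φ.toRingHom.comp C = algebraMap D H := RingHom.ext fun d => φ.commutes d
  have hcomap : (maximalIdeal H).comap φ.toRingHom =
      (maximalIdeal Λ).comap (algebraMap (MvPolynomial ι D) Λ) := by
    refine MvPolynomial.comap_eq_comap_of_comap_C_eq _ _ _ _ (fun i => ?_) hX ?_
    · have : φ (X i) = 0 := aeval_X _ _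
      exact (IsLocalRing.mem_maximalIdeal_iff_eq_zero _).mpr this
    · rw [hC, hφC]
      ext d
      rw [Ideal.mem_comap, IsLocalRing.mem_maximalIdeal_iff_eq_zero,
        Ideal.algebraMap_residueField_eq_zero]
  obtain ⟨ψ, ⟨hψ, hψφ⟩, -⟩ := hΛ H φ.toRingHom hcomap
  have hψD : ∀ d, ψ (algebraMap D Λ d) = algebraMap D H d := fun d => by
    rw [← hφC, ← hC, ← hψφ]
    rfl
  obtain ⟨l, rfl⟩ := residue_surjective a
  obtain ⟨x, y, hy, hxy⟩ := IsFractionRing.div_surjective (A := D ⧸ σ) (ψ l)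
  obtain ⟨x, rfl⟩ := Ideal.Quotient.mk_surjective x
  obtain ⟨y, rfl⟩ := Ideal.Quotient.mk_surjective y
  have hyσ : y ∉ σ := fun h => nonZeroDivisors.ne_zero hy (Ideal.Quotient.eq_zero_iff_mem.mpr h)
  have hyH : algebraMap D H y ≠ 0 := fun h => hyσ ((Ideal.algebraMap_residueField_eq_zero).mp h)
  refine ⟨x, y, fun h => hyσ ((residue_eq_zero_iff _).mp h), ?_⟩
  have h1 : ψ (l * algebraMap D Λ y - algebraMap D Λ x) = 0 := by
    rw [map_sub, map_mul, hψD, hψD, ← hxy]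
    change algebraMap D H x / algebraMap D H y * _ - _ = 0
    rw [div_mul_cancel₀ _ hyH, sub_self]
  have h2 : l * algebraMap D Λ y - algebraMap D Λ x ∈ maximalIdeal Λ := by
    rw [← comap_maximalIdeal_of_isLocalHom ψ hψ, Ideal.mem_comap, h1]
    exact zero_mem _
  rw [← residue_eq_zero_iff, map_sub, map_mul, sub_eq_zero] at h2
  exact h2

variable {A : Type u} [CommRing A] [IsLocalRing A]

/-- If `A` is the henselization of an affine space, and `Λ` that of the affine space of the
coordinates other than the last one, then `A` is a henselization of the affine line over `Λ`. -/
theorem IsHenselUniversal.eval₂RingHom (hΛ : IsHenselUniversal (algebraMap (MvPolynomial ι D) Λ))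
    {f : MvPolynomial (Option ι) D →+* A} (hf : IsHenselUniversal f) (φ : Λ →+* A)
    (hφ : IsLocalHom φ)
    (hφf : φ.comp (algebraMap (MvPolynomial ι D) Λ) = f.comp (rename some).toRingHom) :
    IsHenselUniversal (Polynomial.eval₂RingHom φ (f (X none))) := by
  let P := MvPolynomial (Option ι) D
  let P₀ := MvPolynomial ι D
  let ρ : P →+* Polynomial Λ := eval₂Hom ((Polynomial.C : Λ →+* _).comp (algebraMap D Λ))
    fun o => o.elim Polynomial.X fun i => Polynomial.C (algebraMap P₀ Λ (X i))
  have hρC : ∀ d, ρ (C d) = Polynomial.C (algebraMap P₀ Λ (C d)) := fun d => by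
    rw [eval₂Hom_C, RingHom.comp_apply, IsScalarTower.algebraMap_apply D P₀ Λ]
    rfl
  have hρn : ρ (X none) = Polynomial.X := eval₂Hom_X' _ _ _
  have hρs : ∀ i, ρ (X (some i)) = Polynomial.C (algebraMap P₀ Λ (X i)) := fun i =>
    eval₂Hom_X' _ _ _
  have hρr : ρ.comp (rename some).toRingHom = (Polynomial.C : Λ →+* _).comp (algebraMap P₀ Λ) := by
    refine MvPolynomial.ringHom_ext (fun d => ?_) fun i => ?_
    · exact (congrArg ρ (rename_C _ _)).trans (hρC d)
    · exact (congrArg ρ (rename_X _ _)).trans (hρs i)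
  let ε := Polynomial.eval₂RingHom φ (f (X none))
  have hεC : ε.comp Polynomial.C = φ := RingHom.ext fun l => Polynomial.eval₂_C _ _
  have hφf' : ∀ p, φ (algebraMap P₀ Λ p) = f (rename some p) := fun p =>
    congrArg (fun k => k p) hφf
  have hερ : ε.comp ρ = f := by
    refine MvPolynomial.ringHom_ext (fun d => ?_) fun o => ?_
    · rw [RingHom.comp_apply, hρC, ← RingHom.comp_apply, hεC, hφf', rename_C]
    · cases o with
      | none => rw [RingHom.comp_apply, hρn]; exact Polynomial.eval₂_X _ _
      | some i => rw [RingHom.comp_apply, hρs, ← RingHom.comp_apply, hεC, hφf', rename_X]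
  intro H _ _ ψ hψ
  have hψC : IsLocalHom (ψ.comp Polynomial.C) := isLocalHom_of_comap_maximalIdeal_eq _ (by
    rw [← Ideal.comap_comap, hψ, Ideal.comap_comap, hεC, comap_maximalIdeal_of_isLocalHom _ hφ])
  obtain ⟨χ, ⟨hχ, hχf⟩, hu⟩ := hf H (ψ.comp ρ) (by
    rw [← Ideal.comap_comap, hψ, Ideal.comap_comap, hερ])
  refine ⟨χ, ⟨hχ, ?_⟩, fun χ' ⟨h, h'⟩ => hu χ' ⟨h, by rw [← h', RingHom.comp_assoc, hερ]⟩⟩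
  have h1 : (χ.comp φ) = ψ.comp Polynomial.C := by
    refine (hΛ H ((ψ.comp Polynomial.C).comp (algebraMap P₀ Λ)) ?_).unique
      ⟨RingHom.isLocalHom_comp χ φ, ?_⟩ ⟨hψC, rfl⟩
    · rw [← Ideal.comap_comap, comap_maximalIdeal_of_isLocalHom _ hψC]
    · rw [RingHom.comp_assoc, hφf, ← RingHom.comp_assoc, hχf, RingHom.comp_assoc, hρr]
      rfl
  refine Polynomial.ringHom_ext (fun l => ?_) ?_
  · rw [RingHom.comp_apply, show ε (Polynomial.C l) = φ l from Polynomial.eval₂_C _ _]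
    exact congrArg (fun k => k l) h1
  · rw [RingHom.comp_apply, show ε Polynomial.X = f (X none) from Polynomial.eval₂_X _ _,
      ← hρn]
    exact congrArg (fun k => k (X none)) hχf

theorem IsHenselUniversal.comp_ringEquiv {M M' : Type u} [CommRing M] [CommRing M'] {f : M →+* A}
    (hf : IsHenselUniversal f) (e : M' ≃+* M) : IsHenselUniversal (f.comp e.toRingHom) := by
  intro H _ _ φ hφ
  have he : e.toRingHom.comp e.symm.toRingHom = RingHom.id M :=
    RingEquiv.toRingHom_comp_symm_toRingHom e
  obtain ⟨ψ, ⟨hψ, hψf⟩, hu⟩ := hf H (φ.comp e.symm.toRingHom) (by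
    rw [← Ideal.comap_comap, hφ, Ideal.comap_comap, RingHom.comp_assoc, he, RingHom.comp_id])
  refine ⟨ψ, ⟨hψ, ?_⟩, fun χ ⟨h, h'⟩ => hu χ ⟨h, ?_⟩⟩
  · rw [← RingHom.comp_assoc, hψf, RingHom.comp_assoc, RingEquiv.symm_toRingHom_comp_toRingHom,
      RingHom.comp_id]
  · rw [← h', RingHom.comp_assoc, RingHom.comp_assoc, he, RingHom.comp_id]

end HenselizedAffineSpace

/-! ### Étale coordinates of a henselization -/

section HenselizedCoordinates

variable {D R A : Type u} [CommRing D] [CommRing R] [CommRing A] [HenselianLocalRing A]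
  [Algebra D R] [Algebra R A] [Algebra D A] [IsScalarTower D R A]

theorem IsHenselUniversal.of_localization (hA : IsHenselUniversal (algebraMap R A))
    (p : Ideal R) [p.IsPrime] (L : Type u) [CommRing L] [IsLocalRing L] [Algebra R L]
    [IsLocalization.AtPrime L p] [Algebra L A] [IsScalarTower R L A]
    [IsLocalHom (algebraMap L A)] : IsHenselUniversal (algebraMap L A) := by
  refine IsHenselUniversal.of_comp (g := algebraMap R L) ?_ inferInstance fun H _ _ a b _ _ hab =>
    IsLocalization.ringHom_ext p.primeCompl hab
  rwa [← IsScalarTower.algebraMap_eq]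

/-- The henselization `A` of a smooth `D`-scheme at a point whose residue field is a finite simple
extension of that of its image is a henselization of the affine space over `D`, at a point where all
the coordinates but one vanish. -/
theorem IsHenselUniversal.exists_mvPolynomial_comp (m : ℕ)
    [Algebra.IsStandardSmoothOfRelativeDimension (m + 1) D R]
    (hA : IsHenselUniversal (algebraMap R A))
    {k : Type u} [Field k] [Algebra D k] [Algebra k (ResidueField A)]
    [IsScalarTower D k (ResidueField A)] [Algebra.IsAlgebraic k (ResidueField A)]
    (hfrac : ∀ a : k, ∃ x y : D, algebraMap D k y ≠ 0 ∧ a * algebraMap D k y = algebraMap D k x)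
    (hfrac' : ∀ a : ResidueField A, ∃ x y : R, algebraMap R (ResidueField A) y ≠ 0 ∧
      a * algebraMap R _ y = algebraMap R _ x)
    {α : ResidueField A} (hα : IntermediateField.adjoin k {α} = ⊤) :
    ∃ f : MvPolynomial (Option (ULift.{u} (Fin m))) D →ₐ[D] A,
      (∀ i, f (.X (some i)) ∈ maximalIdeal A) ∧ IsHenselUniversal f.toRingHom ∧
      IntermediateField.adjoin k {residue A (f (.X none))} = ⊤ := by
  obtain ⟨b₀, hb₀⟩ := exists_adjoin_algebraMap_eq_top (R := R) hfrac hfrac' hα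
  let p : Ideal R := (maximalIdeal A).comap (algebraMap R A)
  let L := Localization.AtPrime p
  have hu : ∀ t : p.primeCompl, IsUnit (algebraMap R A t) := fun t => by
    by_contra h
    exact t.2 ((mem_maximalIdeal _).mpr h)
  let : Algebra L A := (IsLocalization.lift hu).toAlgebra
  have : IsScalarTower R L A := .of_algebraMap_eq fun r => (IsLocalization.lift_eq hu r).symm
  have : IsLocalHom (algebraMap L A) := by
    refine ⟨fun x hx => ?_⟩
    obtain ⟨z, t, rfl⟩ := IsLocalization.exists_mk'_eq p.primeCompl x
    refine (IsLocalization.AtPrime.isUnit_mk'_iff L p z t).mpr fun hz => ?_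
    have h1 : algebraMap L A (IsLocalization.mk' L z t) * algebraMap R A t = algebraMap R A z := by
      rw [IsScalarTower.algebraMap_apply R L A t, ← map_mul, IsLocalization.mk'_spec,
        ← IsScalarTower.algebraMap_apply]
    exact (mem_maximalIdeal _).mp hz (h1 ▸ hx.mul (hu t))
  have hLA := hA.of_localization p L
  have : IsScalarTower D L A := .of_algebraMap_eq fun d => by
    rw [IsScalarTower.algebraMap_apply D R A, IsScalarTower.algebraMap_apply R L A,
      ← IsScalarTower.algebraMap_apply D R L]
  let κ : ResidueField L →+* ResidueField A := ResidueField.map (algebraMap L A)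
  have hκR : ∀ r, κ (algebraMap R _ r) = algebraMap R (ResidueField A) r := fun r => by
    rw [IsScalarTower.algebraMap_apply R L (ResidueField L),
      IsScalarTower.algebraMap_apply R A (ResidueField A), IsScalarTower.algebraMap_apply R L A]
    rfl
  have hκD : ∀ d, κ (algebraMap D _ d) = algebraMap D (ResidueField A) d := fun d => by
    rw [IsScalarTower.algebraMap_apply D R (ResidueField L),
      IsScalarTower.algebraMap_apply D R (ResidueField A), hκR]
  have hgen : ∀ a : ResidueField L, ∃ (d : D) (F : Polynomial D),
      algebraMap D (ResidueField L) d ≠ 0 ∧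
      a * algebraMap D _ d = Polynomial.aeval (algebraMap R _ b₀) F := by
    intro a
    obtain ⟨d, F, hd, hF⟩ := exists_mul_eq_aeval_of_adjoin_eq_top hfrac hb₀ (κ a)
    refine ⟨d, F, fun h => hd (by rw [← hκD, h, map_zero]), κ.injective ?_⟩
    let κ' : ResidueField L →ₐ[D] ResidueField A := ⟨κ, hκD⟩
    rw [map_mul, hκD, hF, ← hκR]
    exact Polynomial.aeval_algHom_apply κ' _ F
  obtain ⟨f₀, hf₀n, hf₀s, het⟩ := exists_isEtaleAt_mvPolynomial (m := m) p b₀ hgen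
  let P := MvPolynomial (Option (ULift.{u} (Fin m))) D
  let : Algebra P R := f₀.toRingHom.toAlgebra
  have : Algebra.IsEtaleAt P p := het
  have : IsScalarTower D P R := .of_algebraMap_eq fun d => (f₀.commutes d).symm
  have hsm : Algebra.IsStandardSmooth D R :=
    Algebra.IsStandardSmoothOfRelativeDimension.isStandardSmooth (m + 1)
  have hfp : Algebra.FinitePresentation D R := inferInstance
  have : Algebra.FinitePresentation P R :=
    .of_restrict_scalars_finitePresentation D P R
  have hzero : ∀ r ∈ p, algebraMap R (ResidueField A) r = 0 := fun r hr =>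
    (residue_eq_zero_iff _).mpr hr
  have hf₀b : algebraMap R (ResidueField A) (f₀ (.X none)) = algebraMap R _ b₀ := by
    have := hzero _ hf₀n
    rwa [map_sub, sub_eq_zero] at this
  have hPL : IsHenselUniversal ((algebraMap R L).comp (algebraMap P R)) := by
    refine IsHenselUniversal.of_isEtaleAt p fun a => ?_
    obtain ⟨d, F, hd, hF⟩ := hgen a
    have h1 : f₀ (algebraMap D P d) = algebraMap D R d := f₀.commutes d
    have h2 : f₀ (Polynomial.aeval (MvPolynomial.X none) F) =
        Polynomial.aeval (f₀ (.X none)) F := (Polynomial.aeval_algHom_apply f₀ _ F).symm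
    have h3 : ∀ r, residue L (algebraMap R L r) = algebraMap R (ResidueField L) r := fun r => rfl
    refine ⟨Polynomial.aeval (MvPolynomial.X none) F, algebraMap D P d, ?_, ?_⟩
    · change residue L (algebraMap R L (f₀ (algebraMap D P d))) ≠ 0
      rw [h1, h3, ← IsScalarTower.algebraMap_apply]
      exact hd
    · change a * residue L (algebraMap R L (f₀ (algebraMap D P d))) =
        residue L (algebraMap R L (f₀ _))
      rw [h1, h2, h3, h3, ← IsScalarTower.algebraMap_apply, hF, ← Polynomial.aeval_algebraMap_apply]
      refine congrArg (fun z => Polynomial.aeval z F) (κ.injective ?_)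
      rw [hκR, hκR, hf₀b]
  refine ⟨(IsScalarTower.toAlgHom D R A).comp f₀, hf₀s, ?_, ?_⟩
  · have h1 := hPL.comp hLA inferInstance
    rw [← RingHom.comp_assoc, ← IsScalarTower.algebraMap_eq] at h1
    exact h1
  · rw [← hb₀, ← hf₀b]
    rfl

end HenselizedCoordinates

/-! ### The minimal polynomial of the last coordinate as a parameter -/

section Parameter

open MvPolynomial

/-- Modulo all the variables but the last one, a polynomial is one in the last variable. -/
theorem MvPolynomial.sub_aeval_mem_span {D ι : Type*} [CommRing D] (p : MvPolynomial (Option ι) D) :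
    p - Polynomial.aeval (X none) (aeval (R := D) (fun o : Option ι =>
      o.elim (Polynomial.X : Polynomial D) fun _ => 0) p) ∈
        Ideal.span (Set.range fun i : ι => (X (some i) : MvPolynomial (Option ι) D)) := by
  rw [← Ideal.Quotient.eq]
  let I := Ideal.span (Set.range fun i : ι => (X (some i) : MvPolynomial (Option ι) D))
  let ρ : MvPolynomial (Option ι) D →ₐ[D] Polynomial D :=
    aeval fun o : Option ι => o.elim (Polynomial.X : Polynomial D) fun _ => 0
  have : Ideal.Quotient.mkₐ D I = ((Ideal.Quotient.mkₐ D I).comp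
      (Polynomial.aeval (R := D) (X none))).comp ρ := by
    refine MvPolynomial.algHom_ext fun o => ?_
    change Ideal.Quotient.mk I (X o) = Ideal.Quotient.mk I (Polynomial.aeval (X none) (ρ (X o)))
    cases o with
    | none => rw [aeval_X]; exact congrArg _ (Polynomial.aeval_X _).symm
    | some i =>
      rw [aeval_X, Option.elim_some, map_zero, map_zero]
      exact Ideal.Quotient.eq_zero_iff_mem.mpr (Ideal.subset_span ⟨i, rfl⟩)
  exact congrArg (fun k => k p) this

theorem Polynomial.mem_map_C_of_map_eq_zero {D k : Type*} [CommRing D] [CommRing k] (f : D →+* k)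
    {F : Polynomial D} (hF : F.map f = 0) :
    F ∈ (RingHom.ker f).map (Polynomial.C : D →+* Polynomial D) := by
  rw [Ideal.mem_map_C_iff]
  intro n
  rw [RingHom.mem_ker, ← Polynomial.coeff_map, hF, Polynomial.coeff_zero]

/-- If `p` is congruent to `a` modulo `J`, and a multiple of `a` is divisible by `s` modulo `I`,
then the same multiple of `p` is divisible by `s` modulo both ideals. -/
theorem exists_mul_mem_sup_of_mul_sub_mem {P : Type*} [CommRing P] {I J : Ideal P} {c p a s b : P}
    (h₁ : c * a - s * b ∈ I) (h₂ : p - a ∈ J) : c * p ∈ I ⊔ J ⊔ Ideal.span {s} := by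
  rw [show c * p = (c * a - s * b) + c * (p - a) + b * s by ring]
  exact add_mem (Ideal.mem_sup_left (add_mem (Ideal.mem_sup_left h₁)
    (Ideal.mem_sup_right (Ideal.mul_mem_left _ _ h₂))))
    (Ideal.mem_sup_right (Ideal.mul_mem_left _ _ (Ideal.mem_span_singleton_self s)))

variable {D ι A k : Type u} [CommRing D] [CommRing A] [HenselianLocalRing A] [Algebra D A]
  [Field k] [Algebra D k] [Algebra k (ResidueField A)] [IsScalarTower D k (ResidueField A)]

theorem residue_aeval_eq (b : A) (H : Polynomial D) : residue A (Polynomial.aeval b H) =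
    Polynomial.aeval (residue A b) (H.map (algebraMap D k)) := by
  rw [Polynomial.aeval_map_algebraMap]
  exact (Polynomial.aeval_algebraMap_apply (ResidueField A) b H).symm

variable (A k) in
/-- The prime of `D` under the closed point of `A` is the kernel of `D → k`, for every subfield `k`
of the residue field through which `D` maps to it. -/
theorem comap_maximalIdeal_eq_ker : (maximalIdeal A).comap (algebraMap D A) =
    RingHom.ker (algebraMap D k) := by
  ext c
  rw [Ideal.mem_comap, RingHom.mem_ker, ← residue_eq_zero_iff,
    ← map_eq_zero (algebraMap k (ResidueField A)), ← IsScalarTower.algebraMap_apply]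
  rfl

/-- Up to a denominator, a polynomial that vanishes at the closed point lies in the ideal generated
by the prime of `D`, by the coordinates that vanish there and by the minimal polynomial of the last
coordinate. -/
theorem MvPolynomial.exists_mul_mem_of_minpoly {f : MvPolynomial (Option ι) D →ₐ[D] A}
    (hX : ∀ i, f (X (some i)) ∈ maximalIdeal A)
    (hfrac : ∀ a : k, ∃ x y : D, algebraMap D k y ≠ 0 ∧ a * algebraMap D k y = algebraMap D k x)
    {F : Polynomial D} {d : D} (hd : algebraMap D k d ≠ 0)
    (hF : F.map (algebraMap D k) =
      Polynomial.C (algebraMap D k d) * minpoly k (residue A (f (X none))))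
    (p : MvPolynomial (Option ι) D) (hp : f p ∈ maximalIdeal A) :
    ∃ c : MvPolynomial (Option ι) D, f c ∉ maximalIdeal A ∧
      c * p ∈ (RingHom.ker (algebraMap D k)).map (C : D →+* MvPolynomial (Option ι) D) ⊔
        Ideal.span (Set.range fun i : ι => (X (some i) : MvPolynomial (Option ι) D)) ⊔
        Ideal.span {Polynomial.aeval (X none) F} := by
  obtain ⟨p₀, hp₀⟩ : ∃ p₀ : Polynomial D, p - Polynomial.aeval (X none) p₀ ∈
      Ideal.span (Set.range fun i : ι => (X (some i) : MvPolynomial (Option ι) D)) :=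
    ⟨_, MvPolynomial.sub_aeval_mem_span p⟩
  have hp₀f : Polynomial.aeval (f (X none)) p₀ ∈ maximalIdeal A := by
    have h1 : Ideal.span (Set.range fun i : ι => (X (some i) : MvPolynomial (Option ι) D)) ≤
        (maximalIdeal A).comap f := by
      rw [Ideal.span_le]
      rintro _ ⟨i, rfl⟩
      exact hX i
    have h2 := h1 hp₀
    rw [Ideal.mem_comap, map_sub, ← Polynomial.aeval_algHom_apply] at h2
    have h3 := sub_mem hp h2
    rwa [sub_sub_cancel] at h3
  rw [← residue_eq_zero_iff, residue_aeval_eq (k := k)] at hp₀f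
  obtain ⟨w, hw⟩ := minpoly.dvd k _ hp₀f
  obtain ⟨c, Q, hc, hQ⟩ := exists_map_eq_C_mul_of_fractions hfrac w
  have h0 : (Polynomial.C (c * d) * p₀ - F * Q).map (algebraMap D k) = 0 := by
    rw [Polynomial.map_sub, Polynomial.map_mul, Polynomial.map_mul, hF, hQ, hw,
      Polynomial.map_C, map_mul, Polynomial.C_mul, sub_eq_zero]
    exact mul_mul_mul_comm _ _ _ _ |>.trans (by ring)
  have h1 := Polynomial.mem_map_C_of_map_eq_zero _ h0
  refine ⟨C (c * d), ?_, exists_mul_mem_sup_of_mul_sub_mem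
    (a := Polynomial.aeval (X none) p₀) (b := Polynomial.aeval (X none) Q) ?_ hp₀⟩
  · rw [show f (C (c * d)) = algebraMap D A (c * d) from f.commutes _, ← Ideal.mem_comap,
      comap_maximalIdeal_eq_ker A k, RingHom.mem_ker, map_mul]
    exact mul_ne_zero hc hd
  · have h3 := Ideal.mem_map_of_mem
      (Polynomial.aeval (R := D) (X none : MvPolynomial (Option ι) D)).toRingHom h1
    have h4 : (Polynomial.aeval (R := D) (X none : MvPolynomial (Option ι) D)).toRingHom.comp
        Polynomial.C = C := RingHom.ext fun c => Polynomial.aeval_C _ c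
    have h5 : Polynomial.aeval (X none : MvPolynomial (Option ι) D)
        (Polynomial.C (c * d) * p₀ - F * Q) = C (c * d) * Polynomial.aeval (X none) p₀ -
          Polynomial.aeval (X none) F * Polynomial.aeval (X none) Q := by
      rw [map_sub, map_mul _ (Polynomial.C (c * d)), map_mul _ F, Polynomial.aeval_C]
      rfl
    rw [Ideal.map_map, h4] at h3
    rw [← h5]
    exact h3

/-- On a suitable curve `T i = F ^ e i` in the fibre, `g` is the product of a unit and a power of
`F`: the curve selection in the case that `F` is a multiple of the minimal polynomial of the last
coordinate. -/
theorem IsHenselUniversal.exists_sub_mul_pow_mem_of_minpoly [Finite ι]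
    {f : MvPolynomial (Option ι) D →ₐ[D] A} (hf : IsHenselUniversal f.toRingHom)
    (hX : ∀ i, f (X (some i)) ∈ maximalIdeal A)
    (hfrac : ∀ a : k, ∃ x y : D, algebraMap D k y ≠ 0 ∧ a * algebraMap D k y = algebraMap D k x)
    (hint : IsIntegral k (residue A (f (X none))))
    {F : Polynomial D} {d : D} (hd : algebraMap D k d ≠ 0)
    (hF : F.map (algebraMap D k) =
      Polynomial.C (algebraMap D k d) * minpoly k (residue A (f (X none))))
    (g : A) (hg : g ∉ (RingHom.ker (algebraMap D k)).map (algebraMap D A)) :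
    ∃ e : ι → ℕ, (∀ i, 1 ≤ e i) ∧ ∃ (j : ℕ) (v : A), IsUnit v ∧
      g - v * Polynomial.aeval (f (X none)) F ^ j ∈
        (RingHom.ker (algebraMap D k)).map (algebraMap D A) ⊔ Ideal.span (Set.range fun i =>
          f (X (some i)) - Polynomial.aeval (f (X none)) F ^ e i) := by
  have hfs : f (Polynomial.aeval (X none) F) = Polynomial.aeval (f (X none)) F :=
    (Polynomial.aeval_algHom_apply f _ F).symm
  have hσp : (RingHom.ker (algebraMap D k)).IsPrime := RingHom.ker_isPrime _
  have hfC : f.toRingHom.comp C = algebraMap D A := RingHom.ext fun c => f.commutes c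
  have hF0 : F ∉ (RingHom.ker (algebraMap D k)).map (Polynomial.C : D →+* Polynomial D) := by
    intro h
    have h1 : F.map (algebraMap D k) = 0 := by
      ext n
      rw [Polynomial.coeff_map, Polynomial.coeff_zero]
      exact Ideal.mem_map_C_iff.mp h n
    rw [hF] at h1
    exact mul_ne_zero (Polynomial.C_ne_zero.mpr hd) (minpoly.ne_zero hint) h1
  have hsm : f.toRingHom (Polynomial.aeval (X none) F) ∈ maximalIdeal A := by
    change f (Polynomial.aeval (X none) F) ∈ _
    rw [hfs, ← residue_eq_zero_iff, residue_aeval_eq (k := k), hF, map_mul, minpoly.aeval,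
      mul_zero]
  obtain ⟨e, he, j, v, hv, h⟩ := hf.exists_sub_mul_pow_mem (RingHom.ker (algebraMap D k))
    (by rw [hfC, comap_maximalIdeal_eq_ker A k]) hF0 hsm hX
    (fun p hp => exists_mul_mem_of_minpoly hX hfrac hd hF p hp) g (by rw [hfC]; exact hg)
  refine ⟨e, he, j, v, hv, ?_⟩
  rw [Ideal.map_sup, Ideal.map_map, hfC, Ideal.map_span, ← Set.range_comp] at h
  have h2 : (f.toRingHom ∘ fun i => X (some i) - Polynomial.aeval (X none) F ^ e i) =
      fun i => f (X (some i)) - Polynomial.aeval (f (X none)) F ^ e i := by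
    funext i
    rw [← hfs]
    change f (X (some i) - Polynomial.aeval (X none) F ^ e i) = _
    rw [map_sub, map_pow]
  rw [← h2]
  rw [← hfs]
  exact h

end Parameter

/-! ### The projection to a henselized affine space -/

section Projection

theorem Ideal.sub_pow_mem_of_sub_mem {A : Type*} [CommRing A] {I : Ideal A} {g v a c : A} {j : ℕ}
    (h : g - v * a ^ j ∈ I) (h' : a - c ∈ I) : g - v * c ^ j ∈ I := by
  rw [← Ideal.Quotient.eq] at h h' ⊢
  rw [h, map_mul, map_mul, map_pow, map_pow, h']

/-- The finiteness criterion for henselizations of the affine line, in terms of a multiple of the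
minimal polynomial of the coordinate. -/
theorem IsHenselUniversal.finite_quotient_of_minpoly {Λ A : Type u} [CommRing Λ]
    [CommRing A] [HenselianLocalRing Λ] [HenselianLocalRing A] [Algebra Λ A]
    [IsLocalHom (algebraMap Λ A)] [Algebra (ResidueField Λ) (ResidueField A)]
    [IsScalarTower Λ (ResidueField Λ) (ResidueField A)] (b : A)
    (hb : IsHenselUniversal (Polynomial.aeval (R := Λ) b).toRingHom)
    (hint : IsIntegral (ResidueField Λ) (residue A b))
    (hgen : IntermediateField.adjoin (ResidueField Λ) {residue A b} = ⊤)
    (F : Polynomial Λ) (d : Λ) (hd : residue Λ d ≠ 0) (hF : F.map (residue Λ) =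
      Polynomial.C (residue Λ d) * minpoly (ResidueField Λ) (residue A b))
    (g v : A) (hv : IsUnit v) (j : ℕ) (hg : g - v * Polynomial.aeval b F ^ j ∈
      (maximalIdeal Λ).map (algebraMap Λ A)) :
    Module.Finite Λ (A ⧸ Ideal.span {g}) ∧
      ∀ a : A, ∃ p : Polynomial Λ, g ∣ a - Polynomial.aeval b p := by
  have hres : ∀ p : Polynomial Λ, residue A (Polynomial.aeval b p) =
      Polynomial.aeval (residue A b) (p.map (residue Λ)) := fun p => residue_aeval_eq b p
  have hlift : ∀ w : Polynomial (ResidueField Λ), ∃ p : Polynomial Λ, p.map (residue Λ) = w :=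
    Polynomial.map_surjective _ residue_surjective
  have hker : ∀ p : Polynomial Λ, p.map (residue Λ) = 0 →
      p ∈ (maximalIdeal Λ).map (Polynomial.C : Λ →+* Polynomial Λ) := fun p hp => by
    have := Polynomial.mem_map_C_of_map_eq_zero _ hp
    rwa [ker_residue] at this
  obtain ⟨G, hG, -, hGm⟩ := Polynomial.lifts_and_natDegree_eq_and_monic
    ((Polynomial.mem_lifts _).mpr (hlift (minpoly (ResidueField Λ) (residue A b))))
    (minpoly.monic hint)
  have hdu : IsUnit d := by
    rwa [← residue_ne_zero_iff_isUnit]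
  refine hb.finite_quotient_and_exists_dvd_sub_aeval b G hGm ?_ ?_ g
    (v * algebraMap Λ A d ^ j) (hv.mul ((hdu.map _).pow j)) j ?_
  · intro p hp
    rw [← residue_eq_zero_iff, hres] at hp
    obtain ⟨w, hw⟩ := minpoly.dvd _ _ hp
    obtain ⟨W, hW⟩ := hlift w
    rw [← sub_add_cancel p (G * W)]
    refine add_mem (Ideal.mem_sup_left (hker _ ?_))
      (Ideal.mem_sup_right (Ideal.mul_mem_right _ _ (Ideal.mem_span_singleton_self G)))
    rw [Polynomial.map_sub, Polynomial.map_mul, hG, hW, hw, sub_self]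
  · intro a
    have h1 : residue A a ∈
        (IntermediateField.adjoin (ResidueField Λ) {residue A b}).toSubalgebra :=
      hgen ▸ IntermediateField.mem_top
    rw [IntermediateField.adjoin_simple_toSubalgebra_of_isAlgebraic hint.isAlgebraic,
      Algebra.adjoin_singleton_eq_range_aeval] at h1
    obtain ⟨w, hw⟩ := h1
    obtain ⟨p, hp⟩ := hlift w
    refine ⟨p, ?_⟩
    rw [← residue_eq_zero_iff, map_sub, hres, hp, sub_eq_zero]
    exact hw.symm
  · rw [mul_assoc, ← mul_pow]
    refine Ideal.sub_pow_mem_of_sub_mem hg ?_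
    have h1 := hker (F - Polynomial.C d * G) (by
      rw [Polynomial.map_sub, Polynomial.map_mul, hG, hF, Polynomial.map_C, sub_self])
    have h2 := Ideal.mem_map_of_mem (Polynomial.aeval (R := Λ) b).toRingHom h1
    rw [Ideal.map_map] at h2
    have h3 : (Polynomial.aeval (R := Λ) b).toRingHom.comp Polynomial.C = algebraMap Λ A :=
      RingHom.ext fun c => Polynomial.aeval_C b c
    have h4 : (Polynomial.aeval (R := Λ) b).toRingHom (F - Polynomial.C d * G) =
        Polynomial.aeval b F - algebraMap Λ A d * Polynomial.aeval b G := by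
      change Polynomial.aeval b (F - Polynomial.C d * G) = _
      rw [map_sub, map_mul, Polynomial.aeval_C]
    rw [h3, h4] at h2
    exact h2

open MvPolynomial in
/-- The automorphism of an affine space that fixes the last coordinate and translates the other ones
by polynomials in the last one. -/
noncomputable def MvPolynomial.translateEquiv {D ι : Type*} [CommRing D] (c : ι → Polynomial D) :
    MvPolynomial (Option ι) D ≃ₐ[D] MvPolynomial (Option ι) D :=
  AlgEquiv.ofAlgHom
    (aeval fun o => o.elim (X none) fun i => X (some i) - Polynomial.aeval (X none) (c i))
    (aeval fun o => o.elim (X none) fun i => X (some i) + Polynomial.aeval (X none) (c i))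
    (by
      refine MvPolynomial.algHom_ext fun o => ?_
      cases o with
      | none => simp
      | some i => simp [← Polynomial.aeval_algHom_apply])
    (by
      refine MvPolynomial.algHom_ext fun o => ?_
      cases o with
      | none => simp
      | some i => simp [← Polynomial.aeval_algHom_apply])

open MvPolynomial in
theorem MvPolynomial.translateEquiv_X_none {D ι : Type*} [CommRing D] (c : ι → Polynomial D) :
    translateEquiv c (X none) = X none := aeval_X _ _

open MvPolynomial in
theorem MvPolynomial.translateEquiv_X_some {D ι : Type*} [CommRing D] (c : ι → Polynomial D)
    (i : ι) : translateEquiv c (X (some i)) = X (some i) - Polynomial.aeval (X none) (c i) :=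
  aeval_X _ _

variable {D R Λ A : Type u} [CommRing D] [CommRing R] [CommRing Λ] [HenselianLocalRing Λ]
  [CommRing A] [HenselianLocalRing A] [Algebra D R] [Algebra R A] [Algebra D A]
  [IsScalarTower D R A] [Algebra D Λ]

/-- If the residue field of `Λ` consists of fractions of elements of `D`, every local homomorphism
over `D` from `Λ` to `A` induces the given extension of residue fields. -/
theorem residue_eq_algebraMap_residue [Algebra (ResidueField Λ) (ResidueField A)]
    [IsScalarTower D (ResidueField Λ) (ResidueField A)]
    (hfrac : ∀ a : ResidueField Λ, ∃ x y : D, algebraMap D (ResidueField Λ) y ≠ 0 ∧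
      a * algebraMap D (ResidueField Λ) y = algebraMap D (ResidueField Λ) x)
    (φ : Λ →+* A) (hφ : IsLocalHom φ) (hφD : φ.comp (algebraMap D Λ) = algebraMap D A) (l : Λ) :
    residue A (φ l) = algebraMap (ResidueField Λ) (ResidueField A) (residue Λ l) := by
  obtain ⟨x, y, hy, hxy⟩ := hfrac (residue Λ l)
  have hD : ∀ d, residue A (φ (algebraMap D Λ d)) = algebraMap D (ResidueField A) d := fun d => by
    have := congrArg (fun k => residue A (k d)) hφD
    exact this
  have h1 : l * algebraMap D Λ y - algebraMap D Λ x ∈ maximalIdeal Λ := by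
    rw [← residue_eq_zero_iff, map_sub, map_mul, sub_eq_zero]
    exact hxy
  rw [← comap_maximalIdeal_of_isLocalHom φ hφ, Ideal.mem_comap, ← residue_eq_zero_iff, map_sub,
    map_mul, map_sub, map_mul, hD, hD, sub_eq_zero] at h1
  have h2 := congrArg (algebraMap (ResidueField Λ) (ResidueField A)) hxy
  rw [map_mul, ← IsScalarTower.algebraMap_apply, ← IsScalarTower.algebraMap_apply] at h2
  refine mul_right_cancel₀ (b := algebraMap D (ResidueField A) y) ?_ (h1.trans h2.symm)
  rw [IsScalarTower.algebraMap_apply D (ResidueField Λ), Ne, map_eq_zero]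
  exact hy

/-- The finiteness criterion with the hypothesis on `g` stated in terms of the base ring `D` and of
elements `t i` of the maximal ideal of `Λ`, for a map `φ` that need not be an algebra map. -/
theorem IsHenselUniversal.finite_quotient_of_sub_mem {ι : Type*}
    [Algebra (ResidueField Λ) (ResidueField A)] [IsScalarTower D (ResidueField Λ) (ResidueField A)]
    (φ : Λ →+* A) (hφ : IsLocalHom φ)
    (hφD : φ.comp (algebraMap D Λ) = algebraMap D A)
    (hφres : ∀ l, residue A (φ l) =
      algebraMap (ResidueField Λ) (ResidueField A) (residue Λ l)) {b : A}
    (hb : IsHenselUniversal (Polynomial.eval₂RingHom φ b))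
    (hint : IsIntegral (ResidueField Λ) (residue A b))
    (hgen : IntermediateField.adjoin (ResidueField Λ) {residue A b} = ⊤)
    {F : Polynomial D} {d : D} (hd : algebraMap D (ResidueField Λ) d ≠ 0)
    (hF : F.map (algebraMap D (ResidueField Λ)) = Polynomial.C (algebraMap D (ResidueField Λ) d) *
      minpoly (ResidueField Λ) (residue A b)) {t : ι → Λ} (ht : ∀ i, t i ∈ maximalIdeal Λ)
    {g v : A} (hv : IsUnit v) {j : ℕ} (hg : g - v * Polynomial.aeval b F ^ j ∈
      (RingHom.ker (algebraMap D (ResidueField Λ))).map (algebraMap D A) ⊔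
        Ideal.span (Set.range fun i => φ (t i))) :
    ((Ideal.Quotient.mk (Ideal.span {g})).comp φ).Finite ∧
      ∀ a, ∃ p : Polynomial Λ, g ∣ a - Polynomial.eval₂ φ b p := by
  let : Algebra Λ A := φ.toAlgebra
  have : IsLocalHom (algebraMap Λ A) := hφ
  have : IsScalarTower D Λ A := .of_algebraMap_eq' hφD.symm
  have : IsScalarTower Λ (ResidueField Λ) (ResidueField A) := .of_algebraMap_eq hφres
  obtain ⟨h1, h2⟩ := IsHenselUniversal.finite_quotient_of_minpoly b hb hint hgen
    (F.map (algebraMap D Λ)) (algebraMap D Λ d) hd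
    (by rw [Polynomial.map_map]; exact hF) g v hv j (by
      rw [Polynomial.aeval_map_algebraMap]
      refine (sup_le ?_ ?_ : _ ≤ (maximalIdeal Λ).map (algebraMap Λ A)) hg
      · rw [IsScalarTower.algebraMap_eq D Λ A, ← Ideal.map_map]
        refine Ideal.map_mono (Ideal.map_le_iff_le_comap.mpr fun c hc => ?_)
        exact (residue_eq_zero_iff _).mp hc
      · rw [Ideal.span_le]
        rintro _ ⟨i, rfl⟩
        exact Ideal.mem_map_of_mem (algebraMap Λ A) (ht i))
  exact ⟨(RingHom.finite_algebraMap (A := Λ) (B := A ⧸ Ideal.span {g})).mpr h1, h2⟩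

variable {m : ℕ} [Algebra (MvPolynomial (ULift.{u} (Fin m)) D) Λ]
  [IsScalarTower D (MvPolynomial (ULift.{u} (Fin m)) D) Λ]

open MvPolynomial in
/-- Let `A` be the henselization of a smooth `D`-algebra of relative dimension `m + 1` at a point
with finite simple residue field extension, and let `Λ` be the henselization of the affine space of
dimension `m` at the origin. If `g` does not vanish on the fibre, then `A` is a henselization of an
affine line over `Λ` in such a way that `A / g` is a finite `Λ`-module and is generated by the
coordinate as a `Λ`-algebra. -/
theorem IsHenselUniversal.exists_finite_quotient
    [Algebra.IsStandardSmoothOfRelativeDimension (m + 1) D R]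
    (hA : IsHenselUniversal (algebraMap R A))
    (hΛ : IsHenselUniversal (algebraMap (MvPolynomial (ULift.{u} (Fin m)) D) Λ))
    (hΛX : ∀ i, algebraMap (MvPolynomial (ULift.{u} (Fin m)) D) Λ (X i) ∈ maximalIdeal Λ)
    [Algebra (ResidueField Λ) (ResidueField A)]
    [IsScalarTower D (ResidueField Λ) (ResidueField A)]
    [Algebra.IsAlgebraic (ResidueField Λ) (ResidueField A)]
    {α : ResidueField A} (hα : IntermediateField.adjoin (ResidueField Λ) {α} = ⊤)
    (hfrac' : ∀ a : ResidueField A, ∃ x y : R, algebraMap R (ResidueField A) y ≠ 0 ∧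
      a * algebraMap R _ y = algebraMap R _ x)
    (g : A) (hg : g ∉ ((maximalIdeal A).comap (algebraMap D A)).map (algebraMap D A)) :
    ∃ (φ : Λ →+* A) (b : A), IsLocalHom φ ∧ φ.comp (algebraMap D Λ) = algebraMap D A ∧
      IsHenselUniversal (Polynomial.eval₂RingHom φ b) ∧
      ((Ideal.Quotient.mk (Ideal.span {g})).comp φ).Finite ∧
      ∀ a, ∃ p : Polynomial Λ, g ∣ a - Polynomial.eval₂ φ b p := by
  have hfrac : ∀ a : ResidueField Λ, ∃ x y : D, algebraMap D (ResidueField Λ) y ≠ 0 ∧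
      a * algebraMap D (ResidueField Λ) y = algebraMap D (ResidueField Λ) x :=
    fun a => hΛ.exists_mul_eq_algebraMap_residueField hΛX a
  obtain ⟨f, hfX, hf, hb⟩ := hA.exists_mvPolynomial_comp (k := ResidueField Λ) m hfrac hfrac' hα
  have hint : IsIntegral (ResidueField Λ) (residue A (f (X none))) :=
    (Algebra.IsAlgebraic.isAlgebraic _).isIntegral
  -- The minimal polynomial of the class of the last coordinate, with denominators cleared.
  obtain ⟨d, F, hd, hF⟩ := exists_map_eq_C_mul_of_fractions hfrac
    (minpoly (ResidueField Λ) (residue A (f (X none))))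
  obtain ⟨e, he, j, v, hv, h⟩ := hf.exists_sub_mul_pow_mem_of_minpoly hfX hfrac hint hd hF g
    (by rwa [← comap_maximalIdeal_eq_ker A (ResidueField Λ)])
  have hs : Polynomial.aeval (f (X none)) F ∈ maximalIdeal A := by
    rw [← residue_eq_zero_iff, residue_aeval_eq (k := ResidueField Λ), hF, map_mul, minpoly.aeval,
      mul_zero]
  -- The equations of the curve become coordinates.
  obtain ⟨f', hf', hf'n, hf's, hf'D⟩ : ∃ f' : MvPolynomial (Option (ULift.{u} (Fin m))) D →+* A,
      IsHenselUniversal f' ∧ f' (X none) = f (X none) ∧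
      (∀ i, f' (X (some i)) = f (X (some i)) - Polynomial.aeval (f (X none)) F ^ e i) ∧
      f'.comp C = algebraMap D A := by
    refine ⟨_, hf.comp_ringEquiv (translateEquiv fun i => F ^ e i).toRingEquiv, ?_, fun i => ?_, ?_⟩
    · exact congrArg f (translateEquiv_X_none _)
    · refine (congrArg f (translateEquiv_X_some _ i)).trans ?_
      rw [map_sub, ← Polynomial.aeval_algHom_apply, map_pow]
    · refine RingHom.ext fun c => ?_
      exact (congrArg f ((translateEquiv fun i => F ^ e i).commutes c)).trans (f.commutes c)
  -- The new coordinates vanish at the closed point, so that they extend to the henselization `Λ`.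
  obtain ⟨φ, ⟨hφ, hφf⟩, -⟩ := hΛ A (f'.comp (rename some).toRingHom) (by
    refine MvPolynomial.comap_eq_comap_of_comap_C_eq _ _ _ _ (fun i => ?_) hΛX ?_
    · change f' (rename some (X i)) ∈ _
      rw [rename_X, hf's]
      exact sub_mem (hfX i) (Ideal.pow_mem_of_mem _ hs _ (he i))
    · have h1 : (f'.comp (rename some).toRingHom).comp C = algebraMap D A := by
        rw [← hf'D]
        exact RingHom.ext fun c => congrArg f' (rename_C _ _)
      have h2 : (algebraMap (MvPolynomial (ULift.{u} (Fin m)) D) Λ).comp C = algebraMap D Λ :=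
        (IsScalarTower.algebraMap_eq D (MvPolynomial (ULift.{u} (Fin m)) D) Λ).symm
      rw [h1, h2, comap_maximalIdeal_eq_ker A (ResidueField Λ),
        comap_maximalIdeal_eq_ker Λ (ResidueField Λ)])
  have hφD : φ.comp (algebraMap D Λ) = algebraMap D A := by
    refine RingHom.ext fun c => ?_
    have h1 := congrArg (fun k => k (C c)) hφf
    have h2 : f' (rename some (C c)) = algebraMap D A c := by
      rw [rename_C, ← hf'D]
      rfl
    rw [IsScalarTower.algebraMap_eq D (MvPolynomial (ULift.{u} (Fin m)) D) Λ]
    exact h1.trans h2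
  have hφX : ∀ i, φ (algebraMap (MvPolynomial (ULift.{u} (Fin m)) D) Λ (X i)) =
      f (X (some i)) - Polynomial.aeval (f (X none)) F ^ e i := fun i => by
    rw [← hf's, ← rename_X]
    exact congrArg (fun k => k (X i)) hφf
  have huniv := hΛ.eval₂RingHom hf' φ hφ hφf
  rw [hf'n] at huniv
  have hres := residue_eq_algebraMap_residue hfrac φ hφ hφD
  refine ⟨φ, f (X none), hφ, hφD, huniv, ?_⟩
  refine IsHenselUniversal.finite_quotient_of_sub_mem φ hφ hφD hres huniv hint hb hd hF hΛX hv
    (j := j) ?_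
  simp only [hφX]
  exact h

end Projection

/-! ### Residue fields over the base -/

section Descent

theorem IntermediateField.adjoin_eq_top_of_isScalarTower {k l K : Type*} [Field k] [Field l]
    [Field K] [Algebra k l] [Algebra l K] [Algebra k K] [IsScalarTower k l K] {s : Set K}
    (h : IntermediateField.adjoin k s = ⊤) : IntermediateField.adjoin l s = ⊤ := by
  have h1 : IntermediateField.adjoin k s ≤ (IntermediateField.adjoin l s).restrictScalars k :=
    IntermediateField.adjoin_le_iff.mpr (IntermediateField.subset_adjoin l s)
  rw [h] at h1
  exact eq_top_iff.mpr fun a _ => h1 IntermediateField.mem_top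

variable {D R Λ A k : Type u} [CommRing D] [CommRing R] [CommRing Λ] [HenselianLocalRing Λ]
  [CommRing A] [HenselianLocalRing A] [Algebra D R] [Algebra R A] [Algebra D A]
  [IsScalarTower D R A] [Algebra D Λ] {m : ℕ} [Algebra (MvPolynomial (ULift.{u} (Fin m)) D) Λ]
  [IsScalarTower D (MvPolynomial (ULift.{u} (Fin m)) D) Λ] [Field k] [Algebra D k]
  [Algebra k (ResidueField A)] [IsScalarTower D k (ResidueField A)]

open MvPolynomial in
/-- A form of `IsHenselUniversal.exists_finite_quotient` in which the extension of residue fields is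
given over a field `k` of fractions of the image of `D` in the residue field of `A`, instead of over
the residue field of `Λ`. -/
theorem IsHenselUniversal.exists_finite_quotient_of_fractions
    [Algebra.IsStandardSmoothOfRelativeDimension (m + 1) D R]
    (hA : IsHenselUniversal (algebraMap R A))
    (hΛ : IsHenselUniversal (algebraMap (MvPolynomial (ULift.{u} (Fin m)) D) Λ))
    (hΛX : ∀ i, algebraMap (MvPolynomial (ULift.{u} (Fin m)) D) Λ (X i) ∈ maximalIdeal Λ)
    (hD : (maximalIdeal Λ).comap (algebraMap D Λ) = (maximalIdeal A).comap (algebraMap D A))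
    (hfrac : ∀ a : k, ∃ x y : D, algebraMap D k y ≠ 0 ∧ a * algebraMap D k y = algebraMap D k x)
    [Module.Finite k (ResidueField A)]
    {α : ResidueField A} (hα : IntermediateField.adjoin k {α} = ⊤)
    (hfrac' : ∀ a : ResidueField A, ∃ x y : R, algebraMap R (ResidueField A) y ≠ 0 ∧
      a * algebraMap R _ y = algebraMap R _ x)
    (g : A) (hg : g ∉ ((maximalIdeal A).comap (algebraMap D A)).map (algebraMap D A)) :
    ∃ (φ : Λ →+* A) (b : A), IsLocalHom φ ∧ φ.comp (algebraMap D Λ) = algebraMap D A ∧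
      IsHenselUniversal (Polynomial.eval₂RingHom φ b) ∧
      ((Ideal.Quotient.mk (Ideal.span {g})).comp φ).Finite ∧
      ∀ a, ∃ p : Polynomial Λ, g ∣ a - Polynomial.eval₂ φ b p := by
  have hΛker : RingHom.ker (algebraMap D (ResidueField Λ)) =
      (maximalIdeal Λ).comap (algebraMap D Λ) := (comap_maximalIdeal_eq_ker Λ _).symm
  have hAker : RingHom.ker (algebraMap D (ResidueField A)) =
      (maximalIdeal A).comap (algebraMap D A) := (comap_maximalIdeal_eq_ker A _).symm
  have hkker : RingHom.ker (algebraMap D k) =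
      (maximalIdeal A).comap (algebraMap D A) := (comap_maximalIdeal_eq_ker A _).symm
  obtain ⟨ψ, hψ⟩ := exists_ringHom_of_ker_eq_of_fractions (algebraMap D (ResidueField Λ))
    (algebraMap D (ResidueField A)) (by rw [hΛker, hAker, hD])
    fun a => hΛ.exists_mul_eq_algebraMap_residueField hΛX a
  obtain ⟨θ, hθ⟩ := exists_ringHom_of_ker_eq_of_fractions (algebraMap D k)
    (algebraMap D (ResidueField Λ)) (by rw [hΛker, hkker, hD]) hfrac
  let : Algebra (ResidueField Λ) (ResidueField A) := ψ.toAlgebra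
  let : Algebra k (ResidueField Λ) := θ.toAlgebra
  have : IsScalarTower D (ResidueField Λ) (ResidueField A) := .of_algebraMap_eq' hψ.symm
  have : IsScalarTower k (ResidueField Λ) (ResidueField A) := by
    refine .of_algebraMap_eq fun a => ?_
    obtain ⟨x, y, hy, hxy⟩ := hfrac a
    have h1 := congrArg (algebraMap k (ResidueField A)) hxy
    have h2 := congrArg (fun a => ψ (θ a)) hxy
    have h3 : ∀ d, ψ (θ (algebraMap D k d)) = algebraMap k (ResidueField A) (algebraMap D k d) :=
      fun d => by
        rw [← IsScalarTower.algebraMap_apply, ← hψ, ← hθ]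
        rfl
    simp only [map_mul, h3] at h1 h2
    exact mul_right_cancel₀ ((map_ne_zero _).mpr hy) (h1.trans h2.symm)
  have : Module.Finite (ResidueField Λ) (ResidueField A) := .of_restrictScalars_finite k _ _
  exact hA.exists_finite_quotient hΛ hΛX
    (IntermediateField.adjoin_eq_top_of_isScalarTower (k := k) hα) hfrac' g hg

end Descent

/-! ### Stalks, residue fields and affine spaces in affine charts -/

section AffineCharts

theorem IsLocalization.AtPrime.exists_residue_mul_eq {P L : Type*} [CommRing P] [CommRing L]
    [IsLocalRing L] [Algebra P L] (y : Ideal P) [y.IsPrime] [IsLocalization.AtPrime L y] (a : L) :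
    ∃ p s : P, residue L (algebraMap P L s) ≠ 0 ∧
      residue L a * residue L (algebraMap P L s) = residue L (algebraMap P L p) := by
  obtain ⟨⟨p, s⟩, h⟩ := IsLocalization.surj y.primeCompl a
  refine ⟨p, s, ?_, by rw [← map_mul, h]⟩
  rw [residue_ne_zero_iff_isUnit]
  exact IsLocalization.map_units L s

/-- The local ring of a scheme at a point of an affine chart `o : Spec P ⟶ Y` is a localization
of `P`. -/
theorem AlgebraicGeometry.exists_isLocalization_stalk {P : Type u} [CommRing P]
    {Y : Scheme.{u}} (o : Spec (.of P) ⟶ Y) [IsOpenImmersion o] (y : PrimeSpectrum P) (z : Y)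
    (h : o y = z) :
    ∃ l : P →+* Y.presheaf.stalk z,
      (letI := l.toAlgebra; IsLocalization.AtPrime (Y.presheaf.stalk z) y.asIdeal) ∧
        Spec.map (CommRingCat.ofHom l) ≫ o = Y.fromSpecStalk z := by
  subst h
  let y' : Spec (.of P) := y
  have : IsIso (o.stalkMap y') := inferInstance
  let l₀ : CommRingCat.of P ⟶ (Spec (.of P)).presheaf.stalk y' :=
    StructureSheaf.toStalk P y
  let l := l₀ ≫ inv (o.stalkMap y')
  refine ⟨l.hom, ?_, ?_⟩
  · let : Algebra P (Y.presheaf.stalk (o y)) := l.hom.toAlgebra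
    let e : ((Spec.structureSheaf P).presheaf.stalk y) ≃ₐ[P] Y.presheaf.stalk (o y) :=
      { (asIso (o.stalkMap y')).symm.commRingCatIsoToRingEquiv with
        commutes' := fun _ => rfl }
    exact IsLocalization.isLocalization_of_algEquiv _ e
  · change Spec.map (l₀ ≫ inv (o.stalkMap y')) ≫ o = _
    rw [Spec.map_comp, Category.assoc]
    have h1 : Spec.map l₀ = (Spec (.of P)).fromSpecStalk y' := (Spec.fromSpecStalk_eq _ _).symm
    rw [h1, ← Scheme.SpecMap_stalkMap_fromSpecStalk, ← Spec.map_comp_assoc, IsIso.hom_inv_id,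
      Spec.map_id, Category.id_comp]

/-- The henselization of a scheme at a point of an affine chart `o : Spec P ⟶ Y` is universal over
`P`, and its residue field consists of fractions of elements of `P`. -/
theorem AlgebraicGeometry.exists_isHenselUniversal {P : Type u} [CommRing P]
    {Y : Scheme.{u}} (o : Spec (.of P) ⟶ Y) [IsOpenImmersion o] (y : PrimeSpectrum P) (z : Y)
    (h : o y = z) :
    ∃ l : P →+* localHenselization (Y.presheaf.stalk z), IsHenselUniversal l ∧
      (maximalIdeal (localHenselization (Y.presheaf.stalk z))).comap l = y.asIdeal ∧
      (∀ a : ResidueField (localHenselization (Y.presheaf.stalk z)), ∃ p s : P,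
        IsLocalRing.residue _ (l s) ≠ 0 ∧
          a * IsLocalRing.residue _ (l s) = IsLocalRing.residue _ (l p)) ∧
      Spec.map (CommRingCat.ofHom l) ≫ o = fromHenselizationAt Y z := by
  obtain ⟨l, hl, hlo⟩ := exists_isLocalization_stalk o y z h
  let : Algebra P (Y.presheaf.stalk z) := l.toAlgebra
  have : IsLocalization.AtPrime (Y.presheaf.stalk z) y.asIdeal := hl
  refine ⟨(toLocalHenselization (Y.presheaf.stalk z)).hom.comp l,
    IsHenselUniversal.toLocalHenselization_comp_localization y.asIdeal (Y.presheaf.stalk z),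
    ?_, fun a => ?_, ?_⟩
  · rw [← Ideal.comap_comap, comap_maximalIdeal_of_isLocalHom _ inferInstance]
    exact IsLocalization.AtPrime.under_maximalIdeal _ y.asIdeal
  · obtain ⟨a, rfl⟩ := residue_surjective a
    obtain ⟨r, hr⟩ := residue_surjective (localHenselization.toResidueField _ a)
    obtain ⟨p, s, hs, h⟩ := IsLocalization.AtPrime.exists_residue_mul_eq y.asIdeal r
    have h0 : ∀ b : localHenselization (Y.presheaf.stalk z), IsLocalRing.residue _ b = 0 ↔
        localHenselization.toResidueField _ b = 0 := fun b => by
      rw [residue_eq_zero_iff, localHenselization.mem_maximalIdeal]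
    refine ⟨p, s, ?_, ?_⟩
    · rw [Ne, h0, RingHom.comp_apply, localHenselization.toResidueField_toLocalHenselization]
      exact hs
    · rw [← map_mul, ← sub_eq_zero, ← map_sub, h0, map_sub, map_mul, RingHom.comp_apply,
        RingHom.comp_apply, localHenselization.toResidueField_toLocalHenselization,
        localHenselization.toResidueField_toLocalHenselization, ← hr, sub_eq_zero]
      exact h
  · rw [CommRingCat.ofHom_comp, Spec.map_comp, Category.assoc, hlo]
    rfl

/-- The residue field of a scheme at a point of an affine chart `o : Spec P ⟶ Y` consists of
fractions of elements of `P`. -/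
theorem AlgebraicGeometry.exists_residueField_hom {P : Type u} [CommRing P]
    {Y : Scheme.{u}} (o : Spec (.of P) ⟶ Y) [IsOpenImmersion o] (y : PrimeSpectrum P) (z : Y)
    (h : o y = z) :
    ∃ l : P →+* Y.residueField z, RingHom.ker l = y.asIdeal ∧
      (∀ a, ∃ p s : P, l s ≠ 0 ∧ a * l s = l p) ∧
      Spec.map (CommRingCat.ofHom l) ≫ o = Y.fromSpecResidueField z := by
  obtain ⟨l, hl, hlo⟩ := exists_isLocalization_stalk o y z h
  let : Algebra P (Y.presheaf.stalk z) := l.toAlgebra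
  have : IsLocalization.AtPrime (Y.presheaf.stalk z) y.asIdeal := hl
  refine ⟨(Y.residue z).hom.comp l, ?_, fun a => ?_, ?_⟩
  · have h1 : RingHom.ker (Y.residue z).hom = maximalIdeal (Y.presheaf.stalk z) := ker_residue
    rw [← RingHom.comap_ker, h1]
    exact IsLocalization.AtPrime.under_maximalIdeal _ y.asIdeal
  · obtain ⟨a, rfl⟩ := residue_surjective (R := Y.presheaf.stalk z) a
    exact IsLocalization.AtPrime.exists_residue_mul_eq y.asIdeal a
  · rw [CommRingCat.ofHom_comp, Spec.map_comp, Category.assoc, hlo]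
    rfl

open MvPolynomial in
/-- An affine chart `o : Spec D ⟶ S` gives an affine chart of the affine space over `S`, which is
compatible with the projections and with the zero sections. -/
theorem exists_affineSpace_chart {D ι : Type u} [CommRing D] {S : Scheme.{u}}
    (o : Spec (.of D) ⟶ S) [IsOpenImmersion o] :
    ∃ o' : Spec (.of (MvPolynomial ι D)) ⟶ 𝔸(ι; S), IsOpenImmersion o' ∧
      o' ≫ 𝔸(ι; S) ↘ S = Spec.map (CommRingCat.ofHom C) ≫ o ∧
      Spec.map (CommRingCat.ofHom (constantCoeff (R := D) (σ := ι))) ≫ o' =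
        o ≫ AffineSpace.homOfVector (𝟙 S) 0 := by
  have hm : IsOpenImmersion (AffineSpace.map ι o) :=
    MorphismProperty.of_isPullback (P := @IsOpenImmersion) (AffineSpace.isPullback_map o).flip
      ‹_›
  refine ⟨(AffineSpace.SpecIso ι (.of D)).inv ≫ AffineSpace.map ι o, inferInstance, ?_, ?_⟩
  · rw [Category.assoc, AffineSpace.map_over, AffineSpace.SpecIso_inv_over_assoc]
  · refine AffineSpace.hom_ext ?_ fun i => ?_
    · rw [Category.assoc, Category.assoc, Category.assoc, AffineSpace.map_over,
        AffineSpace.SpecIso_inv_over_assoc, AffineSpace.homOfVector_over, Category.comp_id,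
        ← Spec.map_comp_assoc, ← CommRingCat.ofHom_comp]
      have : (constantCoeff (R := D) (σ := ι)).comp C = RingHom.id D :=
        RingHom.ext fun d => constantCoeff_C _ d
      rw [this]
      exact (congrArg (· ≫ o) (Spec.map_id _)).trans (Category.id_comp _)
    · rw [Scheme.Hom.comp_appTop, Scheme.Hom.comp_appTop, Scheme.Hom.comp_appTop,
        CommRingCat.comp_apply, CommRingCat.comp_apply, CommRingCat.comp_apply,
        AffineSpace.map_appTop_coord, AffineSpace.SpecIso_inv_appTop_coord,
        AffineSpace.homOfVector_appTop_coord]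
      refine Eq.trans ?_ (map_zero o.appTop.hom).symm
      have h := congrArg (fun k => k.hom (X i)) (Scheme.ΓSpecIso_inv_naturality
        (CommRingCat.ofHom (constantCoeff (R := D) (σ := ι))))
      refine Eq.trans h.symm ?_
      change (Scheme.ΓSpecIso (.of D)).inv.hom (constantCoeff (X i)) = 0
      rw [constantCoeff_X, map_zero]

end AffineCharts

/-! ### Equations of closed subschemes of positive codimension -/

section Codimension

/-- The generic point of an irreducible component has codimension zero. -/
theorem AlgebraicGeometry.exists_coheight_eq_zero {X : Scheme.{u}} (x : X) :
    ∃ y : X, Order.coheight y = 0 := by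
  obtain ⟨y, hy⟩ := QuasiSober.sober (isIrreducible_irreducibleComponent (x := x))
    isClosed_irreducibleComponent
  refine ⟨y, Order.coheight_eq_zero.mpr fun z hz => ?_⟩
  have hz' : z ⤳ y := hz
  change y ⤳ z
  have h1 : irreducibleComponent x ⊆ closure {z} := by
    rw [← hy.def]
    exact closure_minimal (Set.singleton_subset_iff.mpr hz'.mem_closure) isClosed_closure
  have h2 := (irreducibleComponent_mem_irreducibleComponents x).2
    (isIrreducible_singleton.closure : IsIrreducible (closure {z})) h1
  rw [specializes_iff_mem_closure, hy.def]
  exact h2 (subset_closure rfl)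

/-- A closed subset of positive codimension in a fibre does not contain the fibre. -/
theorem exists_notMem_of_codimIn_pos {U S : Scheme.{u}} (q : U ⟶ S) (x : U) (T : Set U)
    (h : 0 < codimIn (q.fiber (q x)) (q.fiberι (q x) ⁻¹' T)) : ∃ u : U, q u = q x ∧ u ∉ T := by
  by_contra! hT
  obtain ⟨y, hy⟩ := exists_coheight_eq_zero (q.asFiber x)
  have hy' : y ∈ q.fiberι (q x) ⁻¹' T := by
    refine hT _ ?_
    have : q.fiberι (q x) y ∈ Set.range (q.fiberι (q x)) := ⟨y, rfl⟩
    rw [Scheme.Hom.range_fiberι] at this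
    exact this
  have h1 : codimIn (q.fiber (q x)) (q.fiberι (q x) ⁻¹' T) ≤ Order.coheight y := iInf₂_le y hy'
  rw [hy] at h1
  exact absurd h (not_lt.mpr h1)

/-- A closed subscheme of a local scheme that has positive codimension in the fibre over the image
of the closed point has an equation that does not vanish on that fibre. -/
theorem exists_mem_notMem_map_comap_of_codimIn_pos {U S Z : Scheme.{u}} {D A : Type u} [CommRing D]
    [CommRing A] [IsLocalRing A] [Algebra D A] (q : U ⟶ S) (e : U ≅ Spec (.of A))
    (o : Spec (.of D) ⟶ S) [IsOpenImmersion o]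
    (hqo : e.inv ≫ q = Spec.map (CommRingCat.ofHom (algebraMap D A)) ≫ o) (x : U)
    (hx : e.hom x = closedPoint A) (i : Z ⟶ U) (I : Ideal A)
    (ez : Z ≅ Spec (.of (A ⧸ I)))
    (hi : i ≫ e.hom = ez.hom ≫ Spec.map (CommRingCat.ofHom (Ideal.Quotient.mk I)))
    (h : 0 < codimIn (q.fiber (q x)) (q.fiberι (q x) ⁻¹' Set.range i)) :
    ∃ g ∈ I, g ∉ ((maximalIdeal A).comap (algebraMap D A)).map (algebraMap D A) := by
  obtain ⟨u, hu, hui⟩ := exists_notMem_of_codimIn_pos q x _ h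
  have hq : ∀ w : U, q w = o (PrimeSpectrum.comap (algebraMap D A) (e.hom w)) := fun w => by
    have h1 : q w = (e.inv ≫ q) (e.hom w) := by
      rw [Scheme.Hom.comp_apply, ← Scheme.Hom.comp_apply e.hom, Iso.hom_inv_id]
      rfl
    rw [h1, hqo]
    rfl
  have h1 : PrimeSpectrum.comap (algebraMap D A) (e.hom u) =
      PrimeSpectrum.comap (algebraMap D A) (e.hom x) := by
    refine o.isOpenEmbedding.injective ?_
    rw [← hq, ← hq, hu]
  let P : PrimeSpectrum A := e.hom u
  have hP : (maximalIdeal A).comap (algebraMap D A) = P.asIdeal.comap (algebraMap D A) := by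
    rw [hx] at h1
    exact (congrArg PrimeSpectrum.asIdeal h1).symm
  obtain ⟨g, hgI, hgP⟩ : ∃ g ∈ I, g ∉ P.asIdeal := by
    by_contra! hI
    have h2 : P ∈ Set.range (PrimeSpectrum.comap (Ideal.Quotient.mk I)) := by
      rw [range_comap_of_surjective _ _ Ideal.Quotient.mk_surjective, Ideal.mk_ker]
      exact hI
    obtain ⟨w', hw⟩ := h2
    let w : Spec (.of (A ⧸ I)) := w'
    refine hui ⟨ez.inv w, ?_⟩
    have h3 : e.hom (i (ez.inv w)) = e.hom u := by
      rw [← Scheme.Hom.comp_apply, hi, ← Scheme.Hom.comp_apply, Iso.inv_hom_id_assoc]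
      exact hw
    exact e.hom.isOpenEmbedding.injective h3
  refine ⟨g, hgI, fun hg => hgP ?_⟩
  rw [hP] at hg
  exact Ideal.map_comap_le hg

end Codimension

/-! ### Morphisms to the affine line -/

section AffineLine

open MvPolynomial in
/-- A henselization of an affine line over `Λ` yields an essentially étale morphism to that line; a
closed subscheme whose coordinate ring is generated over `Λ` by the coordinate, and is finite over
`Λ`, is mapped isomorphically to a closed subscheme that is finite over `Λ`. -/
theorem exists_hom_affineSpace_of_isHenselUniversal {U Z : Scheme.{u}} {Λ : CommRingCat.{u}}
    {A : Type u} [CommRing A] [HenselianLocalRing A] (e : U ≅ Spec (.of A)) (φ : Λ →+* A) (b : A)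
    (hb : IsHenselUniversal (Polynomial.eval₂RingHom φ b)) (i : Z ⟶ U) (I : Ideal A)
    (ez : Z ≅ Spec (.of (A ⧸ I)))
    (hi : i ≫ e.hom = ez.hom ≫ Spec.map (CommRingCat.ofHom (Ideal.Quotient.mk I))) {g : A}
    (hgI : g ∈ I) (hfin : ((Ideal.Quotient.mk (Ideal.span {g})).comp φ).Finite)
    (hsurj : ∀ a, ∃ p : Polynomial Λ, g ∣ a - Polynomial.eval₂ φ b p) :
    ∃ π : U ⟶ affineSpace 1 (Spec Λ),
      π ≫ affineSpaceProj 1 (Spec Λ) = e.hom ≫ Spec.map (CommRingCat.ofHom φ) ∧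
        IsEssEtaleHenselianLocal π ∧ IsIso (i ≫ π).toImage ∧
        IsFinite ((i ≫ π).imageι ≫ affineSpaceProj 1 (Spec Λ)) := by
  let M := MvPolynomial (ULift.{u} (Fin 1)) Λ
  let ε : M ≃ₐ[Λ] Polynomial Λ := MvPolynomial.uniqueAlgEquiv Λ (ULift.{u} (Fin 1))
  let ψ : M →+* A := (Polynomial.eval₂RingHom φ b).comp ε.toRingEquiv.toRingHom
  have hψ : IsHenselUniversal ψ := hb.comp_ringEquiv ε.toRingEquiv
  have hψC : ψ.comp C = φ := RingHom.ext fun l =>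
    (congrArg (Polynomial.eval₂RingHom φ b) (ε.commutes l)).trans (Polynomial.eval₂_C _ _)
  let o : Spec (.of M) ⟶ affineSpace 1 (Spec Λ) := (AffineSpace.SpecIso _ Λ).inv
  have ho : o ≫ affineSpaceProj 1 (Spec Λ) = Spec.map (CommRingCat.ofHom C) :=
    AffineSpace.SpecIso_inv_over _
  let π : U ⟶ affineSpace 1 (Spec Λ) := e.hom ≫ Spec.map (CommRingCat.ofHom ψ) ≫ o
  have hπ : π ≫ affineSpaceProj 1 (Spec Λ) = e.hom ≫ Spec.map (CommRingCat.ofHom φ) := by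
    simp only [π, Category.assoc]
    rw [ho, ← Spec.map_comp, ← CommRingCat.ofHom_comp, hψC]
  have hiπ : i ≫ π = ez.hom ≫
      Spec.map (CommRingCat.ofHom ((Ideal.Quotient.mk I).comp ψ)) ≫ o := by
    rw [CommRingCat.ofHom_comp, Spec.map_comp, Category.assoc, ← reassoc_of% hi]
  -- A closed immersion is an isomorphism onto its scheme-theoretic image.
  have hcl : IsClosedImmersion (i ≫ π) := by
    have h1 : IsClosedImmersion
        (Spec.map (CommRingCat.ofHom ((Ideal.Quotient.mk I).comp ψ))) := by
      refine IsClosedImmersion.spec_of_surjective _ fun a => ?_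
      obtain ⟨a, rfl⟩ := Ideal.Quotient.mk_surjective a
      obtain ⟨p, hp⟩ := hsurj a
      refine ⟨ε.symm p, ?_⟩
      have h2 : ψ (ε.symm p) = Polynomial.eval₂ φ b p :=
        congrArg (Polynomial.eval₂RingHom φ b) (ε.apply_symm_apply p)
      change Ideal.Quotient.mk I (ψ (ε.symm p)) = _
      rw [h2, eq_comm, Ideal.Quotient.eq]
      exact I.mem_of_dvd hp hgI
    rw [hiπ]
    infer_instance
  have hiso : IsIso (i ≫ π).toImage := inferInstance
  refine ⟨π, hπ, ?_, hiso, ?_⟩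
  · let y : PrimeSpectrum M := PrimeSpectrum.comap ψ (closedPoint A)
    obtain ⟨l, hl, hly, -, hlo⟩ := exists_isHenselUniversal o y (o y) rfl
    -- `A` and the henselization of the affine line at the image of the closed point have the same
    -- universal property, so the étale scheme over the affine line is the affine line itself.
    obtain ⟨E, hE⟩ := hψ.exists_ringEquiv hl hly.symm
    let E' : CommRingCat.of A ≅
        localHenselization ((affineSpace 1 (Spec Λ)).presheaf.stalk (o y)) :=
      E.toCommRingCatIso
    refine ⟨_, 𝟙 _, o y, π, inferInstance, ⟨e ≪≫ Scheme.Spec.mapIso E'.symm.op, ?_⟩,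
      Category.comp_id _⟩
    rw [← hlo]
    have h1 : CommRingCat.ofHom l ≫ E'.inv = CommRingCat.ofHom ψ := by
      rw [Iso.comp_inv_eq]
      exact congrArg CommRingCat.ofHom hE.symm
    simp only [π]
    rw [← h1, Spec.map_comp, Category.assoc]
    exact Category.assoc _ _ _
  · have h1 : IsFinite ((i ≫ π) ≫ affineSpaceProj 1 (Spec Λ)) := by
      rw [Category.assoc, hπ, reassoc_of% hi, ← Spec.map_comp, ← CommRingCat.ofHom_comp]
      have h2 : ((Ideal.Quotient.mk I).comp φ).Finite := by
        have h3 : (Ideal.Quotient.mk I).comp φ = (Ideal.Quotient.factor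
            ((Ideal.span_singleton_le_iff_mem I).mpr hgI)).comp
              ((Ideal.Quotient.mk (Ideal.span {g})).comp φ) := rfl
        rw [h3]
        exact (RingHom.Finite.of_surjective _ (Ideal.Quotient.factor_surjective _)).comp hfin
      have h4 : IsFinite (Spec.map (CommRingCat.ofHom ((Ideal.Quotient.mk I).comp φ))) :=
        (IsFinite.SpecMap_iff _).mpr h2
      infer_instance
    rw [show (i ≫ π).imageι ≫ affineSpaceProj 1 (Spec Λ) =
      inv (i ≫ π).toImage ≫ (i ≫ π) ≫ affineSpaceProj 1 (Spec Λ) by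
        rw [IsIso.eq_inv_comp, Scheme.Hom.toImage_imageι_assoc]]
    infer_instance

end AffineLine

/-! ### Local schemes over an affine chart -/

section Chart

theorem IsFiniteSimpleExtension.comp_bijective {k K K' : Type u} [Field k] [Field K] [Field K']
    {φ : k →+* K} (h : IsFiniteSimpleExtension φ) (ε : K →+* K') (hε : Function.Bijective ε) :
    IsFiniteSimpleExtension (ε.comp φ) := by
  let : Algebra k K := φ.toAlgebra
  let : Algebra k K' := (ε.comp φ).toAlgebra
  let E : K ≃ₐ[k] K' := AlgEquiv.ofBijective ⟨ε, fun _ => rfl⟩ hε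
  obtain ⟨h1, α, hα⟩ := h
  refine ⟨Module.Finite.equiv E.toLinearEquiv, ε α, ?_⟩
  have h2 := IntermediateField.adjoin_map k {α} E.toAlgHom
  rw [hα, Set.image_singleton, ← AlgHom.fieldRange_eq_map] at h2
  exact h2.symm.trans (AlgHom.fieldRange_eq_top.mpr E.surjective)

/-- The extension of residue fields of a morphism from a local scheme `U` to `S`, in terms of an
affine chart of `S` and of the coordinate ring of `U`. -/
theorem exists_isFiniteSimpleExtension_residueField {U S : Scheme.{u}} {D A : Type u} [CommRing D]
    [CommRing A] [IsLocalRing A] [Algebra D A] (q : U ⟶ S) (e : U ≅ Spec (.of A))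
    (o : Spec (.of D) ⟶ S) [IsOpenImmersion o]
    (hqo : e.inv ≫ q = Spec.map (CommRingCat.ofHom (algebraMap D A)) ≫ o) (x : U)
    (hx : e.hom x = closedPoint A)
    (ho : o (PrimeSpectrum.comap (algebraMap D A) (closedPoint A)) = q x)
    (hres : IsFiniteSimpleExtension (q.residueFieldMap x).hom) :
    ∃ (δ : D →+* S.residueField (q x)) (ρ : S.residueField (q x) →+* ResidueField A),
      (∀ a, ∃ p s : D, δ s ≠ 0 ∧ a * δ s = δ p) ∧ ρ.comp δ = algebraMap D (ResidueField A) ∧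
        IsFiniteSimpleExtension ρ := by
  obtain ⟨δ, -, hδ, hδo⟩ := exists_residueField_hom o _ (q x) ho
  obtain ⟨τ, hτker, hτ, hτo⟩ := exists_residueField_hom e.inv (closedPoint A) x (by
    rw [← hx, ← Scheme.Hom.comp_apply, Iso.hom_inv_id]
    rfl)
  obtain ⟨ε, hε⟩ := exists_ringHom_of_ker_eq_of_fractions τ (residue A)
    (hτker.trans ker_residue.symm) hτ
  have hεb : Function.Bijective ε := ⟨ε.injective, fun a => by
    obtain ⟨a, rfl⟩ := residue_surjective a
    exact ⟨τ a, congrArg (fun k => k a) hε⟩⟩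
  have hτδ : τ.comp (algebraMap D A) = (q.residueFieldMap x).hom.comp δ := by
    have h1 : Spec.map (CommRingCat.ofHom (τ.comp (algebraMap D A))) ≫ o =
        Spec.map (CommRingCat.ofHom ((q.residueFieldMap x).hom.comp δ)) ≫ o := by
      rw [CommRingCat.ofHom_comp, CommRingCat.ofHom_comp, Spec.map_comp, Spec.map_comp,
        Category.assoc, Category.assoc, hδo, ← hqo, reassoc_of% hτo]
      exact (q.SpecMap_residueFieldMap_fromSpecResidueField x).symm
    rw [cancel_mono] at h1
    exact congrArg CommRingCat.Hom.hom (Spec.map_injective h1)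
  refine ⟨δ, ε.comp (q.residueFieldMap x).hom, hδ, ?_, hres.comp_bijective ε hεb⟩
  rw [RingHom.comp_assoc, ← hτδ, ← RingHom.comp_assoc, hε]
  rfl

open MvPolynomial in
/-- The theorem for a local scheme `U` that is given by the henselization `A` of a standard smooth
algebra over the coordinate ring of an affine chart of `S`. -/
theorem exists_hom_affineSpace_henselAffineSpace {S U Z : Scheme.{u}} (m : ℕ) {D R A : Type u}
    [CommRing D] [CommRing R] [CommRing A] [HenselianLocalRing A] [Algebra D R] [Algebra R A]
    [Algebra D A] [IsScalarTower D R A]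
    [Algebra.IsStandardSmoothOfRelativeDimension (m + 1) D R]
    (hA : IsHenselUniversal (algebraMap R A))
    (hfrac : ∀ a : ResidueField A, ∃ x y : R, algebraMap R (ResidueField A) y ≠ 0 ∧
      a * algebraMap R _ y = algebraMap R _ x)
    (q : U ⟶ S) (e : U ≅ Spec (.of A)) (o : Spec (.of D) ⟶ S) [IsOpenImmersion o]
    (hqo : e.inv ≫ q = Spec.map (CommRingCat.ofHom (algebraMap D A)) ≫ o) (x : U)
    (hx : e.hom x = closedPoint A) (hres : IsFiniteSimpleExtension (q.residueFieldMap x).hom)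
    (i : Z ⟶ U) [IsClosedImmersion i]
    (hZ : 0 < codimIn (q.fiber (q x)) (q.fiberι (q x) ⁻¹' Set.range i)) :
    ∃ π : U ⟶ affineSpace 1 (henselAffineSpace m S (q x)),
      π ≫ affineSpaceProj 1 (henselAffineSpace m S (q x)) ≫
          henselAffineSpaceProj m S (q x) = q ∧
        IsEssEtaleHenselianLocal π ∧ IsIso (i ≫ π).toImage ∧
        IsFinite ((i ≫ π).imageι ≫ affineSpaceProj 1 (henselAffineSpace m S (q x))) := by
  let σ : PrimeSpectrum D := PrimeSpectrum.comap (algebraMap D A) (closedPoint A)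
  have hσ : o σ = q x := by
    have h1 : q x = (e.inv ≫ q) (e.hom x) := by
      rw [Scheme.Hom.comp_apply, ← Scheme.Hom.comp_apply e.hom, Iso.hom_inv_id]
      rfl
    rw [h1, hqo, hx]
    rfl
  obtain ⟨δ, ρ, hδ, hρδ, hfin, α, hα⟩ :=
    exists_isFiniteSimpleExtension_residueField q e o hqo x hx hσ hres
  obtain ⟨o', _, ho'S, ho'0⟩ := exists_affineSpace_chart (ι := ULift.{u} (Fin m)) o
  let y : PrimeSpectrum (MvPolynomial (ULift.{u} (Fin m)) D) :=
    PrimeSpectrum.comap constantCoeff σ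
  have hy : o' y = zeroSection m S (q x) := by
    rw [← hσ]
    exact congrArg (fun k => k.base σ) ho'0
  obtain ⟨l, hl, hly, -, hlo⟩ := exists_isHenselUniversal o' y _ hy
  obtain ⟨I, ez, hi⟩ := IsClosedImmersion.Spec_iff.mp
    (inferInstance : IsClosedImmersion (i ≫ e.hom))
  obtain ⟨g, hgI, hg⟩ := exists_mem_notMem_map_comap_of_codimIn_pos q e o hqo x hx i I ez hi hZ
  let Λ : CommRingCat.{u} :=
    localHenselization ((affineSpace m S).presheaf.stalk (zeroSection m S (q x)))
  let : Algebra (MvPolynomial (ULift.{u} (Fin m)) D) Λ := l.toAlgebra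
  let : Algebra D Λ := (l.comp C).toAlgebra
  have : IsScalarTower D (MvPolynomial (ULift.{u} (Fin m)) D) Λ := .of_algebraMap_eq' rfl
  let : Algebra D (S.residueField (q x)) := δ.toAlgebra
  let : Algebra (S.residueField (q x)) (ResidueField A) := ρ.toAlgebra
  have : IsScalarTower D (S.residueField (q x)) (ResidueField A) :=
    .of_algebraMap_eq' hρδ.symm
  have : Module.Finite (S.residueField (q x)) (ResidueField A) := hfin
  obtain ⟨φ, b, -, hφD, hb, hφ, hsurj⟩ :=
    hA.exists_finite_quotient_of_fractions (k := S.residueField (q x)) (Λ := Λ) (m := m) hl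
      (fun j => by
        have h1 : X j ∈ y.asIdeal := by
          change constantCoeff (X j) ∈ σ.asIdeal
          rw [constantCoeff_X]
          exact zero_mem _
        rw [← hly] at h1
        exact h1)
      (by
        change (maximalIdeal Λ).comap (l.comp C) = σ.asIdeal
        rw [← Ideal.comap_comap, hly]
        ext d
        change constantCoeff (C d) ∈ σ.asIdeal ↔ _
        rw [constantCoeff_C]) hδ hα hfrac g hg
  obtain ⟨π, hπ, h1, h2, h3⟩ :=
    exists_hom_affineSpace_of_isHenselUniversal e φ b hb i I ez hi hgI hφ hsurj
  refine ⟨π, ?_, h1, h2, h3⟩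
  have h4 : Spec.map (CommRingCat.ofHom l) ≫ o' ≫ 𝔸(ULift.{u} (Fin m); S) ↘ S =
      Spec.map (CommRingCat.ofHom (l.comp C)) ≫ o := by
    rw [ho'S, ← Spec.map_comp_assoc, ← CommRingCat.ofHom_comp]
  have h5 : henselAffineSpaceProj m S (q x) =
      Spec.map (CommRingCat.ofHom (algebraMap D Λ)) ≫ o :=
    (congrArg (· ≫ affineSpaceProj m S) hlo).symm.trans ((Category.assoc _ _ _).trans h4)
  have h6 : (e.hom ≫ Spec.map (CommRingCat.ofHom φ)) ≫
      Spec.map (CommRingCat.ofHom (algebraMap D Λ)) ≫ o = q := by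
    rw [Category.assoc, ← Spec.map_comp_assoc, ← CommRingCat.ofHom_comp, hφD, ← hqo,
      Iso.hom_inv_id_assoc]
  exact (Category.assoc _ _ _).symm.trans ((congrArg₂ CategoryStruct.comp hπ h5).trans h6)

end Chart

theorem mainTheorem4 {S U Z : Scheme.{u}} (n : ℕ) (hn : 1 ≤ n)
    (q : U ⟶ S) (hq : IsEssSmoothHenselianLocal n q)
    (x : U) (hx : IsClosed ({x} : Set U))
    (hres : IsFiniteSimpleExtension (q.residueFieldMap x).hom)
    (i : Z ⟶ U) [IsClosedImmersion i]
    (hZ : 0 < codimIn (q.fiber (q x)) (q.fiberι (q x) ⁻¹' Set.range i)) :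
    ∃ π : U ⟶ affineSpace 1 (henselAffineSpace (n - 1) S (q x)),
      π ≫ affineSpaceProj 1 (henselAffineSpace (n - 1) S (q x)) ≫
          henselAffineSpaceProj (n - 1) S (q x) = q ∧
        IsEssEtaleHenselianLocal π ∧
        IsIso (i ≫ π).toImage ∧
        IsFinite ((i ≫ π).imageι ≫
          affineSpaceProj 1 (henselAffineSpace (n - 1) S (q x))) := by
  obtain ⟨m, rfl⟩ : ∃ m, n = m + 1 := ⟨n - 1, by omega⟩
  obtain ⟨Y, p, y, j, hp, ⟨e, he⟩, hj⟩ := hq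
  -- A chart in which the smooth morphism is standard smooth.
  obtain ⟨W, hW, V, hV, hyV, hVW, hsm⟩ :=
    hp.exists_isStandardSmoothOfRelativeDimension y
  obtain ⟨l, hl, -, hfrac, hlo⟩ := exists_isHenselUniversal (P := Γ(Y, V)) hV.fromSpec
    (hV.primeIdealOf ⟨y, hyV⟩) y (hV.fromSpec_primeIdealOf _)
  let A : CommRingCat.{u} := localHenselization (Y.presheaf.stalk y)
  let : Algebra Γ(S, W) Γ(Y, V) := (p.appLE W V hVW).hom.toAlgebra
  let : Algebra Γ(Y, V) A := l.toAlgebra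
  let : Algebra Γ(S, W) A := (l.comp (p.appLE W V hVW).hom).toAlgebra
  have : IsScalarTower Γ(S, W) Γ(Y, V) A := .of_algebraMap_eq' rfl
  have : Algebra.IsStandardSmoothOfRelativeDimension (m + 1) Γ(S, W) Γ(Y, V) := hsm
  let e' : U ≅ Spec (.of A) := e
  -- The only closed point of `U` is the one of the local ring `A`.
  have hx' : e'.hom x = closedPoint A := by
    have h1 : IsClosed ({e'.hom x} : Set (Spec (.of A))) := by
      rw [← Set.image_singleton]
      exact e'.hom.isClosedEmbedding.isClosedMap _ hx
    have h2 := (PrimeSpectrum.isClosed_singleton_iff_isMaximal (R := A) (e'.hom x)).mp h1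
    exact PrimeSpectrum.ext (IsLocalRing.eq_maximalIdeal h2)
  have hl' : Spec.map (CommRingCat.ofHom l) ≫ hV.fromSpec ≫ p =
      Spec.map (p.appLE W V hVW ≫ CommRingCat.ofHom l) ≫ hW.fromSpec := by
    rw [Spec.map_comp, Category.assoc, IsAffineOpen.SpecMap_appLE_fromSpec]
  have hq : e'.hom ≫ Spec.map (CommRingCat.ofHom l) ≫ hV.fromSpec ≫ p = q := by
    have hj' : e'.hom ≫ Spec.map (CommRingCat.ofHom l) ≫ hV.fromSpec = j :=
      (congrArg (e'.hom ≫ ·) hlo).trans he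
    rw [← hj, ← hj', Category.assoc, Category.assoc]
  refine exists_hom_affineSpace_henselAffineSpace (A := A) (o := hW.fromSpec) m hl hfrac q e' ?_ x
    hx' hres i hZ
  rw [Iso.inv_comp_eq, ← hq, hl']
  rfl
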